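/- Let $S^1=\mathbb R/2\pi\mathbb Z$, let $f:S^1\to S^1$ be $C^\infty$, and let $\sigma:S^1\to(0,\infty)$ be $C^\infty$. Let $B(S^1)$ be the space of bounded Borel functions on $S^1$ with the sup norm (real-valued, complexified when spectra are considered). For $\varepsilon>0$ let $T^\varepsilon:B(S^1)\to B(S^1)$, $T^\varepsilon\phi(x)=\mathbb E[\phi(f(x)+\varepsilon\sigma(x)\chi)]$ with $\chi$ standard normal (addition mod $2\pi$), be the transition operator of the chain $X_{n+1}=f(X_n)+\varepsilon\sigma(X_n)\chi_n \bmod 2\pi$. Suppose $f$ has fixed points $x_s,x_u$ with $c_s=f'(x_s)\in(-1,1)$ and $c_u=f'(x_u)\notin[-1,1]$, and $f^n(x)\to x_s$ for every $x\ne x_u$. Put $\alpha=\sqrt{(1-c_s^2)/(2\sigma(x_s)^2)}$, $\beta=\sqrt{(c_u^2-1)/(2\sigma(x_u)^2)}$ and $h_j(x)=e^{-x^2}H_j(x)$, where $H_j$ is the (physicists') Hermite polynomial, $\sum_j H_j(x)z^j/j!=e^{2xz-z^2}$. An eigendensity of a bounded operator $T$ on $B(S^1)$ for $\lambda$ is a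 nonzero $\rho\in L^1(S^1)$ with $\int (T\phi)\rho\,dx=\lambda\int\phi\rho\,dx$ for all $\phi\in B(S^1)$. An eigenvalue is simple if its algebraic multiplicity is one. For $x$ in $S^1$, $x-x_s$ and $x-x_u$ denote the representatives in $(-\pi,\pi]$. **Theorem.** There are open balls $V_3$ around $x_s$ and $V_1$ around $x_u$, of radius less than $\pi$, and $k>0$ such that for every $r>0$ there are $\varepsilon_r,L_r,K_r>0$ such that for every $0<\varepsilon<\varepsilon_r$ one can write $T^\varepsilon=T^\varepsilon_{up}+T^\varepsilon_{lp}$ with bounded operators on $B(S^1)$ satisfying $\|T^\varepsilon_{lp}\|_\infty<r$ and the following. Every $\lambda\in\sigma(T^\varepsilon_{up})$ with $|\lambda|>r$ is a simple eigenvalue, and for some $j\ge 0$ it is of one of the following two types. (i) $|\lambda-c_s^j|\le L_r\varepsilon$, and the eigendensities of $T_{up}^\varepsilon$ for $\lambda$ are exactly the nonzero multiples (almost everywhere) of $$\Big[h_j\Big(\frac{\alpha(x-x_s)}{\varepsilon}\Big)+\varepsilon\,\psi\Big(\frac{x-x_s}{\varepsilon}\Big)\Big]\mathbf 1_{V_3}(x)$$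 for some function $\psi$ on $\mathbb R$ (depending on $\varepsilon$ and $j$) with $|\psi(y)|e^{ky^2}\le K_r$ for all $y\in\mathbb R$. (ii) $|\lambda-|c_u|^{-1}c_u^{-j}|\le L_r\varepsilon$, and the eigenfunctions of $T_{up}^\varepsilon$ for $\lambda$ are exactly the nonzero multiples of $$\Big[h_j\Big(\frac{\beta(x-x_u)}{\varepsilon}\Big)+\varepsilon\,\psi\Big(\frac{x-x_u}{\varepsilon}\Big)\Big]\mathbf 1_{V_1}(x)$$ for some function $\psi$ on $\mathbb R$ (depending on $\varepsilon$ and $j$) with $|\psi(y)|e^{ky^2}\le K_r$ for all $y\in\mathbb R$. Moreover all these limits occur: for every $j$ with $|c_s^j|>r$ there is $\lambda\in\sigma(T^\varepsilon_{up})$ as in (i), and for every $j$ with $|c_u|^{-1-j}>r$ there is $\lambda\in\sigma(T^\varepsilon_{up})$ as in (ii). -/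

import Mathlib

open MeasureTheory ProbabilityTheory Filter Topology
open scoped ENNReal ContDiff

noncomputable section

namespace CirclePert

instance instFactTwoPiPos : Fact (0 < 2 * Real.pi) := ⟨Real.two_pi_pos⟩

/-- The circle `ℝ / 2πℤ`, with its quotient metric, Borel sets and Lebesgue measure (total mass
`2π`). -/
abbrev S1 : Type := AddCircle (2 * Real.pi)

/-- The representative in `(-π, π]` of a point of the circle. -/
def rep (x : S1) : ℝ := (AddCircle.equivIoc (2 * Real.pi) (-Real.pi) x : ℝ)

/-- A self-map of the circle is smooth if it has a `C^∞` lift `ℝ → ℝ`. -/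
def IsSmoothMap (f : S1 → S1) : Prop :=
  ∃ F : ℝ → ℝ, ContDiff ℝ ∞ F ∧ ∀ t : ℝ, f (t : S1) = (F t : S1)

/-- A real function on the circle is smooth if the corresponding `2π`-periodic function on `ℝ`
is `C^∞`. -/
def IsSmoothFun (σ : S1 → ℝ) : Prop :=
  ContDiff ℝ ∞ (fun t : ℝ => σ (t : S1))

/-- The derivative `f'(x)` of a self-map of the circle, in the angular coordinates
`t ↦ x + t` at `x` and `y ↦ y - f x` at `f x`. -/
def circleDeriv (f : S1 → S1) (x : S1) : ℝ :=
  deriv (fun t : ℝ => rep (f (x + (t : S1)) - f x)) 0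

theorem IsSmoothMap.continuous {f : S1 → S1} (hf : IsSmoothMap f) : Continuous f := by
  obtain ⟨F, hF, h⟩ := hf
  refine (QuotientAddGroup.isQuotientMap_mk (N := AddSubgroup.zmultiples (2 * Real.pi))).continuous_iff.2 ?_
  have : f ∘ (fun t : ℝ => (t : S1)) = fun t : ℝ => (F t : S1) := funext h
  exact this ▸ (AddCircle.continuous_mk' (2 * Real.pi)).comp hF.continuous

theorem IsSmoothFun.continuous {σ : S1 → ℝ} (hσ : IsSmoothFun σ) : Continuous σ :=
  (QuotientAddGroup.isQuotientMap_mk (N := AddSubgroup.zmultiples (2 * Real.pi))).continuous_iff.2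
    (ContDiff.continuous hσ)

/-- The bounded Borel measurable functions `S1 → ℂ`, as a subspace of all bounded functions. -/
def bddMeasSubmodule : Submodule ℂ (lp (fun _ : S1 => ℂ) ∞) where
  carrier := {φ | Measurable (φ : S1 → ℂ)}
  add_mem' := fun {a b} ha hb => by
    change Measurable (a : S1 → ℂ) at ha
    change Measurable (b : S1 → ℂ) at hb
    change Measurable ((a + b : lp (fun _ : S1 => ℂ) ∞) : S1 → ℂ)
    rw [lp.coeFn_add]
    exact ha.add hb
  zero_mem' := by
    change Measurable ((0 : lp (fun _ : S1 => ℂ) ∞) : S1 → ℂ)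
    rw [lp.coeFn_zero]
    exact measurable_const
  smul_mem' := fun c a ha => by
    change Measurable (a : S1 → ℂ) at ha
    change Measurable ((c • a : lp (fun _ : S1 => ℂ) ∞) : S1 → ℂ)
    rw [lp.coeFn_smul]
    exact ha.const_smul c

/-- The Banach space `B(S1)` of bounded Borel measurable functions with the sup norm
(complex-valued, so that complex eigenvalues make sense). -/
abbrev B : Type := bddMeasSubmodule

instance instCoeFunB : CoeFun B (fun _ => S1 → ℂ) := ⟨fun φ => ⇑φ.1⟩

theorem B.measurable (φ : B) : Measurable (φ : S1 → ℂ) := φ.2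

theorem B.norm_apply_le (φ : B) (x : S1) : ‖φ x‖ ≤ ‖φ‖ :=
  lp.norm_apply_le_norm ENNReal.top_ne_zero φ.1 x

/-- `x ↦ 𝔼[φ(f(x) + ε σ(x) χ)]` with `χ` standard normal (addition modulo `2π`). -/
def transFun (f : S1 → S1) (σ : S1 → ℝ) (ε : ℝ) (φ : S1 → ℂ) (x : S1) : ℂ :=
  ∫ z : ℝ, φ (f x + ((ε * σ x * z : ℝ) : S1)) ∂(gaussianReal 0 1)

theorem measurable_kernelMap {f : S1 → S1} {σ : S1 → ℝ} (hf : Measurable f) (hσ : Measurable σ)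
    (ε : ℝ) : Measurable (fun p : S1 × ℝ => f p.1 + ((ε * σ p.1 * p.2 : ℝ) : S1)) := by
  have h1 : Measurable (fun p : S1 × ℝ => ε * σ p.1 * p.2) :=
    ((hσ.comp measurable_fst).const_mul ε).mul measurable_snd
  have h2 : Measurable (fun p : S1 × ℝ => ((ε * σ p.1 * p.2 : ℝ) : S1)) :=
    (AddCircle.continuous_mk' (2 * Real.pi)).measurable.comp h1
  exact (hf.comp measurable_fst).add h2

theorem measurable_transFun {f : S1 → S1} {σ : S1 → ℝ} (hf : Measurable f) (hσ : Measurable σ)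
    (ε : ℝ) (φ : B) : Measurable (transFun f σ ε φ) := by
  have h : StronglyMeasurable
      (fun p : S1 × ℝ => φ (f p.1 + ((ε * σ p.1 * p.2 : ℝ) : S1))) :=
    (φ.measurable.comp (measurable_kernelMap hf hσ ε)).stronglyMeasurable
  exact (h.integral_prod_right' (ν := gaussianReal 0 1)).measurable

theorem norm_transFun_le (f : S1 → S1) (σ : S1 → ℝ) (ε : ℝ) (φ : B) (x : S1) :
    ‖transFun f σ ε φ x‖ ≤ ‖φ‖ := by
  have h := norm_integral_le_of_norm_le_const (μ := gaussianReal 0 1)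
    (f := fun z : ℝ => φ (f x + ((ε * σ x * z : ℝ) : S1))) (C := ‖φ‖)
    (Eventually.of_forall fun _ => φ.norm_apply_le _)
  simpa [transFun] using h

theorem integrable_transFun {f : S1 → S1} {σ : S1 → ℝ} (hf : Measurable f) (hσ : Measurable σ)
    (ε : ℝ) (φ : B) (x : S1) :
    Integrable (fun z : ℝ => φ (f x + ((ε * σ x * z : ℝ) : S1))) (gaussianReal 0 1) :=
  Integrable.of_bound
    ((φ.measurable.comp
      ((measurable_kernelMap hf hσ ε).comp measurable_prodMk_left)).aestronglyMeasurable) ‖φ‖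
    (Eventually.of_forall fun _ => φ.norm_apply_le _)

/-- The Markov transition operator `T^ε` on `B(S1)` of the chain
`X_{n+1} = f(X_n) + ε σ(X_n) χ_n mod 2π`. -/
def transOp (f : S1 → S1) (σ : S1 → ℝ) (hf : Measurable f) (hσ : Measurable σ) (ε : ℝ) :
    B →L[ℂ] B :=
  LinearMap.mkContinuous
    { toFun := fun φ =>
        ⟨⟨transFun f σ ε φ, memℓp_infty ⟨‖φ‖, by
            rintro _ ⟨x, rfl⟩
            exact norm_transFun_le f σ ε φ x⟩⟩,
          measurable_transFun hf hσ ε φ⟩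
      map_add' := fun φ ψ => by
        ext x
        exact integral_add (integrable_transFun hf hσ ε φ x) (integrable_transFun hf hσ ε ψ x)
      map_smul' := fun c φ => by
        ext x
        exact integral_const_mul c _ }
    1 (fun φ => by
      rw [one_mul]
      exact lp.norm_le_of_forall_le (norm_nonneg φ) (norm_transFun_le f σ ε φ))

/-- An operator on `B(S1)` which is the complexification of an operator on the real-valued bounded
measurable functions. -/
def IsRealOp (T : B →L[ℂ] B) : Prop :=
  ∀ φ : B, (∀ x, (φ x).im = 0) → ∀ x, (T φ x).im = 0

/-- `μ` is an eigenvalue of `T` of algebraic multiplicity one. -/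
def IsSimpleEigenvalue (T : B →L[ℂ] B) (μ : ℂ) : Prop :=
  Module.finrank ℂ (Module.End.maxGenEigenspace (T : Module.End ℂ B) μ) = 1

/-- `φ` is an eigenfunction of `T` for `μ`. -/
def IsEigenfunction (T : B →L[ℂ] B) (μ : ℂ) (φ : B) : Prop :=
  φ ≠ 0 ∧ T φ = μ • φ

/-- `ρ` is an eigendensity of `T` for `μ`: a nonzero integrable density for which the (complex)
measure `m = ρ dx` satisfies `m T = μ m`, i.e. `∫ T φ dm = μ ∫ φ dm` for all `φ ∈ B(S1)`. -/
def IsEigendensity (T : B →L[ℂ] B) (μ : ℂ) (ρ : S1 → ℂ) : Prop :=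
  Integrable ρ volume ∧ ¬ (ρ =ᵐ[volume] 0) ∧
    ∀ φ : B, ∫ x, T φ x * ρ x = μ * ∫ x, φ x * ρ x

/-- The Hermite function `h_j(x) = exp(-x²) H_j(x)`. Here `H_j` is the physicists' Hermite
polynomial `H_j(x) = 2^(j/2) He_j(√2 x)`, with generating function `exp(2xz - z²)`, and `He_j` is
the probabilists' one. -/
def hermiteFn (j : ℕ) (x : ℝ) : ℝ :=
  Real.exp (-x ^ 2) * ((√2) ^ j * Polynomial.aeval (√2 * x) (Polynomial.hermite j))

/-- `x ↦ [h_j(a (x - x₀)/ε) + ε ψ((x - x₀)/ε)] 1_V(x)`, where `V` is the open ball of radius `δ`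
around `x₀`. -/
def profile (j : ℕ) (a ε : ℝ) (ψ : ℝ → ℂ) (x₀ : S1) (δ : ℝ) : S1 → ℂ :=
  Set.indicator (Metric.ball x₀ δ) fun x =>
    (hermiteFn j (a * rep (x - x₀) / ε) : ℂ) + (ε : ℂ) * ψ (rep (x - x₀) / ε)

/-- The correction `ψ` has the Gaussian decay `|ψ(y)| exp(k y²) ≤ K`. -/
def GaussianDecay (k K : ℝ) (ψ : ℝ → ℂ) : Prop :=
  ∀ y : ℝ, ‖ψ y‖ * Real.exp (k * y ^ 2) ≤ K

/-- The eigendensities of `T` for `μ` are exactly the nonzero multiples of a function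
`[h_j(a (x - x₀)/ε) + ε ψ((x - x₀)/ε)] 1_V(x)`, with `V` the ball of radius `δ` around `x₀` and `ψ`
of Gaussian decay. -/
def HermiteEigendensities (T : B →L[ℂ] B) (μ : ℂ) (j : ℕ) (a ε : ℝ) (x₀ : S1) (δ k K : ℝ) :
    Prop :=
  ∃ ψ : ℝ → ℂ, GaussianDecay k K ψ ∧
    IsEigendensity T μ (profile j a ε ψ x₀ δ) ∧
    ∀ ρ : S1 → ℂ, IsEigendensity T μ ρ →
      ∃ b : ℂ, ρ =ᵐ[volume] fun x => b * profile j a ε ψ x₀ δ x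

/-- The eigenfunctions of `T` for `μ` are exactly the nonzero multiples of a function
`[h_j(a (x - x₀)/ε) + ε ψ((x - x₀)/ε)] 1_V(x)`, with `V` the ball of radius `δ` around `x₀` and `ψ`
of Gaussian decay. -/
def HermiteEigenfunctions (T : B →L[ℂ] B) (μ : ℂ) (j : ℕ) (a ε : ℝ) (x₀ : S1) (δ k K : ℝ) :
    Prop :=
  ∃ ψ : ℝ → ℂ, GaussianDecay k K ψ ∧
    (∃ φ : B, IsEigenfunction T μ φ ∧ ∀ x, φ x = profile j a ε ψ x₀ δ x) ∧
    ∀ φ : B, IsEigenfunction T μ φ →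
      ∃ b : ℂ, ∀ x, φ x = b * profile j a ε ψ x₀ δ x

/-- `α = √((1 - c²)/(2 s²))`, for the derivative `c` and the noise intensity `s` at a stable fixed
point. -/
def stableScale (c s : ℝ) : ℝ := √((1 - c ^ 2) / (2 * s ^ 2))

/-- `β = √((c² - 1)/(2 s²))`, for the derivative `c` and the noise intensity `s` at an unstable
fixed point. -/
def unstableScale (c s : ℝ) : ℝ := √((c ^ 2 - 1) / (2 * s ^ 2))

end CirclePert

end

open CirclePert

/-! Since the remainder only needs norm below r, the main part may be an explicit model whose
eigendata are exact; ψ then merely records that Hermite functions are cut off at the boundary of a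
small chart. The charts around the fixed points have radius κρ with κ proportional to ε and ρ =
ε^(-1/4): then ρ → ∞, while κρ² → 0 makes the quadratic error of linearization negligible at the
scale of the noise.

Stable point. In the coordinate t = √2 α (x - x_s)/ε the linearized chain is t ↦ c t + √(1 - c²) χ,
which preserves the standard Gaussian γ. Its operator `ou` is self-adjoint in L²(γ) (`ou_symm`), the
Hermite polynomials are a complete orthogonal family of eigenvectors with eigenvalues c^j, and so it
contracts by |c|^N off the first N of them (`integral_norm_ou_sq_le`). As left eigenvectors they are
the functionals φ ↦ ∫ φ He_j dγ, whose Lebesgue densities are Hermite functions. Smoothing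
(`exists_norm_ou_le_L2`) passes from L² to the sup norm.

Unstable point. With c = 1/c_u, conjugation by exp(-t²/2) turns the expanding chain into |c| times
the contracting operator `ou c` (`integral_expanding`). Hence the eigenvalues |c| c^j, now with
Hermite functions as right eigenvectors; the spectral bound follows from the stable one by duality.

Elsewhere. With the noise truncated at a large level M, trajectories are pseudo-orbits with jumps
O(ε). By `exists_no_long_pseudoOrbit` they meet a chart within a bounded number of steps, so the
operator outside the charts is nilpotent.

Assembly. The model never goes from outside back to the unstable chart and never leaves the stable
chart, so it is block triangular, and only the diagonal blocks matter for the spectrum away from 0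
(`notMem_spectrum_add_of_mul_eq_zero`). The N leading modes are removed from each block, leaving
spectral radius at most r/2, and are put back as rank one terms with prescribed eigenvalues;
`Deflated` reads off spectrum, simplicity, eigenvectors and eigenfunctionals. The prescribed values
are c_s^i and |c| c^j (1 + ε); the factor 1 + ε prevents coincidences between the two families and
costs only O(ε). -/

noncomputable section

namespace CirclePert

/-! ### Spectra of triangular sums, nilpotents and elements with decaying powers -/

section Spectral

variable {A : Type*} [NormedRing A] [NormedAlgebra ℂ A]

/-- When ab = 0 one has (z - a)(z - b) = z (z - (a + b)). This is the way block triangularity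
enters: away from 0 the spectrum of the sum lies in the union of the two spectra. -/
theorem notMem_spectrum_add_of_mul_eq_zero {a b : A} (hab : a * b = 0) {z : ℂ} (hz : z ≠ 0)
    (ha : z ∉ spectrum ℂ a) (hb : z ∉ spectrum ℂ b) : z ∉ spectrum ℂ (a + b) := by
  rw [spectrum.notMem_iff] at *
  have h : (algebraMap ℂ A z - a) * (algebraMap ℂ A z - b)
      = algebraMap ℂ A z * (algebraMap ℂ A z - (a + b)) := by
    have := Algebra.commutes z a
    rw [sub_mul, mul_sub, mul_sub, mul_sub, hab, mul_add, ← this]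
    abel
  have h1 : IsUnit (algebraMap ℂ A z) := (IsUnit.mk0 z hz).map (algebraMap ℂ A)
  have h2 := ha.mul hb
  rw [h] at h2
  obtain ⟨u, hu⟩ := h1
  rw [← hu] at h2 ⊢
  exact (Units.isUnit_units_mul u _).1 h2

theorem notMem_spectrum_of_pow_eq_zero {a : A} {n : ℕ} (ha : a ^ n = 0) {z : ℂ} (hz : z ≠ 0) :
    z ∉ spectrum ℂ a := by
  intro h
  have h1 := spectrum.pow_mem_pow a n h
  rw [ha] at h1
  cases subsingleton_or_nontrivial A
  · simp [spectrum.of_subsingleton] at h1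
  · rw [spectrum.zero_eq] at h1
    exact pow_ne_zero n hz h1

/-- The power z^(n+k) lies in the spectrum of a^(n+k), so its modulus is at most a constant times
the norm. The shift k admits bounds in which a fixed number of factors is spent on changing norms.
-/
theorem notMem_spectrum_of_norm_pow_le [CompleteSpace A] {a : A} {C θ : ℝ} (hθ : 0 ≤ θ) {k : ℕ}
    (ha : ∀ n : ℕ, ‖a ^ (n + k)‖ ≤ C * θ ^ n) {z : ℂ} (hz : θ < ‖z‖) : z ∉ spectrum ℂ a := by
  intro h
  have hz0 : 0 < ‖z‖ := hθ.trans_lt hz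
  have h1 : ∀ n : ℕ, ‖z‖ ^ k ≤ C * ‖(1 : A)‖ * (θ / ‖z‖) ^ n := fun n => by
    have h2 := spectrum.norm_le_norm_mul_of_mem (spectrum.pow_mem_pow a (n + k) h)
    rw [norm_pow, pow_add] at h2
    have h3 := h2.trans (mul_le_mul_of_nonneg_right (ha n) (norm_nonneg (1 : A)))
    rw [div_pow, mul_div_assoc', le_div_iff₀ (by positivity)]
    linarith
  have h2 : Tendsto (fun n : ℕ => C * ‖(1 : A)‖ * (θ / ‖z‖) ^ n) atTop (𝓝 (C * ‖(1 : A)‖ * 0)) :=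
    (tendsto_pow_atTop_nhds_zero_of_lt_one (by positivity)
      ((div_lt_one hz0).2 hz)).const_mul _
  have h3 := ge_of_tendsto' h2 h1
  rw [mul_zero] at h3
  exact absurd h3 (not_le.2 (by positivity))

end Spectral

/-! ### Finite rank terms: eigenvalues, eigenvectors and eigenfunctionals -/

section Deflation

variable {E : Type*} [NormedAddCommGroup E] [NormedSpace ℂ E]

/-- A continuous linear operator `R` together with finitely many rank one terms: the vectors `φ` are
killed by `R`, the functionals `m` kill the range of `R`. -/
structure Deflated (N : ℕ) (R T : E →L[ℂ] E) (φ g : Fin N → E) (l m : Fin N → E →L[ℂ] ℂ)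
    (μ lam : Fin N → ℂ) : Prop where
  eq : ∀ u, T u = R u + ∑ j, (μ j * l j u) • φ j + ∑ i, (lam i * m i u) • g i
  R_φ : ∀ j, R (φ j) = 0
  m_R : ∀ i u, m i (R u) = 0
  m_φ : ∀ i j, m i (φ j) = 0
  l_φ : ∀ i j, l i (φ j) = if i = j then 1 else 0
  m_g : ∀ i j, m i (g j) = if i = j then 1 else 0

namespace Deflated

variable {N : ℕ} {R T : E →L[ℂ] E} {φ g : Fin N → E} {l m : Fin N → E →L[ℂ] ℂ}
  {μ lam : Fin N → ℂ}

theorem m_T (h : Deflated N R T φ g l m μ lam) (i : Fin N) (u : E) :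
    m i (T u) = lam i * m i u := by
  rw [h.eq]
  simp [h.m_R, h.m_φ, h.m_g]

theorem T_φ (h : Deflated N R T φ g l m μ lam) (j : Fin N) : T (φ j) = μ j • φ j := by
  rw [h.eq]
  simp [h.R_φ, h.m_φ, h.l_φ]

theorem φ_ne_zero (h : Deflated N R T φ g l m μ lam) (j : Fin N) : φ j ≠ 0 := by
  intro h0
  have := h.l_φ j j
  simp [h0] at this

theorem exists_resolvent [CompleteSpace E] {z : ℂ} (hz : z ∉ spectrum ℂ R) :
    (∀ v, ∃ u, R u - z • u = v) ∧ ∀ u, R u = z • u → u = 0 := by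
  rw [spectrum.notMem_iff] at hz
  have hb := ContinuousLinearMap.isUnit_iff_bijective.1 hz
  have happ : ∀ u, (algebraMap ℂ (E →L[ℂ] E) z - R) u = z • u - R u := fun u => by
    simp [Algebra.algebraMap_eq_smul_one]
  refine ⟨fun v => ?_, fun u hu => ?_⟩
  · obtain ⟨u, hu⟩ := hb.2 (-v)
    refine ⟨u, ?_⟩
    rw [happ] at hu
    rw [← neg_sub, hu, neg_neg]
  · apply hb.1
    rw [happ, hu, map_zero, sub_self]

/-- Solutions of the perturbed eigenvalue equation which are annihilated by all `m i`. -/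
theorem eq_sum_of_ker [CompleteSpace E] (h : Deflated N R T φ g l m μ lam) {z : ℂ} (hz : z ∉ spectrum ℂ R)
    (hz0 : z ≠ 0) {u : E} (hm : ∀ i, m i u = 0) {b : Fin N → ℂ}
    (hu : T u - z • u = ∑ j, b j • φ j) :
    u = ∑ j, l j u • φ j ∧ ∀ j, (μ j - z) * l j u = b j := by
  have h1 : R u - z • u = ∑ j, (b j - μ j * l j u) • φ j := by
    have := h.eq u
    simp only [hm, mul_zero, zero_smul, Finset.sum_const_zero, add_zero] at this
    simp only [sub_smul, Finset.sum_sub_distrib, ← hu, this]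
    abel
  -- `R` annihilates every `φ j`, so -z⁻¹ times the right side of `h1` solves the same equation as
  -- `u`, and R - z is injective.
  have h2 : u = ∑ j, (z⁻¹ * (μ j * l j u - b j)) • φ j := by
    rw [← sub_eq_zero]
    apply (exists_resolvent hz).2
    rw [map_sub, map_sum]
    simp only [map_smul, h.R_φ, smul_zero, Finset.sum_const_zero, sub_zero]
    rw [smul_sub, Finset.smul_sum, ← sub_eq_zero, ← sub_add, h1, ← Finset.sum_add_distrib]
    refine Finset.sum_eq_zero fun j _ => ?_
    rw [smul_smul, mul_inv_cancel_left₀ hz0, ← add_smul]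
    ring_nf
    simp
  have h3 : ∀ k, l k u = z⁻¹ * (μ k * l k u - b k) := fun k => by
    conv_lhs => rw [h2]
    simp [h.l_φ]
  refine ⟨?_, fun k => ?_⟩
  · conv_lhs => rw [h2]
    exact Finset.sum_congr rfl fun j _ => by rw [← h3]
  · have := h3 k
    field_simp at this
    linear_combination -this

/-- On the common kernel of the `m i` only `R` and the `φ` terms act. The resolvent of `R` solves
the equation up to a combination of the `φ j`, which are eigenvectors of `T`; the correction divides
by μ j - z. -/
theorem exists_solution_ker [CompleteSpace E] (h : Deflated N R T φ g l m μ lam) {z : ℂ} (hz : z ∉ spectrum ℂ R)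
    (hz0 : z ≠ 0) (hμ : ∀ j, μ j ≠ z) {v : E} (hv : ∀ i, m i v = 0) :
    ∃ u, T u - z • u = v ∧ ∀ i, m i u = 0 := by
  obtain ⟨u, hu⟩ := (exists_resolvent hz).1 v
  have hmu : ∀ i, m i u = 0 := fun i => by
    have := congrArg (m i) hu
    simpa [h.m_R, hv, hz0] using this
  refine ⟨u - ∑ j, (μ j * l j u / (μ j - z)) • φ j, ?_, fun i => ?_⟩
  · have := h.eq u
    simp only [hmu, mul_zero, zero_smul, Finset.sum_const_zero, add_zero] at this
    rw [map_sub, map_sum, this, ← hu, smul_sub, Finset.smul_sum]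
    simp only [map_smul, h.T_φ, smul_smul]
    have h2 : ∑ j, (μ j * l j u) • φ j = ∑ j, (μ j * l j u / (μ j - z) * μ j) • φ j
        - ∑ j, (z * (μ j * l j u / (μ j - z))) • φ j := by
      rw [← Finset.sum_sub_distrib]
      refine Finset.sum_congr rfl fun j _ => ?_
      rw [← sub_smul]
      congr 1
      have := sub_ne_zero.2 (hμ j)
      field_simp
    rw [h2]
    abel
  · simp [hmu, h.m_φ]

/-- The common kernel of the `m i` is invariant, and on the quotient by it `T` is diagonal with
entries `lam i`. Injectivity and surjectivity of T - z are checked on both pieces. -/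
theorem notMem_spectrum [CompleteSpace E] (h : Deflated N R T φ g l m μ lam) {z : ℂ} (hz : z ∉ spectrum ℂ R)
    (hz0 : z ≠ 0) (hμ : ∀ j, μ j ≠ z) (hlam : ∀ i, lam i ≠ z) : z ∉ spectrum ℂ T := by
  rw [spectrum.notMem_iff, ContinuousLinearMap.isUnit_iff_bijective]
  have happ : ∀ u, (algebraMap ℂ (E →L[ℂ] E) z - T) u = -(T u - z • u) := fun u => by
    simp [Algebra.algebraMap_eq_smul_one]
  constructor
  · rw [injective_iff_map_eq_zero]
    intro u hu
    rw [happ, neg_eq_zero] at hu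
    have hm : ∀ i, m i u = 0 := fun i => by
      have := congrArg (m i) hu
      rw [map_sub, h.m_T, map_smul, smul_eq_mul, ← sub_mul, map_zero, mul_eq_zero] at this
      exact this.resolve_left (sub_ne_zero.2 (hlam i))
    have h1 := h.eq_sum_of_ker hz hz0 hm (b := 0) (by simp [hu])
    rw [h1.1]
    refine Finset.sum_eq_zero fun j _ => ?_
    have := h1.2 j
    rw [Pi.zero_apply, mul_eq_zero] at this
    rw [this.resolve_left (sub_ne_zero.2 (hμ j)), zero_smul]
  · intro v
    set u0 := ∑ i, (m i (-v) / (lam i - z)) • g i with hu0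
    have hmu : ∀ i, m i u0 = m i (-v) / (lam i - z) := fun i => by
      simp [hu0, h.m_g]
    obtain ⟨u, hu, -⟩ := h.exists_solution_ker hz hz0 hμ (v := -v - (T u0 - z • u0)) (fun i => by
      have := sub_ne_zero.2 (hlam i)
      rw [map_sub, map_sub, h.m_T, map_smul, hmu, smul_eq_mul]
      field_simp
      ring)
    refine ⟨u + u0, ?_⟩
    rw [happ, map_add, smul_add]
    have : T u + T u0 - (z • u + z • u0) = -v := by
      rw [← sub_eq_zero, ← sub_eq_zero.2 hu]
      abel
    rw [this, neg_neg]

theorem mem_spectrum_of_eigenvector [CompleteSpace E] {z : ℂ} {e : E} (he : e ≠ 0)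
    (hT : T e = z • e) : z ∈ spectrum ℂ T := by
  intro hmem
  rw [spectrum.mem_resolventSet_iff, ContinuousLinearMap.isUnit_iff_bijective] at hmem
  apply he
  apply hmem.1
  simp [Algebra.algebraMap_eq_smul_one, hT]

theorem pow_apply_m (h : Deflated N R T φ g l m μ lam) (z : ℂ) (n : ℕ) (i : Fin N) (u : E) :
    m i ((((T : Module.End ℂ E) - z • 1) ^ n) u) = (lam i - z) ^ n * m i u := by
  induction n with
  | zero => simp
  | succ n ih =>
    rw [pow_succ', Module.End.mul_apply]
    have : ∀ w, m i (((T : Module.End ℂ E) - z • 1) w) = (lam i - z) * m i w := fun w => by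
      simp [h.m_T, sub_mul]
    rw [this, ih, pow_succ']
    ring

/-- As no `lam i` equals z, every `m i` kills a generalized eigenvector. Then `eq_sum_of_ker`
applies, and descending through the powers of T - z shows that one never leaves the line of `φ j`.
-/
theorem finrank_maxGenEigenspace_φ [CompleteSpace E] (h : Deflated N R T φ g l m μ lam) {z : ℂ}
    (hz : z ∉ spectrum ℂ R) (hz0 : z ≠ 0) (hlam : ∀ i, lam i ≠ z) {j : Fin N} (hj : μ j = z)
    (hμ : ∀ k, k ≠ j → μ k ≠ z) :
    Module.finrank ℂ (Module.End.maxGenEigenspace (T : Module.End ℂ E) z) = 1 ∧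
      ∀ u, T u = z • u → ∃ b : ℂ, u = b • φ j := by
  have key : ∀ n : ℕ, ∀ u, (((T : Module.End ℂ E) - z • 1) ^ n) u = 0 → ∃ b : ℂ, u = b • φ j := by
    intro n
    induction n with
    | zero => intro u hu; exact ⟨0, by simpa using hu⟩
    | succ n ih =>
      intro u hu
      have hm : ∀ i, m i u = 0 := fun i => by
        have := h.pow_apply_m z (n + 1) i u
        rw [hu, map_zero, eq_comm, mul_eq_zero] at this
        exact this.resolve_left (pow_ne_zero _ (sub_ne_zero.2 (hlam i)))
      rw [pow_succ, Module.End.mul_apply] at hu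
      obtain ⟨b, hb⟩ := ih _ hu
      have hb' : T u - z • u = ∑ k, (if k = j then b else 0) • φ k := by
        simpa [ite_smul] using hb
      obtain ⟨h1, h2⟩ := h.eq_sum_of_ker hz hz0 hm hb'
      refine ⟨l j u, h1.trans (Finset.sum_eq_single j (fun k _ hk => ?_) (by simp))⟩
      have := h2 k
      rw [if_neg hk, mul_eq_zero] at this
      rw [this.resolve_left (sub_ne_zero.2 (hμ k hk)), zero_smul]
  have hs : Module.End.maxGenEigenspace (T : Module.End ℂ E) z = Submodule.span ℂ {φ j} := by
    ext u
    rw [Module.End.mem_maxGenEigenspace, Submodule.mem_span_singleton]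
    constructor
    · rintro ⟨n, hn⟩
      obtain ⟨b, hb⟩ := key n u hn
      exact ⟨b, hb.symm⟩
    · rintro ⟨b, rfl⟩
      exact ⟨1, by simp [h.T_φ, hj]⟩
  refine ⟨?_, fun u hu => key 1 u (by simp [hu])⟩
  rw [hs, finrank_span_singleton (h.φ_ne_zero j)]

/-- Every v in the common kernel of the `m i` is of the form (T - z)u, so `M` vanishes there and is
a combination of the `m k`; comparing eigenvalues leaves only the index i. Continuity of `M` plays
no role, which lets integration against an L¹ density be inserted directly. -/
theorem eigenfunctional_lam [CompleteSpace E] (h : Deflated N R T φ g l m μ lam) {z : ℂ}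
    (hz : z ∉ spectrum ℂ R) (hz0 : z ≠ 0) (hμ : ∀ j, μ j ≠ z) {i : Fin N}
    (hlam : ∀ k, k ≠ i → lam k ≠ z) (M : E →ₗ[ℂ] ℂ) (hM : ∀ u, M (T u) = z * M u) :
    ∃ b : ℂ, ∀ u, M u = b * m i u := by
  have hker : ∀ v, (∀ i, m i v = 0) → M v = 0 := fun v hv => by
    obtain ⟨u, hu, -⟩ := h.exists_solution_ker hz hz0 hμ hv
    rw [← hu, map_sub, hM, map_smul, smul_eq_mul, sub_self]
  have hg : ∀ k, k ≠ i → M (g k) = 0 := fun k hk => by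
    have h1 : M (T (g k) - lam k • g k) = 0 := hker _ fun a => by
      rw [map_sub, h.m_T, map_smul, h.m_g]
      by_cases hak : a = k <;> simp [hak]
    rw [map_sub, hM, map_smul, smul_eq_mul, ← sub_mul, mul_eq_zero] at h1
    exact h1.resolve_left (sub_ne_zero.2 (hlam k hk).symm)
  refine ⟨M (g i), fun u => ?_⟩
  have h1 := hker (u - ∑ k, m k u • g k) fun a => by simp [h.m_g]
  rw [map_sub, sub_eq_zero, map_sum] at h1
  rw [h1, Finset.sum_eq_single i (fun k _ hk => by simp [hg k hk]) (by simp)]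
  simp [mul_comm]

/-- The vector `g i` is an eigenvector only modulo the common kernel of the `m a`; a correction `w`
from that kernel makes it exact. Since T - z is injective on the kernel, a generalized eigenvector
is determined by its coordinate `m i`. -/
theorem finrank_maxGenEigenspace_lam [CompleteSpace E] (h : Deflated N R T φ g l m μ lam) {z : ℂ}
    (hz : z ∉ spectrum ℂ R) (hz0 : z ≠ 0) (hμ : ∀ j, μ j ≠ z) {i : Fin N} (hi : lam i = z)
    (hlam : ∀ k, k ≠ i → lam k ≠ z) :
    Module.finrank ℂ (Module.End.maxGenEigenspace (T : Module.End ℂ E) z) = 1 ∧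
      z ∈ spectrum ℂ T := by
  obtain ⟨w, hw, hmw⟩ := h.exists_solution_ker hz hz0 hμ (v := T (g i) - z • g i) fun a => by
    rw [map_sub, h.m_T, map_smul, h.m_g]
    by_cases hai : a = i <;> simp [hai, hi]
  set e := g i - w with he
  have hme : ∀ a, m a e = if a = i then 1 else 0 := fun a => by simp [he, hmw, h.m_g]
  have he0 : e ≠ 0 := fun h0 => by
    have := hme i
    simp [h0] at this
  have hTe : T e = z • e := by
    rw [he, map_sub, smul_sub, ← sub_eq_zero, ← sub_eq_zero.2 hw.symm]
    abel
  have hinj : ∀ n : ℕ, ∀ u, (∀ a, m a u = 0) → (((T : Module.End ℂ E) - z • 1) ^ n) u = 0 →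
      u = 0 := by
    intro n
    induction n with
    | zero => intro u _ hu; simpa using hu
    | succ n ih =>
      intro u hm hu
      rw [pow_succ, Module.End.mul_apply] at hu
      have h1 := ih _ (fun a => by simp [h.m_T, hm]) hu
      obtain ⟨h2, h3⟩ := h.eq_sum_of_ker hz hz0 hm (b := 0) (by simpa using h1)
      rw [h2]
      refine Finset.sum_eq_zero fun k _ => ?_
      have := h3 k
      rw [Pi.zero_apply, mul_eq_zero] at this
      rw [this.resolve_left (sub_ne_zero.2 (hμ k)), zero_smul]
  have hpe : ∀ n : ℕ, n ≠ 0 → (((T : Module.End ℂ E) - z • 1) ^ n) e = 0 := fun n hn => by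
    obtain ⟨k, rfl⟩ := Nat.exists_eq_succ_of_ne_zero hn
    rw [pow_succ, Module.End.mul_apply]
    simp [hTe]
  have hs : Module.End.maxGenEigenspace (T : Module.End ℂ E) z = Submodule.span ℂ {e} := by
    ext u
    rw [Module.End.mem_maxGenEigenspace, Submodule.mem_span_singleton]
    constructor
    · rintro ⟨n, hn⟩
      rcases Nat.eq_zero_or_pos n with rfl | hpos
      · exact ⟨0, by simpa [eq_comm] using hn⟩
      refine ⟨m i u, ?_⟩
      rw [eq_comm, ← sub_eq_zero]
      refine hinj n _ (fun a => ?_) ?_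
      · rw [map_sub, map_smul, hme]
        by_cases hai : a = i
        · simp [hai]
        · have := h.pow_apply_m z n a u
          rw [hn, map_zero, eq_comm, mul_eq_zero] at this
          rw [this.resolve_left (pow_ne_zero _ (sub_ne_zero.2 (hlam a hai)))]
          simp [hai]
      · rw [map_sub, map_smul, hn, hpe n hpos.ne']
        simp
    · rintro ⟨b, rfl⟩
      exact ⟨1, by simp [hTe]⟩
  refine ⟨?_, mem_spectrum_of_eigenvector he0 hTe⟩
  rw [hs, finrank_span_singleton he0]

end Deflated
end Deflation

/-! ### The Ornstein-Uhlenbeck operator and Hermite polynomials in Gaussian L² -/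

/-- The standard Gaussian measure on the line. -/
abbrev stdG : Measure ℝ := gaussianReal 0 1

/-- The probabilists' Hermite polynomial as a real function. -/
def He (j : ℕ) (t : ℝ) : ℝ := ((Polynomial.hermite j).map (Int.castRingHom ℝ)).eval t

/-- The Ornstein-Uhlenbeck (Mehler) operator `u ↦ 𝔼[u(c t + √(1 - c²) χ)]`. -/
def ou (c : ℝ) (u : ℝ → ℂ) (t : ℝ) : ℂ := ∫ z, u (c * t + √(1 - c ^ 2) * z) ∂stdG

theorem He_eq_aeval (j : ℕ) (t : ℝ) : He j t = Polynomial.aeval t (Polynomial.hermite j) := by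
  rw [He, Polynomial.eval_map, Polynomial.aeval_def]
  rfl

theorem continuous_He (j : ℕ) : Continuous (He j) := Polynomial.continuous _

theorem integrable_polynomial (p : Polynomial ℝ) : Integrable (fun x => p.eval x) stdG := by
  simp_rw [Polynomial.eval_eq_sum_range]
  refine integrable_finsetSum _ fun i _ => Integrable.const_mul ?_ _
  rcases Nat.eq_zero_or_pos i with rfl | hi
  · simp
  have h := (memLp_id_gaussianReal' (μ := 0) (v := 1) (i : ℝ≥0∞) (ENNReal.natCast_ne_top i))
  have h2 := h.integrable_norm_pow hi.ne'
  refine h2.mono' (by fun_prop) (Eventually.of_forall fun x => ?_)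
  simp

theorem memLp_polynomial (p : Polynomial ℝ) : MemLp (fun x => p.eval x) 2 stdG := by
  rw [memLp_two_iff_integrable_sq (Polynomial.continuous p).aestronglyMeasurable]
  simp_rw [← Polynomial.eval_pow]
  exact integrable_polynomial (p ^ 2)

theorem memLp_He (j : ℕ) : MemLp (fun x => (He j x : ℂ)) 2 stdG :=
  (memLp_polynomial _).ofReal

/-- Gaussian integration by parts: for the density g, the derivative of g p is g (p' - x p), and its
integral over the line vanishes. -/
theorem integral_mul_polynomial (p : Polynomial ℝ) :
    ∫ z, z * p.eval z ∂stdG = ∫ z, p.derivative.eval z ∂stdG := by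
  have hint : ∀ q : Polynomial ℝ, Integrable (fun x => gaussianPDFReal 0 1 x * q.eval x) volume := by
    intro q
    have h := integrable_polynomial q
    rw [stdG, gaussianReal_of_var_ne_zero _ one_ne_zero,
      integrable_withDensity_iff_integrable_smul' (measurable_gaussianPDF _ _)
        (ae_of_all _ fun _ => gaussianPDF_lt_top)] at h
    simpa using h
  have hd : ∀ x, HasDerivAt (fun x => gaussianPDFReal 0 1 x * p.eval x)
      (gaussianPDFReal 0 1 x * (p.derivative - Polynomial.X * p).eval x) x := fun x => by
    have h1 : HasDerivAt (fun x => gaussianPDFReal 0 1 x) (gaussianPDFReal 0 1 x * (-x)) x := by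
      simp only [gaussianPDFReal, sub_zero, NNReal.coe_one, mul_one]
      have : HasDerivAt (fun x : ℝ => -x ^ 2 / 2) (-x) x := by
        have := ((hasDerivAt_pow 2 x).neg.div_const 2)
        exact this.congr_deriv (by simp; ring)
      exact (this.exp.const_mul ((√(2 * Real.pi))⁻¹)).congr_deriv (by ring)
    refine (h1.mul (p.hasDerivAt x)).congr_deriv ?_
    simp only [Polynomial.eval_sub, Polynomial.eval_mul, Polynomial.eval_X]
    ring
  have h0 := integral_eq_zero_of_hasDerivAt_of_integrable hd (hint _) (hint _)
  have h1 := integral_gaussianReal_eq_integral_smul (μ := 0) (v := 1)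
    (f := fun x => (p.derivative - Polynomial.X * p).eval x) one_ne_zero
  simp only [smul_eq_mul] at h1
  rw [h0] at h1
  have h2 : ∫ z, (p.derivative.eval z - z * p.eval z) ∂stdG = 0 := by
    rw [← h1]
    simp
  have h3 : Integrable (fun z => z * p.eval z) stdG := by
    have := integrable_polynomial (Polynomial.X * p)
    simp_rw [Polynomial.eval_mul, Polynomial.eval_X] at this
    exact this
  rw [integral_sub (integrable_polynomial _) h3, sub_eq_zero] at h2
  exact h2.symm

theorem derivative_hermite_succ (n : ℕ) : Polynomial.derivative (Polynomial.hermite (n + 1)) =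
    ((n : Polynomial ℤ) + 1) * Polynomial.hermite n := by
  induction n with
  | zero => simp [Polynomial.hermite_succ]
  | succ n ih =>
    rw [Polynomial.hermite_succ (n + 1), Polynomial.derivative_sub, Polynomial.derivative_mul,
      ih, Polynomial.derivative_mul]
    have := Polynomial.hermite_succ n
    simp only [Polynomial.derivative_X, Polynomial.derivative_add, Polynomial.derivative_natCast,
      Polynomial.derivative_one]
    push_cast
    linear_combination (-(n + 1 : Polynomial ℤ)) * this

theorem He_zero (t : ℝ) : He 0 t = 1 := by simp [He]

theorem He_one (t : ℝ) : He 1 t = t := by simp [He]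

theorem He_succ_succ (j : ℕ) (t : ℝ) : He (j + 2) t = t * He (j + 1) t - (j + 1) * He j t := by
  have := Polynomial.hermite_succ (j + 1)
  rw [derivative_hermite_succ] at this
  simp [He, this, -Polynomial.hermite_succ]

/-- Two-step induction along the recurrence He_{j+2} = t He_{j+1} - (j+1) He_j. Integration by parts
handles the factor z, and s² = 1 - c² makes the terms with He_j combine. -/
theorem integral_He (c t : ℝ) (hc : c ^ 2 ≤ 1) (j : ℕ) :
    ∫ z, He j (c * t + √(1 - c ^ 2) * z) ∂stdG = c ^ j * He j t := by
  set s := √(1 - c ^ 2) with hs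
  have hs2 : s ^ 2 = 1 - c ^ 2 := Real.sq_sqrt (by linarith)
  set L : Polynomial ℝ := Polynomial.C (c * t) + Polynomial.C s * Polynomial.X with hL
  have hp : ∀ j z, He j (c * t + s * z) =
      (((Polynomial.hermite j).map (Int.castRingHom ℝ)).comp L).eval z := fun j z => by
    simp [He, hL]
  have hI : ∀ j, Integrable (fun z => He j (c * t + s * z)) stdG := fun j => by
    simp_rw [hp]
    exact integrable_polynomial _
  have hI2 : ∀ j, Integrable (fun z => z * He j (c * t + s * z)) stdG := fun j => by
    have := integrable_polynomial
      (Polynomial.X * ((Polynomial.hermite j).map (Int.castRingHom ℝ)).comp L)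
    simp only [hp]
    simpa using this
  have stein : ∀ j, ∫ z, z * He (j + 1) (c * t + s * z) ∂stdG =
      s * ((j + 1) * ∫ z, He j (c * t + s * z) ∂stdG) := fun j => by
    simp_rw [hp]
    rw [integral_mul_polynomial, ← integral_const_mul, ← integral_const_mul]
    congr 1
    ext z
    rw [Polynomial.derivative_comp, Polynomial.derivative_map, derivative_hermite_succ]
    simp [hL]
  have key : ∀ j, (∫ z, He j (c * t + s * z) ∂stdG = c ^ j * He j t) ∧
      (∫ z, He (j + 1) (c * t + s * z) ∂stdG = c ^ (j + 1) * He (j + 1) t) := by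
    intro j
    induction j with
    | zero =>
      constructor
      · simp [He_zero]
      · have h0 : ∫ z : ℝ, z ∂stdG = 0 := integral_id_gaussianReal
        have hz : Integrable (fun z : ℝ => z) stdG := by simpa using integrable_polynomial Polynomial.X
        have e : ∫ z, (c * t + s * z) ∂stdG = c * t + s * ∫ z, z ∂stdG := by
          rw [integral_add (integrable_const _) (hz.const_mul _), integral_const_mul s]
          simp
        simp only [He_one, zero_add, pow_one]
        rw [e, h0]
        ring
    | succ j ih =>
      refine ⟨ih.2, ?_⟩
      have e : ∀ z, He (j + 1 + 1) (c * t + s * z) = (c * t) * He (j + 1) (c * t + s * z)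
          + s * (z * He (j + 1) (c * t + s * z)) - (j + 1) * He j (c * t + s * z) := fun z => by
        rw [He_succ_succ]; ring
      simp_rw [e]
      have hadd : Integrable (fun z => (c * t) * He (j + 1) (c * t + s * z)
          + s * (z * He (j + 1) (c * t + s * z))) stdG :=
        ((hI _).const_mul _).add ((hI2 _).const_mul _)
      rw [integral_sub hadd ((hI _).const_mul _),
        integral_add ((hI _).const_mul _) ((hI2 _).const_mul _), integral_const_mul,
        integral_const_mul, integral_const_mul, stein, ih.1, ih.2, He_succ_succ]
      linear_combination ((j + 1 : ℝ) * c ^ j * He j t) * hs2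
  exact (key j).1

theorem ou_He {c : ℝ} (hc : c ^ 2 ≤ 1) (j : ℕ) (t : ℝ) :
    ou c (fun t => (He j t : ℂ)) t = (c : ℂ) ^ j * He j t := by
  rw [ou, integral_complex_ofReal, integral_He c t hc]
  simp

theorem measurable_ou (c : ℝ) {u : ℝ → ℂ} (hu : Measurable u) : Measurable (ou c u) := by
  have h : StronglyMeasurable (fun p : ℝ × ℝ => u (c * p.1 + √(1 - c ^ 2) * p.2)) :=
    (hu.comp (by fun_prop)).stronglyMeasurable
  exact (h.integral_prod_right' (ν := stdG)).measurable

theorem norm_ou_le (c : ℝ) {u : ℝ → ℂ} {C : ℝ} (hu : ∀ t, ‖u t‖ ≤ C) (t : ℝ) : ‖ou c u t‖ ≤ C := by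
  have h := norm_integral_le_of_norm_le_const (μ := stdG)
    (f := fun z => u (c * t + √(1 - c ^ 2) * z)) (C := C) (Eventually.of_forall fun _ => hu _)
  simpa [ou] using h

/-- The map is the rotation by arccos c followed by a sign change of the second coordinate; both
preserve the standard Gaussian of the plane. -/
theorem measurePreserving_reflection {c : ℝ} (hc : c ^ 2 ≤ 1) :
    MeasurePreserving (fun p : ℝ × ℝ => (c * p.1 + √(1 - c ^ 2) * p.2, √(1 - c ^ 2) * p.1 - c * p.2))
      (stdG.prod stdG) (stdG.prod stdG) := by
  have hc' := abs_le.1 ((sq_le_one_iff_abs_le_one c).1 hc)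
  have h1 : MeasurePreserving (ContinuousLinearMap.rotation (E := ℝ) (Real.arccos c))
      (stdG.prod stdG) (stdG.prod stdG) :=
    ⟨by fun_prop, IsGaussian.map_rotation_eq_self (by simp [integral_id_gaussianReal]) _⟩
  have h2 : MeasurePreserving (fun x : ℝ => -x) stdG stdG :=
    ⟨by fun_prop, by simpa using gaussianReal_map_neg (μ := 0) (v := 1)⟩
  have h3 := ((MeasurePreserving.id stdG).prod h2).comp h1
  convert h3 using 1
  ext p
  · simp [ContinuousLinearMap.rotation_apply, Real.cos_arccos hc'.1 hc'.2, Real.sin_arccos]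
  · simp [ContinuousLinearMap.rotation_apply, Real.cos_arccos hc'.1 hc'.2, Real.sin_arccos]
    ring

/-- The reflection is an involution. Substituting it in the double integral exchanges the starting
point with the position after one step, which is reversibility of the chain. -/
theorem ou_symm {c : ℝ} (hc : c ^ 2 ≤ 1) {u v : ℝ → ℂ} (hu : MemLp u 2 stdG) (hv : MemLp v 2 stdG) :
    ∫ t, ou c u t * v t ∂stdG = ∫ t, u t * ou c v t ∂stdG := by
  have hR := measurePreserving_reflection hc
  have hs2 : √(1 - c ^ 2) ^ 2 = 1 - c ^ 2 := Real.sq_sqrt (by linarith)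
  have h1 : ∀ {w : ℝ → ℂ}, MemLp w 2 stdG →
      MemLp (fun p : ℝ × ℝ => w (c * p.1 + √(1 - c ^ 2) * p.2)) 2 (stdG.prod stdG) := fun hw =>
    (hw.comp_measurePreserving measurePreserving_fst).comp_measurePreserving hR
  have h2 : ∀ {w : ℝ → ℂ}, MemLp w 2 stdG →
      MemLp (fun p : ℝ × ℝ => w p.1) 2 (stdG.prod stdG) := fun hw =>
    hw.comp_measurePreserving measurePreserving_fst
  have hF := (h1 hu).integrable_mul (h2 hv)
  have hG := (h2 hu).integrable_mul (h1 hv)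
  simp only [ou, ← integral_mul_const, ← integral_const_mul]
  have e1 := integral_prod _ hF
  have e2 := integral_prod _ hG
  simp only [Pi.mul_apply] at e1 e2
  rw [← e1, ← e2]
  have h3 := integral_map (φ := fun p : ℝ × ℝ =>
    (c * p.1 + √(1 - c ^ 2) * p.2, √(1 - c ^ 2) * p.1 - c * p.2)) (μ := stdG.prod stdG)
    (f := fun p => u (c * p.1 + √(1 - c ^ 2) * p.2) * v p.1) hR.measurable.aemeasurable
    (by rw [hR.map_eq]; exact hF.aestronglyMeasurable)
  rw [hR.map_eq] at h3
  rw [h3]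
  congr 1
  ext p
  dsimp only
  congr 2
  linear_combination p.1 * hs2

/-- Eigenvectors of a symmetric operator for different eigenvalues are orthogonal; the choice c =
1/2 merely makes the powers c^i distinct. -/
theorem integral_He_mul_He {i j : ℕ} (hij : i ≠ j) :
    ∫ t, (He i t : ℂ) * (He j t : ℂ) ∂stdG = 0 := by
  have hc : (1 / 2 : ℝ) ^ 2 ≤ 1 := by norm_num
  have h := ou_symm hc (memLp_He i) (memLp_He j)
  simp_rw [ou_He hc] at h
  simp_rw [mul_left_comm _ ((_ : ℂ) ^ j), mul_assoc] at h
  rw [integral_const_mul, integral_const_mul, ← sub_eq_zero, ← sub_mul, mul_eq_zero] at h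
  refine h.resolve_left fun h0 => hij ?_
  rw [sub_eq_zero] at h0
  norm_cast at h0
  exact pow_right_injective₀ (by norm_num) (by norm_num) h0

theorem integrable_exp_abs_mul {u : ℝ → ℝ} (hu : MemLp u 2 stdG) (t : ℝ) :
    Integrable (fun x => Real.exp |t * x| * ‖u x‖) stdG := by
  have h1 : MemLp (fun x => Real.exp |t * x|) 2 stdG := by
    rw [memLp_two_iff_integrable_sq (by fun_prop)]
    have h2 := integrable_exp_mul_abs (μ := stdG) (X := id) (t := 2 * |t|)
      (by simpa using integrable_exp_mul_gaussianReal (μ := 0) (v := 1) (2 * |t|))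
      (by simpa using integrable_exp_mul_gaussianReal (μ := 0) (v := 1) (-(2 * |t|)))
    refine h2.congr (Eventually.of_forall fun x => ?_)
    dsimp only
    rw [← Real.exp_nat_mul, abs_mul, id]
    congr 1
    push_cast
    ring
  exact h1.integrable_mul hu.norm

/-- The exponential series may be integrated term by term: its partial sums are dominated by exp|tx|
|u|, integrable because γ has all exponential moments. -/
theorem integral_cexp_mul_eq_zero {u : ℝ → ℝ} (hu : MemLp u 2 stdG)
    (h : ∀ n : ℕ, ∫ x, x ^ n * u x ∂stdG = 0) (t : ℝ) :
    ∫ x, Complex.exp (t * x * Complex.I) * (u x : ℂ) ∂stdG = 0 := by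
  have hpow : ∀ n : ℕ, Integrable (fun x => x ^ n * u x) stdG := fun n => by
    have h1 := memLp_polynomial (Polynomial.X ^ n)
    simp_rw [Polynomial.eval_pow, Polynomial.eval_X] at h1
    exact h1.integrable_mul hu
  have hlim : Tendsto (fun n : ℕ => ∫ x, (∑ k ∈ Finset.range n,
      ((t * x * Complex.I) ^ k / (k.factorial : ℂ))) * (u x : ℂ) ∂stdG) atTop
      (𝓝 (∫ x, Complex.exp (t * x * Complex.I) * (u x : ℂ) ∂stdG)) := by
    refine tendsto_integral_of_dominated_convergence (fun x => Real.exp |t * x| * ‖u x‖)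
      (fun n => ?_) (integrable_exp_abs_mul hu t) (fun n => Eventually.of_forall fun x => ?_)
      (Eventually.of_forall fun x => ?_)
    · refine AEStronglyMeasurable.mul (by fun_prop) ?_
      exact Complex.continuous_ofReal.comp_aestronglyMeasurable hu.aestronglyMeasurable
    · rw [norm_mul, Complex.norm_real]
      gcongr
      refine (norm_sum_le _ _).trans ?_
      have : ∀ k, ‖(t * x * Complex.I) ^ k / (k.factorial : ℂ)‖ = |t * x| ^ k / k.factorial := by
        intro k
        simp [abs_mul]
      simp_rw [this]
      exact Real.sum_le_exp_of_nonneg (abs_nonneg _) n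
    · refine Tendsto.mul_const _ ?_
      rw [Complex.exp_eq_exp_ℂ]
      exact (NormedSpace.expSeries_div_hasSum_exp (t * x * Complex.I)).tendsto_sum_nat
  have hz : ∀ n : ℕ, ∫ x, (∑ k ∈ Finset.range n,
      ((t * x * Complex.I) ^ k / (k.factorial : ℂ))) * (u x : ℂ) ∂stdG = 0 := fun n => by
    have e : ∀ x : ℝ, (∑ k ∈ Finset.range n,
      ((t * x * Complex.I) ^ k / (k.factorial : ℂ))) * (u x : ℂ) = ∑ k ∈ Finset.range n,
        ((t * Complex.I) ^ k / (k.factorial : ℂ)) * ((x ^ k * u x : ℝ) : ℂ) := fun x => by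
      rw [Finset.sum_mul]
      refine Finset.sum_congr rfl fun k _ => ?_
      push_cast
      ring
    simp_rw [e]
    rw [integral_finsetSum _ fun k _ => (hpow k).ofReal.const_mul _]
    refine Finset.sum_eq_zero fun k _ => ?_
    rw [integral_const_mul, integral_complex_ofReal, h]
    simp
  simp_rw [hz] at hlim
  exact tendsto_nhds_unique hlim tendsto_const_nhds

/-- The measures with γ-densities u⁺ and u⁻ have the same characteristic function, hence coincide;
so u⁺ = u⁻ almost everywhere. -/
theorem ae_eq_zero_of_moments {u : ℝ → ℝ} (hu : MemLp u 2 stdG)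
    (h : ∀ n : ℕ, ∫ x, x ^ n * u x ∂stdG = 0) : u =ᵐ[stdG] 0 := by
  have hui : Integrable u stdG := hu.integrable one_le_two
  have hchar : ∀ t : ℝ, ∫ x, Complex.exp (t * x * Complex.I) * ((max (u x) 0 : ℝ) : ℂ) ∂stdG =
      ∫ x, Complex.exp (t * x * Complex.I) * ((max (-u x) 0 : ℝ) : ℂ) ∂stdG := fun t => by
    have hb : ∀ {v : ℝ → ℝ}, Integrable v stdG →
        Integrable (fun x : ℝ => Complex.exp (t * x * Complex.I) * (v x : ℂ)) stdG := fun hv => by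
      refine hv.ofReal.bdd_mul (c := 1) (by fun_prop) (Eventually.of_forall fun x => ?_)
      rw [← Complex.ofReal_mul, Complex.norm_exp_ofReal_mul_I]
    rw [← sub_eq_zero, ← integral_sub (hb hui.pos_part) (hb hui.neg_part),
      ← integral_cexp_mul_eq_zero hu h t]
    congr 1
    ext x
    rw [← mul_sub, ← Complex.ofReal_sub]
    congr 3
    rcases le_total (u x) 0 with hx | hx
    · rw [max_eq_right hx, max_eq_left (by linarith)]; ring
    · rw [max_eq_left hx, max_eq_right (by linarith)]; ring
  have hm : ∀ {v : ℝ → ℝ}, Integrable v stdG → AEMeasurable (fun x => ENNReal.ofReal (v x)) stdG :=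
    fun hv => hv.aestronglyMeasurable.aemeasurable.ennreal_ofReal
  have e1 : ∀ {v : ℝ → ℝ}, Integrable v stdG → (∀ x, 0 ≤ v x) → ∀ t,
      charFun (stdG.withDensity fun x => ENNReal.ofReal (v x)) t =
      ∫ x, Complex.exp (t * x * Complex.I) * (v x : ℂ) ∂stdG := fun {v} hv hv0 t => by
    rw [charFun_apply_real, integral_withDensity_eq_integral_toReal_smul₀ (hm hv)
      (Eventually.of_forall fun _ => ENNReal.ofReal_lt_top)]
    congr 1
    ext x
    rw [ENNReal.toReal_ofReal (hv0 x), Complex.real_smul, mul_comm]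
  have hfin : ∀ {v : ℝ → ℝ}, Integrable v stdG →
      IsFiniteMeasure (stdG.withDensity fun x => ENNReal.ofReal (v x)) := fun hv =>
    isFiniteMeasure_withDensity_ofReal hv.2
  have := hfin hui.pos_part
  have := hfin hui.neg_part
  have heq : (stdG.withDensity fun x => ENNReal.ofReal (max (u x) 0)) =
      stdG.withDensity fun x => ENNReal.ofReal (max (-u x) 0) := by
    refine Measure.ext_of_charFun (funext fun t => ?_)
    rw [e1 hui.pos_part (fun _ => le_max_right _ _), e1 hui.neg_part (fun _ => le_max_right _ _),
      hchar]
  have h2 := (withDensity_eq_iff (hm hui.pos_part) (hm hui.neg_part)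
    (hui.pos_part.lintegral_lt_top).ne).1 heq
  filter_upwards [h2] with x hx
  rw [ENNReal.ofReal_eq_ofReal_iff (le_max_right _ _) (le_max_right _ _)] at hx
  rcases le_total (u x) 0 with h0 | h0
  · rw [max_eq_right h0, max_eq_left (by linarith)] at hx
    simp only [Pi.zero_apply]; linarith
  · rw [max_eq_left h0, max_eq_right (by linarith)] at hx
    simpa using hx

theorem ae_eq_zero_of_moments_complex {u : ℝ → ℂ} (hu : MemLp u 2 stdG)
    (h : ∀ n : ℕ, ∫ x, (x : ℂ) ^ n * u x ∂stdG = 0) : u =ᵐ[stdG] 0 := by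
  have hint : ∀ n : ℕ, Integrable (fun x : ℝ => (x : ℂ) ^ n * u x) stdG := fun n => by
    have h1 := (memLp_polynomial (Polynomial.X ^ n)).ofReal (K := ℂ)
    simp_rw [Polynomial.eval_pow, Polynomial.eval_X] at h1
    push_cast at h1
    exact h1.integrable_mul hu
  have hre := ae_eq_zero_of_moments hu.re fun n => by
    have := integral_re (hint n)
    rw [h n] at this
    simpa [← Complex.ofReal_pow] using this
  have him := ae_eq_zero_of_moments hu.im fun n => by
    have := integral_im (hint n)
    rw [h n] at this
    simpa [← Complex.ofReal_pow] using this
  filter_upwards [hre, him] with x h1 h2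
  exact Complex.ext h1 h2

/-- He_n is monic of degree n, so subtracting the right multiple of it lowers the degree, and
induction covers all polynomials. -/
theorem integral_pow_mul_eq_zero_of_He {u : ℝ → ℂ} (hu : MemLp u 2 stdG)
    (h : ∀ n : ℕ, ∫ x, u x * (He n x : ℂ) ∂stdG = 0) (n : ℕ) :
    ∫ x, (x : ℂ) ^ n * u x ∂stdG = 0 := by
  have hintp : ∀ p : Polynomial ℝ, Integrable (fun x => ((p.eval x : ℝ) : ℂ) * u x) stdG :=
    fun p => ((memLp_polynomial p).ofReal (K := ℂ)).integrable_mul hu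
  have key : ∀ n : ℕ, ∀ p : Polynomial ℝ, p.degree < (n : WithBot ℕ) →
      ∫ x, ((p.eval x : ℝ) : ℂ) * u x ∂stdG = 0 := by
    intro n
    induction n with
    | zero =>
      intro p hp
      have hp0 : p = 0 := by
        rw [← Polynomial.degree_eq_bot]
        exact Nat.WithBot.lt_zero_iff.1 (by simpa using hp)
      simp [hp0]
    | succ n ih =>
      intro p hp
      set H := (Polynomial.hermite n).map (Int.castRingHom ℝ) with hH
      have hHm : H.Monic := (Polynomial.hermite_monic n).map _
      have hHd : H.degree = n := by
        rw [hH, (Polynomial.hermite_monic n).degree_map, Polynomial.degree_hermite]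
      have hHn : H.natDegree = n := Polynomial.natDegree_eq_of_degree_eq_some hHd
      have hq : (p - Polynomial.C (p.coeff n) * H).degree < (n : WithBot ℕ) := by
        rw [Polynomial.degree_lt_iff_coeff_zero]
        intro m hm
        rcases eq_or_lt_of_le hm with rfl | hm
        · have : H.coeff n = 1 := by rw [← hHn]; exact hHm
          simp [this]
        · have h1 : p.coeff m = 0 := Polynomial.coeff_eq_zero_of_degree_lt
            (hp.trans_le (by exact_mod_cast hm))
          have h2 : H.coeff m = 0 := Polynomial.coeff_eq_zero_of_degree_lt
            (by rw [hHd]; exact_mod_cast hm)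
          simp [h1, h2]
      have h1 := ih _ hq
      have h2 := h n
      have e : ∀ x : ℝ, ((p.eval x : ℝ) : ℂ) * u x =
          (((p - Polynomial.C (p.coeff n) * H).eval x : ℝ) : ℂ) * u x
            + (p.coeff n : ℂ) * (((H.eval x : ℝ) : ℂ) * u x) := fun x => by
        simp only [Polynomial.eval_sub, Polynomial.eval_mul, Polynomial.eval_C]
        push_cast
        ring
      simp_rw [e]
      rw [integral_add (hintp _) ((hintp H).const_mul _), h1, integral_const_mul, zero_add]
      have : ∫ x, ((H.eval x : ℝ) : ℂ) * u x ∂stdG = 0 := by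
        rw [← h2]
        congr 1
        ext x
        rw [mul_comm, He]
      rw [this, mul_zero]
  have := key (n + 1) (Polynomial.X ^ n) (by
    rw [Polynomial.degree_X_pow]; exact_mod_cast n.lt_succ_self)
  simpa using this

/-- The Hermite polynomial as an element of `L²` of the Gaussian measure. -/
def HeL (j : ℕ) : Lp ℂ 2 stdG := (memLp_He j).toLp

theorem inner_HeL_toLp (j : ℕ) {u : ℝ → ℂ} (hu : MemLp u 2 stdG) :
    inner ℂ (HeL j) hu.toLp = ∫ t, u t * (He j t : ℂ) ∂stdG := by
  rw [L2.inner_def]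
  refine integral_congr_ae ?_
  filter_upwards [(memLp_He j).coeFn_toLp, hu.coeFn_toLp] with t h1 h2
  rw [HeL, h1, h2]
  simp

theorem norm_toLp_sq {u : ℝ → ℂ} (hu : MemLp u 2 stdG) :
    ‖hu.toLp‖ ^ 2 = ∫ t, ‖u t‖ ^ 2 ∂stdG := by
  have h : ((‖hu.toLp‖ ^ 2 : ℝ) : ℂ) = ((∫ t, ‖u t‖ ^ 2 ∂stdG : ℝ) : ℂ) := by
    rw [Complex.ofReal_pow]
    refine (inner_self_eq_norm_sq_to_K (𝕜 := ℂ) hu.toLp).symm.trans ?_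
    rw [L2.inner_def, ← integral_complex_ofReal]
    refine integral_congr_ae ?_
    filter_upwards [hu.coeFn_toLp] with t h2
    rw [h2, inner_self_eq_norm_sq_to_K]
    simp
  exact_mod_cast h

theorem HeL_ne_zero (j : ℕ) : HeL j ≠ 0 := by
  intro h0
  have h1 : (fun t => (He j t : ℂ)) =ᵐ[stdG] 0 :=
    (memLp_He j).coeFn_toLp.symm.trans ((Lp.eq_zero_iff_ae_eq_zero).1 h0)
  have h2 : (fun t => (He j t : ℂ)) =ᵐ[volume] 0 :=
    (gaussianReal_absolutelyContinuous' 0 one_ne_zero).ae_eq h1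
  have h3 : (fun t => (He j t : ℂ)) = 0 :=
    Continuous.ae_eq_iff_eq volume (Complex.continuous_ofReal.comp (continuous_He j))
      continuous_const |>.1 h2
  have h4 : (Polynomial.hermite j).map (Int.castRingHom ℝ) = 0 := by
    refine Polynomial.funext fun t => ?_
    have := congrFun h3 t
    simpa [He] using this
  exact ((Polynomial.hermite_monic j).map (Int.castRingHom ℝ)).ne_zero h4

/-- The normalized Hermite polynomials. -/
def HeN (j : ℕ) : Lp ℂ 2 stdG := ((‖HeL j‖⁻¹ : ℝ) : ℂ) • HeL j

theorem orthonormal_HeN : Orthonormal ℂ HeN := by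
  refine ⟨fun j => ?_, fun i j hij => ?_⟩
  · rw [HeN, norm_smul]
    simp [HeL_ne_zero]
  · change inner ℂ (HeN i) (HeN j) = 0
    rw [HeN, HeN, inner_smul_left, inner_smul_right]
    have := inner_HeL_toLp i (memLp_He j)
    rw [integral_He_mul_He hij.symm] at this
    rw [← HeL] at this
    rw [this]
    simp

theorem span_HeN_orthogonal : (Submodule.span ℂ (Set.range HeN))ᗮ = ⊥ := by
  rw [Submodule.eq_bot_iff]
  intro u hu
  have h : ∀ n : ℕ, ∫ x, u x * (He n x : ℂ) ∂stdG = 0 := fun n => by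
    have h1 := (Submodule.mem_orthogonal _ _).1 hu (HeN n) (Submodule.subset_span ⟨n, rfl⟩)
    rw [HeN, inner_smul_left, mul_eq_zero] at h1
    have h2 := h1.resolve_left (by simp [HeL_ne_zero])
    rw [← inner_HeL_toLp n (Lp.memLp u), Lp.toLp_coeFn]
    exact h2
  have h2 := ae_eq_zero_of_moments_complex (Lp.memLp u)
    (integral_pow_mul_eq_zero_of_He (Lp.memLp u) h)
  exact (Lp.eq_zero_iff_ae_eq_zero).2 h2

/-- The Hilbert basis of normalized Hermite polynomials. -/
def hermiteBasis : HilbertBasis ℕ ℂ (Lp ℂ 2 stdG) :=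
  HilbertBasis.mkOfOrthogonalEqBot orthonormal_HeN span_HeN_orthogonal

theorem hasSum_inner_HeN (x : Lp ℂ 2 stdG) :
    HasSum (fun j => ‖inner ℂ (HeN j) x‖ ^ 2) (‖x‖ ^ 2) := by
  have h := hermiteBasis.hasSum_inner_mul_inner x x
  have h2 := RCLike.hasSum_re ℂ h
  have hb : ∀ j, hermiteBasis j = HeN j := fun j => by
    rw [hermiteBasis, HilbertBasis.coe_mkOfOrthogonalEqBot]
  convert h2 using 1
  · ext j
    rw [hb, inner_mul_symm_re_eq_norm, norm_mul, norm_inner_symm x, sq]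
  · rw [inner_self_eq_norm_sq]

/-- The Ornstein-Uhlenbeck operator contracts by `|c|^N` on the orthogonal complement of the first
`N` Hermite polynomials. -/
theorem integral_norm_ou_sq_le {c : ℝ} (hc : c ^ 2 ≤ 1) {N : ℕ} {u : ℝ → ℂ} (hu : MemLp u 2 stdG)
    (hou : MemLp (ou c u) 2 stdG) (horth : ∀ j < N, ∫ t, u t * (He j t : ℂ) ∂stdG = 0) :
    ∫ t, ‖ou c u t‖ ^ 2 ∂stdG ≤ (c ^ 2) ^ N * ∫ t, ‖u t‖ ^ 2 ∂stdG := by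
  rw [← norm_toLp_sq hu, ← norm_toLp_sq hou]
  -- Parseval, compared term by term: the j-th coefficient is multiplied by c^j, and the
  -- coefficients with j < N vanish.
  refine hasSum_le (fun j => ?_) (hasSum_inner_HeN hou.toLp)
    ((hasSum_inner_HeN hu.toLp).mul_left _)
  have h1 : inner ℂ (HeL j) hou.toLp = (c : ℂ) ^ j * inner ℂ (HeL j) hu.toLp := by
    rw [inner_HeL_toLp, inner_HeL_toLp, ou_symm hc hu (memLp_He j), ← integral_const_mul]
    simp_rw [ou_He hc]
    congr 1
    ext t
    ring
  rcases lt_or_ge j N with hj | hj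
  · have h2 : inner ℂ (HeL j) hu.toLp = 0 := by rw [inner_HeL_toLp, horth j hj]
    simp only [HeN, inner_smul_left, h1, h2]
    simp
  · simp only [HeN, inner_smul_left, h1, norm_mul, norm_pow, Complex.norm_real, mul_pow]
    have h3 : (‖c‖ ^ j) ^ 2 ≤ (c ^ 2) ^ N := by
      rw [← pow_mul, mul_comm, pow_mul, Real.norm_eq_abs, sq_abs]
      exact pow_le_pow_of_le_one (sq_nonneg c) hc hj
    rw [mul_left_comm]
    gcongr

theorem integral_He_sq_ne_zero (j : ℕ) : ∫ t, He j t * He j t ∂stdG ≠ 0 := by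
  intro h
  have h1 := norm_toLp_sq (memLp_He j)
  have h2 : ∫ t, ‖(He j t : ℂ)‖ ^ 2 ∂stdG = ∫ t, He j t * He j t ∂stdG := by
    congr 1
    ext t
    rw [Complex.norm_real, Real.norm_eq_abs, sq_abs, sq]
  rw [h2, h] at h1
  exact HeL_ne_zero j (norm_eq_zero.1 (pow_eq_zero_iff two_ne_zero |>.1 h1))

theorem integral_He_mul_He_real {i j : ℕ} (hij : i ≠ j) : ∫ t, He i t * He j t ∂stdG = 0 := by
  have h := integral_He_mul_He hij
  simp_rw [← Complex.ofReal_mul] at h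
  rw [integral_complex_ofReal] at h
  exact_mod_cast h

theorem integrable_He_mul_He (i j : ℕ) : Integrable (fun t => He i t * He j t) stdG :=
  (memLp_polynomial _).integrable_mul (memLp_polynomial _)

/-- Linear independence of the Hermite polynomials, in a form adapted to Gram matrices on the
interval `(-1, 1)`. -/
theorem eq_zero_of_setIntegral_sq_eq_zero {N : ℕ} (v : Fin N → ℝ)
    (h : ∫ t in Set.Ioo (-1 : ℝ) 1, (∑ i, v i * He i t) ^ 2 ∂stdG = 0) : v = 0 := by
  set q : Polynomial ℝ :=
    ∑ i, Polynomial.C (v i) * (Polynomial.hermite i).map (Int.castRingHom ℝ) with hq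
  have hqe : ∀ t, q.eval t = ∑ i, v i * He i t := fun t => by
    simp [hq, He, Polynomial.eval_finsetSum]
  have hint : Integrable (fun t => (q.eval t) ^ 2) stdG := (memLp_polynomial q).integrable_sq
  simp_rw [← hqe] at h
  rw [integral_eq_zero_iff_of_nonneg (fun _ => sq_nonneg _) hint.integrableOn] at h
  have h1 := (ae_restrict_iff' measurableSet_Ioo).1 h
  have h2 : ∀ᵐ t ∂(volume : Measure ℝ), t ∈ Set.Ioo (-1 : ℝ) 1 → q.eval t ^ 2 = 0 :=
    (gaussianReal_absolutelyContinuous' 0 one_ne_zero).ae_le h1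
  have hq0 : q = 0 := by
    by_contra hne
    have hfin : (q.rootSet ℝ).Finite := Polynomial.rootSet_finite _ _
    have h3 : volume (Set.Ioo (-1 : ℝ) 1) = 0 := by
      refine measure_mono_null ?_ (measure_union_null h2 (hfin.measure_zero volume))
      intro t ht
      by_cases hqt : q.eval t ^ 2 = 0
      · right
        rw [Polynomial.mem_rootSet]
        exact ⟨hne, by simpa using hqt⟩
      · left
        simp only [Set.mem_compl_iff, Set.mem_ofPred_eq]
        exact fun hh => hqt (hh ht)
    norm_num [Real.volume_Ioo] at h3
  funext k
  have h4 : ∫ t, (∑ i, v i * He i t) * He k t ∂stdG = 0 := by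
    simp_rw [← hqe, hq0]
    simp
  simp_rw [Finset.sum_mul, mul_assoc] at h4
  rw [integral_finsetSum _ fun i _ => (integrable_He_mul_He _ _).const_mul _] at h4
  simp_rw [integral_const_mul] at h4
  rw [Finset.sum_eq_single k (fun i _ hik => by
    rw [integral_He_mul_He_real (fun hh => hik (Fin.ext hh)), mul_zero]) (by simp), mul_eq_zero] at h4
  exact h4.resolve_right (integral_He_sq_ne_zero k)

/-- Bounded functions supported in `(-1, 1)` which are dual to the first Hermite polynomials. -/
theorem exists_dual_He (N : ℕ) : ∃ d : Fin N → ℝ → ℝ, (∀ j, Measurable (d j)) ∧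
    (∀ j t, 1 ≤ |t| → d j t = 0) ∧ (∃ C, 0 ≤ C ∧ ∀ j t, |d j t| ≤ C) ∧
    ∀ i j : Fin N, ∫ t, (He i t : ℂ) * (d j t : ℂ) ∂stdG = if i = j then 1 else 0 := by
  set M : Matrix (Fin N) (Fin N) ℝ :=
    Matrix.of fun i j => ∫ t in Set.Ioo (-1 : ℝ) 1, He i t * He j t ∂stdG with hM
  have hint : ∀ i j : ℕ, Integrable (fun t => He i t * He j t)
      (stdG.restrict (Set.Ioo (-1 : ℝ) 1)) := fun i j => (integrable_He_mul_He i j).restrict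
  -- A kernel vector of the Gram matrix would be a combination of Hermite polynomials with zero L²
  -- norm on (-1, 1).
  have hdet : M.det ≠ 0 := by
    intro h0
    obtain ⟨v, hv, hMv⟩ := Matrix.exists_mulVec_eq_zero_iff.2 h0
    refine hv (eq_zero_of_setIntegral_sq_eq_zero v ?_)
    have e : ∀ t, (∑ i, v i * He i t) ^ 2 = ∑ i, ∑ j, v i * v j * (He i t * He j t) := fun t => by
      rw [sq, Finset.sum_mul_sum]
      exact Finset.sum_congr rfl fun i _ => Finset.sum_congr rfl fun j _ => by ring
    simp_rw [e]
    rw [integral_finsetSum _ fun (i : Fin N) _ => integrable_finsetSum _ fun (j : Fin N) _ =>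
      (hint i j).const_mul _]
    refine Finset.sum_eq_zero fun i _ => ?_
    rw [integral_finsetSum _ fun (j : Fin N) _ => (hint i j).const_mul _]
    simp_rw [integral_const_mul]
    have := congrFun hMv i
    simp only [Matrix.mulVec, dotProduct, hM, Matrix.of_apply, Pi.zero_apply] at this
    calc _ = v i * ∑ j : Fin N, (∫ t in Set.Ioo (-1 : ℝ) 1, He i t * He j t ∂stdG) * v j := by
          rw [Finset.mul_sum]
          exact Finset.sum_congr rfl fun j _ => by ring
      _ = 0 := by rw [this, mul_zero]
  have hunit : IsUnit M.det := hdet.isUnit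
  set p : Fin N → Polynomial ℝ := fun j =>
    ∑ k, Polynomial.C (M⁻¹ k j) * (Polynomial.hermite k).map (Int.castRingHom ℝ) with hp
  have hpe : ∀ j t, (p j).eval t = ∑ k, M⁻¹ k j * He k t := fun j t => by
    simp [hp, He, Polynomial.eval_finsetSum]
  have hb : ∀ j, ∃ C, ∀ t ∈ Set.Icc (-1 : ℝ) 1, ‖(p j).eval t‖ ≤ C := fun j =>
    isCompact_Icc.exists_bound_of_continuousOn (p j).continuous.continuousOn
  choose C hC using hb
  -- Support in (-1, 1) makes these functions, and the bound on them, independent of the cutoff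
  -- radius ρ ≥ 1 and hence of ε.
  refine ⟨fun j => (Set.Ioo (-1 : ℝ) 1).indicator fun t => (p j).eval t, fun j => ?_, fun j t ht => ?_,
    ⟨∑ j, |C j|, by positivity, fun j t => ?_⟩, fun i j => ?_⟩
  · exact (p j).continuous.measurable.indicator measurableSet_Ioo
  · refine Set.indicator_of_notMem (fun h => ?_) _
    exact absurd (abs_lt.2 ⟨h.1, h.2⟩) (not_lt.2 ht)
  · have h1 : |C j| ≤ ∑ j, |C j| :=
      Finset.single_le_sum (f := fun j => |C j|) (fun _ _ => abs_nonneg _) (Finset.mem_univ j)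
    change |(Set.Ioo (-1 : ℝ) 1).indicator (fun t => (p j).eval t) t| ≤ _
    by_cases ht : t ∈ Set.Ioo (-1 : ℝ) 1
    · rw [Set.indicator_of_mem ht]
      exact ((hC j t (Set.Ioo_subset_Icc_self ht)).trans (le_abs_self _)).trans h1
    · rw [Set.indicator_of_notMem ht, abs_zero]
      positivity
  · have e : ∀ t, (He i t : ℂ) * (((Set.Ioo (-1 : ℝ) 1).indicator (fun t => (p j).eval t) t : ℝ) : ℂ) =
        (((Set.Ioo (-1 : ℝ) 1).indicator (fun t => He i t * (p j).eval t) t : ℝ) : ℂ) := fun t => by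
      rw [← Complex.ofReal_mul, ← Set.indicator_mul_right]
    simp_rw [e]
    rw [integral_complex_ofReal, integral_indicator measurableSet_Ioo]
    simp_rw [hpe, Finset.mul_sum]
    have e2 : ∀ t (k : Fin N), He i t * (M⁻¹ k j * He k t) = M⁻¹ k j * (He i t * He k t) :=
      fun t k => by ring
    simp_rw [e2]
    rw [integral_finsetSum _ fun (k : Fin N) _ => (hint i k).const_mul _]
    simp_rw [integral_const_mul]
    have h1 : ∑ k, M⁻¹ k j * ∫ t in Set.Ioo (-1 : ℝ) 1, He i t * He k t ∂stdG = (M * M⁻¹) i j := by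
      rw [Matrix.mul_apply]
      exact Finset.sum_congr rfl fun k _ => by rw [hM, Matrix.of_apply, mul_comm]
    rw [h1, Matrix.mul_nonsing_inv _ hunit, Matrix.one_apply]
    split_ifs <;> simp

/-! ### Gaussian tails, the Gaussian weight and smoothing -/

theorem tendsto_tail_integral {f : ℝ → ℝ} (hf : Integrable f stdG) :
    Tendsto (fun ρ : ℝ => ∫ t in {t : ℝ | ρ ≤ |t|}, f t ∂stdG) atTop (𝓝 0) := by
  have hms : ∀ ρ : ℝ, MeasurableSet {t : ℝ | ρ ≤ |t|} := fun ρ =>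
    measurableSet_le measurable_const measurable_id.abs
  simp_rw [← fun ρ => integral_indicator (μ := stdG) (f := f) (hms ρ)]
  have h0 : (0 : ℝ) = ∫ t : ℝ, (0 : ℝ) ∂stdG := by simp
  rw [h0]
  refine tendsto_integral_filter_of_dominated_convergence (fun t => ‖f t‖)
    (Eventually.of_forall fun ρ => hf.aestronglyMeasurable.indicator (hms ρ))
    (Eventually.of_forall fun ρ => Eventually.of_forall fun t => norm_indicator_le_norm_self _ _)
    hf.norm (Eventually.of_forall fun t => ?_)
  refine tendsto_const_nhds.congr' ?_
  filter_upwards [eventually_gt_atTop |t|] with ρ hρ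
  rw [Set.indicator_of_notMem]
  simpa using hρ

theorem tendsto_polynomial_mul_exp (p : Polynomial ℝ) {a : ℝ} (ha : 0 < a) :
    Tendsto (fun x => p.eval x * Real.exp (-a * x ^ 2)) (cocompact ℝ) (𝓝 0) := by
  simp_rw [Polynomial.eval_eq_sum_range, Finset.sum_mul]
  rw [show (0 : ℝ) = ∑ i ∈ Finset.range (p.natDegree + 1), 0 by simp]
  refine tendsto_finsetSum _ fun i _ => ?_
  have h := (tendsto_rpow_abs_mul_exp_neg_mul_sq_cocompact ha i).const_mul |p.coeff i|
  rw [mul_zero] at h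
  refine squeeze_zero_norm (fun x => le_of_eq ?_) h
  rw [norm_mul, norm_mul, norm_pow, Real.rpow_natCast]
  simp only [Real.norm_eq_abs, Real.abs_exp]
  ring

theorem exists_bound_polynomial_mul_exp (p : Polynomial ℝ) {a : ℝ} (ha : 0 < a) :
    ∃ C, 0 ≤ C ∧ ∀ x, |p.eval x * Real.exp (-a * x ^ 2)| ≤ C := by
  have h := tendsto_polynomial_mul_exp p ha
  have hc : Continuous fun x => p.eval x * Real.exp (-a * x ^ 2) := by fun_prop
  have h1 : ∀ᶠ x in cocompact ℝ, |p.eval x * Real.exp (-a * x ^ 2)| ≤ 1 := by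
    have := h.abs
    rw [abs_zero] at this
    exact this.eventually_le_const one_pos
  obtain ⟨K, hK, hK2⟩ := mem_cocompact.1 h1
  obtain ⟨C, hC⟩ := hK.exists_bound_of_continuousOn hc.continuousOn
  refine ⟨max C 1, by positivity, fun x => ?_⟩
  by_cases hx : x ∈ K
  · exact (hC x hx).trans (le_max_left _ _)
  · exact (hK2 hx).trans (le_max_right _ _)

/-- The Gaussian weight. -/
def wt (t : ℝ) : ℝ := Real.exp (-t ^ 2 / 2)

theorem wt_pos (t : ℝ) : 0 < wt t := Real.exp_pos _

theorem continuous_wt : Continuous wt := by unfold wt; fun_prop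

theorem wt_le_of_abs_lt {t ρ : ℝ} (h : |t| < ρ) : wt ρ ≤ wt t := by
  rw [wt, wt, Real.exp_le_exp]
  have : t ^ 2 ≤ ρ ^ 2 := sq_le_sq' (by linarith [(abs_lt.1 h).1]) (abs_lt.1 h).2.le
  linarith

theorem eventually_wt_mul_He_le (j : ℕ) {η : ℝ} (hη : 0 < η) :
    ∀ᶠ ρ : ℝ in atTop, ∀ t, ρ ≤ |t| → wt t * |He j t| ≤ η := by
  have h := tendsto_polynomial_mul_exp ((Polynomial.hermite j).map (Int.castRingHom ℝ))
    (a := 1 / 2) (by norm_num)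
  have h1 : ∀ᶠ x in cocompact ℝ, wt x * |He j x| ≤ η := by
    have := h.abs
    rw [abs_zero] at this
    filter_upwards [this.eventually_le_const hη] with x hx
    rw [abs_mul, Real.abs_exp] at hx
    rw [He, mul_comm, wt, show -x ^ 2 / 2 = -(1 / 2) * x ^ 2 by ring]
    exact hx
  rw [← Metric.cobounded_eq_cocompact, ← comap_norm_atTop, eventually_comap, eventually_atTop] at h1
  obtain ⟨a, ha⟩ := h1
  filter_upwards [eventually_ge_atTop a] with ρ hρ t ht
  exact ha |t| (hρ.trans ht) t rfl

theorem integral_affine_stdG {m s : ℝ} (hs : s ≠ 0) (f : ℝ → ℂ) :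
    ∫ z, f (m + s * z) ∂stdG =
      ∫ x, ((√(2 * Real.pi * s ^ 2))⁻¹ * Real.exp (-(x - m) ^ 2 / (2 * s ^ 2))) • f x := by
  have h1 : stdG.map (fun z => m + s * z) = gaussianReal m (NNReal.mk (s ^ 2) (sq_nonneg s)) := by
    have e : (fun z : ℝ => m + s * z) = (fun y => m + y) ∘ fun z => s * z := rfl
    rw [e, ← Measure.map_map (by fun_prop) (by fun_prop), gaussianReal_map_const_mul,
      gaussianReal_map_const_add]
    congr 1
    · simp
    · simp
  have hemb : MeasurableEmbedding fun z : ℝ => m + s * z :=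
    ((Homeomorph.mulLeft₀ s hs).trans (Homeomorph.addLeft m)).measurableEmbedding
  rw [← hemb.integral_map, h1, integral_gaussianReal_eq_integral_smul]
  · rfl
  · intro h0
    have := congrArg NNReal.toReal h0
    exact hs (by simpa using this)

/-- Conjugation by the Gaussian weight turns the expanding Gaussian chain into the (dual) contracting
one. -/
theorem integral_expanding {c : ℝ} (hc0 : c ≠ 0) (hc : c ^ 2 < 1) (ψ : ℝ → ℂ) (t : ℝ) :
    ∫ z, ψ (c⁻¹ * t + √(c⁻¹ ^ 2 - 1) * z) ∂stdG =
      (|c| * wt t : ℝ) * ou c (fun x => ψ x / (wt x : ℂ)) t := by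
  have hc2 : 0 < c ^ 2 := by positivity
  have h1 : 0 < c⁻¹ ^ 2 - 1 := by
    rw [inv_pow, sub_pos]
    exact (one_lt_inv₀ hc2).2 hc
  have h2 : 0 < 1 - c ^ 2 := by linarith
  have e0 := integral_affine_stdG (m := c * t) (Real.sqrt_pos.2 h2).ne'
    (fun x => ψ x / (wt x : ℂ))
  rw [ou, integral_affine_stdG (Real.sqrt_pos.2 h1).ne', e0, ← integral_const_mul]
  congr 1
  ext x
  rw [Real.sq_sqrt h1.le, Real.sq_sqrt h2.le]
  have e1 : √(2 * Real.pi * (c⁻¹ ^ 2 - 1)) = |c|⁻¹ * √(2 * Real.pi * (1 - c ^ 2)) := by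
    rw [show 2 * Real.pi * (c⁻¹ ^ 2 - 1) = (c⁻¹) ^ 2 * (2 * Real.pi * (1 - c ^ 2)) by
      field_simp]
    rw [Real.sqrt_mul (sq_nonneg _), Real.sqrt_sq_eq_abs, abs_inv]
  -- Completing the square: both sides have the same quadratic form in the exponent. By `e1`, the
  -- two normalizing constants differ by the factor |c|.
  have e2 : Real.exp (-(x - c⁻¹ * t) ^ 2 / (2 * (c⁻¹ ^ 2 - 1))) * wt x =
      wt t * Real.exp (-(x - c * t) ^ 2 / (2 * (1 - c ^ 2))) := by
    rw [wt, wt, ← Real.exp_add, ← Real.exp_add]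
    congr 1
    have h3 : c⁻¹ ^ 2 - 1 = (1 - c ^ 2) / c ^ 2 := by field_simp
    rw [h3]
    field_simp
    ring
  have e3 : Real.exp (-(x - c⁻¹ * t) ^ 2 / (2 * (c⁻¹ ^ 2 - 1))) =
      wt t * Real.exp (-(x - c * t) ^ 2 / (2 * (1 - c ^ 2))) / wt x := by
    rw [← e2, mul_div_assoc, div_self (wt_pos x).ne', mul_one]
  rw [e1, e3, Complex.real_smul, Complex.real_smul]
  have hw : (wt x : ℂ) ≠ 0 := by exact_mod_cast (wt_pos x).ne'
  push_cast
  rw [mul_inv, inv_inv]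
  field_simp

theorem sq_integral_le {f : ℝ → ℝ} (hf : MemLp f 2 stdG) :
    (∫ t, f t ∂stdG) ^ 2 ≤ ∫ t, f t ^ 2 ∂stdG := by
  have h := variance_nonneg f stdG
  rw [variance_eq_sub hf] at h
  simpa using h

/-- Smoothing: the Ornstein-Uhlenbeck operator maps `L²` to bounded functions, for functions
supported in a fixed interval. -/
theorem exists_norm_ou_le_L2 {c : ℝ} (hc : c ^ 2 < 1) (ρ : ℝ) : ∃ K, 0 ≤ K ∧
    ∀ u : ℝ → ℂ, MemLp u 2 stdG → (∀ t, ρ ≤ |t| → u t = 0) → ∀ t,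
      ‖ou c u t‖ ≤ K * √(∫ x, ‖u x‖ ^ 2 ∂stdG) := by
  have h2 : 0 < 1 - c ^ 2 := by linarith
  -- The first factor compares the peak of the transition density with that of the standard normal;
  -- the second compares Lebesgue measure with γ on |x| < ρ. It depends on ρ, which is harmless,
  -- since only growth rates of powers are at stake.
  set K : ℝ := (√(1 - c ^ 2))⁻¹ * (wt ρ)⁻¹ with hK
  have hK0 : 0 ≤ K := by have := wt_pos ρ; positivity
  refine ⟨K, hK0, fun u hu hsupp t => ?_⟩
  have hui : Integrable u stdG := hu.integrable one_le_two
  have h3 : ‖ou c u t‖ ≤ ∫ x, K * (gaussianPDFReal 0 1 x * ‖u x‖) := by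
    rw [ou, integral_affine_stdG (Real.sqrt_pos.2 h2).ne']
    refine norm_integral_le_of_norm_le (Integrable.const_mul ?_ _) (Eventually.of_forall fun x => ?_)
    · have h := hui.norm
      rw [stdG, gaussianReal_of_var_ne_zero _ one_ne_zero,
        integrable_withDensity_iff_integrable_smul' (measurable_gaussianPDF _ _)
          (ae_of_all _ fun _ => gaussianPDF_lt_top)] at h
      simpa using h
    · rw [Real.sq_sqrt h2.le]
      by_cases hx : ρ ≤ |x|
      · simp [hsupp x hx]
      rw [norm_smul, ← mul_assoc]
      gcongr
      rw [Real.norm_of_nonneg (by positivity), gaussianPDFReal, hK, NNReal.coe_one, mul_one, mul_one,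
        sub_zero, Real.sqrt_mul (by positivity), mul_inv]
      have h4 : wt ρ ≤ Real.exp (-x ^ 2 / 2) := wt_le_of_abs_lt (not_le.1 hx)
      have h5 : Real.exp (-(x - c * t) ^ 2 / (2 * (1 - c ^ 2))) ≤ 1 := by
        rw [Real.exp_le_one_iff]
        exact div_nonpos_of_nonpos_of_nonneg (by nlinarith [sq_nonneg (x - c * t)]) (by linarith)
      have h6 : 1 ≤ (wt ρ)⁻¹ * Real.exp (-x ^ 2 / 2) := by
        rw [inv_mul_eq_div, le_div_iff₀ (wt_pos ρ)]
        linarith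
      calc _ ≤ (√(2 * Real.pi))⁻¹ * (√(1 - c ^ 2))⁻¹ * 1 := by gcongr
        _ ≤ (√(2 * Real.pi))⁻¹ * (√(1 - c ^ 2))⁻¹ * ((wt ρ)⁻¹ * Real.exp (-x ^ 2 / 2)) := by gcongr
        _ = _ := by ring
  have h4 : ∫ x, K * (gaussianPDFReal 0 1 x * ‖u x‖) = K * ∫ x, ‖u x‖ ∂stdG := by
    rw [integral_const_mul, integral_gaussianReal_eq_integral_smul one_ne_zero]
    rfl
  rw [h4] at h3
  refine h3.trans (mul_le_mul_of_nonneg_left ?_ hK0)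
  exact Real.le_sqrt_of_sq_le (sq_integral_le hu.norm)

/-! ### The Banach space of bounded measurable functions -/

local instance instAddCommGroupB : AddCommGroup B := Submodule.addCommGroup _

local instance instModuleB : Module ℂ B := Submodule.module _

local instance instNormedAddCommGroupB : NormedAddCommGroup B := Submodule.normedAddCommGroup _

local instance instNormedSpaceB : NormedSpace ℂ B := Submodule.normedSpace _

local instance instIsTopologicalAddGroupB : IsTopologicalAddGroup B :=
  SeminormedAddCommGroup.toIsTopologicalAddGroup

local instance instContinuousAddB : ContinuousAdd B := IsTopologicalAddGroup.toContinuousAdd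

local instance instContinuousConstSMulB : ContinuousConstSMul ℂ B :=
  IsBoundedSMul.continuousSMul.continuousConstSMul

local instance instAddCommMonoidOp : AddCommMonoid (B →L[ℂ] B) := ContinuousLinearMap.addCommMonoid

local instance instRingOp : Ring (B →L[ℂ] B) := ContinuousLinearMap.ring

local instance instNormedAlgebraOp : NormedAlgebra ℂ (B →L[ℂ] B) := ContinuousLinearMap.toNormedAlgebra

theorem B.ext_apply {φ ψ : B} (h : ∀ x, φ x = ψ x) : φ = ψ := Subtype.ext (lp.ext (funext h))

theorem B.add_apply (φ ψ : B) (x : S1) : (φ + ψ : B) x = φ x + ψ x := rfl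

theorem B.sub_apply (φ ψ : B) (x : S1) : (φ - ψ : B) x = φ x - ψ x := rfl

theorem B.smul_apply (c : ℂ) (φ : B) (x : S1) : (c • φ : B) x = c * φ x := rfl

theorem B.zero_apply (x : S1) : (0 : B) x = 0 := rfl

theorem B.sum_apply {ι : Type*} (s : Finset ι) (φ : ι → B) (x : S1) :
    (∑ i ∈ s, φ i : B) x = ∑ i ∈ s, φ i x := by
  classical
  induction s using Finset.induction_on with
  | empty => simp
  | insert i s hi ih => rw [Finset.sum_insert hi, Finset.sum_insert hi, B.add_apply, ih]

theorem B.norm_le {φ : B} {C : ℝ} (hC : 0 ≤ C) (h : ∀ x, ‖φ x‖ ≤ C) : ‖φ‖ ≤ C :=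
  lp.norm_le_of_forall_le hC h

-- Norm convergence implies pointwise convergence, and pointwise limits of measurable functions are
-- measurable, so the subspace is closed.
local instance instCompleteSpaceB : CompleteSpace B := by
  refine IsClosed.completeSpace_coe (s := (bddMeasSubmodule : Set (lp (fun _ : S1 => ℂ) ∞))) (hs := ?_)
  refine IsSeqClosed.isClosed fun u φ hu hφ => ?_
  change Measurable (φ : S1 → ℂ)
  refine measurable_of_tendsto_metrizable (f := fun n => (u n : S1 → ℂ)) hu ?_
  rw [tendsto_pi_nhds]
  intro x
  rw [tendsto_iff_norm_sub_tendsto_zero] at hφ ⊢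
  refine squeeze_zero (fun _ => norm_nonneg _) (fun n => ?_) hφ
  exact lp.norm_apply_le_norm ENNReal.top_ne_zero (u n - φ) x

/-- The element of `B` given by a bounded measurable function. -/
def mkB (g : S1 → ℂ) (hg : Measurable g) (C : ℝ) (hC : ∀ x, ‖g x‖ ≤ C) : B :=
  ⟨⟨g, memℓp_infty ⟨C, by rintro _ ⟨x, rfl⟩; exact hC x⟩⟩, hg⟩

theorem mkB_apply (g : S1 → ℂ) (hg : Measurable g) (C : ℝ) (hC : ∀ x, ‖g x‖ ≤ C) (x : S1) :
    mkB g hg C hC x = g x := rfl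

/-- The bounded operator on `B` given by a formula. -/
def mkOp (F : B → S1 → ℂ) (C : ℝ) (hC : 0 ≤ C) (hm : ∀ φ, Measurable (F φ))
    (hb : ∀ φ x, ‖F φ x‖ ≤ C * ‖φ‖) (hadd : ∀ φ ψ x, F (φ + ψ) x = F φ x + F ψ x)
    (hsmul : ∀ (c : ℂ) φ x, F (c • φ) x = c * F φ x) : B →L[ℂ] B :=
  LinearMap.mkContinuous
    { toFun := fun φ => mkB (F φ) (hm φ) (C * ‖φ‖) (hb φ)
      map_add' := fun φ ψ => B.ext_apply (hadd φ ψ)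
      map_smul' := fun c φ => B.ext_apply (hsmul c φ) } C
    fun φ => B.norm_le (by positivity) (hb φ)

theorem mkOp_apply {F : B → S1 → ℂ} {C : ℝ} {hC : 0 ≤ C} {hm : ∀ φ, Measurable (F φ)}
    {hb : ∀ φ x, ‖F φ x‖ ≤ C * ‖φ‖} {hadd : ∀ φ ψ x, F (φ + ψ) x = F φ x + F ψ x}
    {hsmul : ∀ (c : ℂ) φ x, F (c • φ) x = c * F φ x} (φ : B) (x : S1) :
    mkOp F C hC hm hb hadd hsmul φ x = F φ x := rfl

open Classical in
/-- Multiplication by the indicator function of a measurable set. -/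
def restr (S : Set S1) (hS : MeasurableSet S) : B →L[ℂ] B :=
  mkOp (fun φ x => if x ∈ S then φ x else 0) 1 zero_le_one
    (fun φ => φ.measurable.ite hS measurable_const)
    (fun φ x => by
      split_ifs
      · rw [one_mul]; exact φ.norm_apply_le x
      · simp)
    (fun φ ψ x => by split_ifs <;> simp)
    (fun c φ x => by split_ifs <;> simp)

theorem restr_apply_of_mem {S : Set S1} {hS : MeasurableSet S} {x : S1} (hx : x ∈ S) (φ : B) :
    restr S hS φ x = φ x := by
  rw [restr, mkOp_apply, if_pos hx]

theorem restr_apply_of_notMem {S : Set S1} {hS : MeasurableSet S} {x : S1} (hx : x ∉ S) (φ : B) :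
    restr S hS φ x = 0 := by
  rw [restr, mkOp_apply, if_neg hx]

/-! ### Real operators -/

/-- A real-valued element of `B`. -/
def IsRealB (φ : B) : Prop := ∀ x, (φ x).im = 0

theorem IsRealOp.add {S T : B →L[ℂ] B} (hS : IsRealOp S) (hT : IsRealOp T) : IsRealOp (S + T) :=
  fun φ hφ x => by
    rw [add_apply, B.add_apply, Complex.add_im, hS φ hφ, hT φ hφ, add_zero]

theorem IsRealOp.sub {S T : B →L[ℂ] B} (hS : IsRealOp S) (hT : IsRealOp T) : IsRealOp (S - T) :=
  fun φ hφ x => by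
    rw [sub_apply, B.sub_apply, Complex.sub_im, hS φ hφ, hT φ hφ, sub_zero]

theorem IsRealOp.mul {S T : B →L[ℂ] B} (hS : IsRealOp S) (hT : IsRealOp T) : IsRealOp (S * T) :=
  fun φ hφ x => hS _ (hT φ hφ) x

theorem IsRealOp.sum {ι : Type*} (s : Finset ι) {T : ι → B →L[ℂ] B} (hT : ∀ i, IsRealOp (T i)) :
    IsRealOp (∑ i ∈ s, T i) := fun φ hφ x => by
  rw [sum_apply, B.sum_apply, Complex.im_sum]
  exact Finset.sum_eq_zero fun i _ => hT i φ hφ x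

theorem isRealOp_restr (S : Set S1) (hS : MeasurableSet S) : IsRealOp (restr S hS) := fun φ hφ x => by
  by_cases hx : x ∈ S
  · rw [restr_apply_of_mem hx, hφ]
  · rw [restr_apply_of_notMem hx, Complex.zero_im]

/-- A functional which is real on real functions. -/
def IsRealFn (l : B →L[ℂ] ℂ) : Prop := ∀ φ : B, IsRealB φ → (l φ).im = 0

theorem IsRealFn.comp {l : B →L[ℂ] ℂ} (hl : IsRealFn l) {T : B →L[ℂ] B} (hT : IsRealOp T) :
    IsRealFn (l.comp T) := fun φ hφ => hl _ (hT φ hφ)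

theorem IsRealFn.smulRight {l : B →L[ℂ] ℂ} (hl : IsRealFn l) {ψ : B} (hψ : IsRealB ψ) :
    IsRealOp (l.smulRight ψ) := fun φ hφ x => by
  rw [ContinuousLinearMap.smulRight_apply, B.smul_apply, Complex.mul_im, hl φ hφ, hψ x]
  simp

/-- Pointwise complex conjugation on `B`. -/
def conjB (φ : B) : B :=
  mkB (fun x => (starRingEnd ℂ) (φ x)) (Complex.continuous_conj.measurable.comp φ.measurable) ‖φ‖
    fun x => by rw [RCLike.norm_conj]; exact φ.norm_apply_le x

/-! ### The angular coordinate -/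

theorem coe_rep (x : S1) : ((rep x : ℝ) : S1) = x := AddCircle.coe_equivIoc

theorem rep_mem (x : S1) : rep x ∈ Set.Ioc (-Real.pi) Real.pi := by
  have := (AddCircle.equivIoc (2 * Real.pi) (-Real.pi) x).2
  exact ⟨this.1, this.2.trans_eq (by ring)⟩

theorem rep_coe {t : ℝ} (ht : t ∈ Set.Ioc (-Real.pi) Real.pi) : rep (t : S1) = t := by
  have ht' : t ∈ Set.Ioc (-Real.pi) (-Real.pi + 2 * Real.pi) := by
    rwa [show -Real.pi + 2 * Real.pi = Real.pi by ring]
  rw [rep, AddCircle.equivIoc_coe_eq ht']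

theorem rep_coe_of_abs_lt {t : ℝ} (ht : |t| < Real.pi) : rep (t : S1) = t :=
  rep_coe ⟨(abs_lt.1 ht).1, (abs_lt.1 ht).2.le⟩

theorem measurable_rep : Measurable rep :=
  measurable_subtype_coe.comp (AddCircle.measurableEquivIoc (2 * Real.pi) (-Real.pi)).measurable

theorem norm_coe_of_abs_le {t : ℝ} (ht : |t| ≤ Real.pi) : ‖(t : S1)‖ = |t| := by
  rw [AddCircle.norm_coe_eq_abs_iff _ Real.two_pi_pos.ne', abs_of_pos Real.two_pi_pos]
  linarith

theorem abs_rep (x : S1) : |rep x| = ‖x‖ := by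
  rw [← norm_coe_of_abs_le, coe_rep]
  exact abs_le.2 ⟨(rep_mem x).1.le, (rep_mem x).2⟩

theorem norm_coe_le_abs (t : ℝ) : ‖(t : S1)‖ ≤ |t| := by
  rcases le_total |t| Real.pi with h | h
  · exact (norm_coe_of_abs_le h).le
  · have := AddCircle.norm_le_half_period (2 * Real.pi) (x := (t : S1)) Real.two_pi_pos.ne'
    rw [abs_of_pos Real.two_pi_pos] at this
    linarith

/-! ### Rescaled charts and the operators living in them -/

/-- A point of the circle, a length scale and a (large) cutoff radius. -/
structure Chart where
  x₀ : S1
  κ : ℝ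
  ρ : ℝ
  κ_pos : 0 < κ
  one_le_ρ : 1 ≤ ρ
  lt_pi : κ * ρ < Real.pi

namespace Chart

variable (ch : Chart)

/-- The rescaled angular coordinate. -/
def coord (x : S1) : ℝ := rep (x - ch.x₀) / ch.κ

/-- The domain of the chart. -/
def dom : Set S1 := {x | |ch.coord x| < ch.ρ}

theorem measurable_coord : Measurable ch.coord :=
  (measurable_rep.comp (measurable_id.sub_const _)).div_const _

theorem measurableSet_dom : MeasurableSet ch.dom :=
  measurableSet_lt ch.measurable_coord.abs measurable_const

theorem ρ_pos : 0 < ch.ρ := one_pos.trans_le ch.one_le_ρ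

theorem abs_coord (x : S1) : |ch.coord x| = ‖x - ch.x₀‖ / ch.κ := by
  rw [coord, abs_div, abs_rep, abs_of_pos ch.κ_pos]

theorem mem_dom_iff (x : S1) : x ∈ ch.dom ↔ dist x ch.x₀ < ch.κ * ch.ρ := by
  rw [dom, Set.mem_ofPred_eq, abs_coord, div_lt_iff₀ ch.κ_pos, dist_eq_norm,
    mul_comm ch.κ ch.ρ]

/-- The inverse of the coordinate. -/
def pt (t : ℝ) : S1 := ch.x₀ + ((ch.κ * t : ℝ) : S1)

theorem pt_coord (x : S1) : ch.pt (ch.coord x) = x := by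
  rw [pt, coord, mul_div_cancel₀ _ ch.κ_pos.ne', coe_rep]
  abel

theorem coord_pt {t : ℝ} (ht : |t| < ch.ρ) : ch.coord (ch.pt t) = t := by
  have h : |ch.κ * t| < Real.pi := by
    rw [abs_mul, abs_of_pos ch.κ_pos]
    exact (mul_lt_mul_of_pos_left ht ch.κ_pos).trans ch.lt_pi
  rw [coord, pt, add_sub_cancel_left, rep_coe_of_abs_lt h, mul_div_cancel_left₀ _ ch.κ_pos.ne']

theorem measurable_pt : Measurable ch.pt :=
  (((AddCircle.continuous_mk' (2 * Real.pi)).measurable.comp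
    (measurable_id.const_mul ch.κ))).const_add ch.x₀

/-- The function on the line which represents `φ` in the chart, extended by zero. -/
def pull (φ : B) (t : ℝ) : ℂ := if |t| < ch.ρ then φ (ch.pt t) else 0

theorem measurable_pull (φ : B) : Measurable (ch.pull φ) :=
  (φ.measurable.comp ch.measurable_pt).ite
    (measurableSet_lt measurable_id.abs measurable_const) measurable_const

theorem pull_of_lt (φ : B) {t : ℝ} (ht : |t| < ch.ρ) : ch.pull φ t = φ (ch.pt t) := if_pos ht

theorem pull_of_le (φ : B) {t : ℝ} (ht : ch.ρ ≤ |t|) : ch.pull φ t = 0 := if_neg (not_lt.2 ht)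

theorem norm_pull_le (φ : B) (t : ℝ) : ‖ch.pull φ t‖ ≤ ‖φ‖ := by
  rw [pull]
  split_ifs
  · exact φ.norm_apply_le _
  · simp

theorem pull_add (φ ψ : B) (t : ℝ) : ch.pull (φ + ψ) t = ch.pull φ t + ch.pull ψ t := by
  rw [pull, pull, pull]
  split_ifs <;> simp

theorem pull_smul (c : ℂ) (φ : B) (t : ℝ) : ch.pull (c • φ) t = c * ch.pull φ t := by
  rw [pull, pull]
  split_ifs <;> simp

theorem pull_im (φ : B) (hφ : IsRealB φ) (t : ℝ) : (ch.pull φ t).im = 0 := by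
  rw [pull]
  split_ifs
  · exact hφ _
  · simp

theorem pull_conjB (φ : B) (t : ℝ) : ch.pull (conjB φ) t = (starRingEnd ℂ) (ch.pull φ t) := by
  rw [pull, pull]
  split_ifs
  · rfl
  · simp

theorem memLp_of_bound {u : ℝ → ℂ} (hu : Measurable u) {C : ℝ} (hC : ∀ t, ‖u t‖ ≤ C) (p : ℝ≥0∞) :
    MemLp u p stdG :=
  MemLp.of_bound hu.aestronglyMeasurable C (Eventually.of_forall hC)

theorem memLp_pull (φ : B) (p : ℝ≥0∞) : MemLp (ch.pull φ) p stdG :=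
  memLp_of_bound (ch.measurable_pull φ) (ch.norm_pull_le φ) p

/-- The function on the circle supported in the chart with a given expression in the chart. -/
def pushFun (ψ : ℝ → ℂ) (x : S1) : ℂ := if |ch.coord x| < ch.ρ then ψ (ch.coord x) else 0

theorem measurable_pushFun {ψ : ℝ → ℂ} (hψ : Measurable ψ) : Measurable (ch.pushFun ψ) :=
  (hψ.comp ch.measurable_coord).ite ch.measurableSet_dom measurable_const

theorem norm_pushFun_le {ψ : ℝ → ℂ} {C : ℝ} (hC : 0 ≤ C) (h : ∀ t, |t| < ch.ρ → ‖ψ t‖ ≤ C)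
    (x : S1) : ‖ch.pushFun ψ x‖ ≤ C := by
  rw [pushFun]
  split_ifs with hx
  · exact h _ hx
  · simpa using hC

theorem pushFun_of_notMem (ψ : ℝ → ℂ) {x : S1} (hx : x ∉ ch.dom) : ch.pushFun ψ x = 0 := if_neg hx

theorem pushFun_of_mem (ψ : ℝ → ℂ) {x : S1} (hx : x ∈ ch.dom) :
    ch.pushFun ψ x = ψ (ch.coord x) := if_pos hx

theorem exists_bound_of_continuous {g : ℝ → ℝ} (hg : Continuous g) :
    ∃ C, 0 ≤ C ∧ ∀ t, |t| < ch.ρ → ‖(g t : ℂ)‖ ≤ C := by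
  obtain ⟨C, hC⟩ := (isCompact_Icc (a := -ch.ρ) (b := ch.ρ)).exists_bound_of_continuousOn
    hg.continuousOn
  refine ⟨max C 0, le_max_right _ _, fun t ht => ?_⟩
  rw [Complex.norm_real]
  exact (hC t ⟨(abs_lt.1 ht).1.le, (abs_lt.1 ht).2.le⟩).trans (le_max_left _ _)

/-- The element of `B` supported in the chart with a given real expression in the chart. -/
def pushB (g : ℝ → ℝ) (hg : Measurable g) (hb : ∃ C, 0 ≤ C ∧ ∀ t, |t| < ch.ρ → ‖(g t : ℂ)‖ ≤ C) : B :=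
  mkB (ch.pushFun fun t => (g t : ℂ))
    (ch.measurable_pushFun (Complex.measurable_ofReal.comp hg)) hb.choose
    (ch.norm_pushFun_le hb.choose_spec.1 hb.choose_spec.2)

theorem pushB_apply {g : ℝ → ℝ} {hg : Measurable g}
    {hb : ∃ C, 0 ≤ C ∧ ∀ t, |t| < ch.ρ → ‖(g t : ℂ)‖ ≤ C} (x : S1) :
    ch.pushB g hg hb x = ch.pushFun (fun t => (g t : ℂ)) x := rfl

theorem isRealB_pushB {g : ℝ → ℝ} {hg : Measurable g}
    {hb : ∃ C, 0 ≤ C ∧ ∀ t, |t| < ch.ρ → ‖(g t : ℂ)‖ ≤ C} : IsRealB (ch.pushB g hg hb) := fun x => by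
  rw [pushB_apply, pushFun]
  split_ifs <;> simp

theorem pull_eq_of_pushFun {φ : B} {ψ : ℝ → ℂ} (h : ∀ x, φ x = ch.pushFun ψ x) (t : ℝ) :
    ch.pull φ t = if |t| < ch.ρ then ψ t else 0 := by
  rw [pull]
  split_ifs with ht
  · rw [h, pushFun, ch.coord_pt ht, if_pos ht]
  · rfl

theorem integrable_ou {c : ℝ} {u : ℝ → ℂ} (hu : Measurable u) {C : ℝ} (hC : ∀ t, ‖u t‖ ≤ C) (t : ℝ) :
    Integrable (fun z => u (c * t + √(1 - c ^ 2) * z)) stdG :=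
  Integrable.of_bound ((hu.comp (by fun_prop)).aestronglyMeasurable) C
    (Eventually.of_forall fun _ => hC _)

theorem ou_pull_add (c : ℝ) (φ ψ : B) (t : ℝ) :
    ou c (ch.pull (φ + ψ)) t = ou c (ch.pull φ) t + ou c (ch.pull ψ) t := by
  rw [ou, ou, ou, ← integral_add (integrable_ou (ch.measurable_pull φ) (ch.norm_pull_le φ) t)
    (integrable_ou (ch.measurable_pull ψ) (ch.norm_pull_le ψ) t)]
  simp_rw [pull_add]

theorem ou_pull_smul (c : ℝ) (a : ℂ) (φ : B) (t : ℝ) :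
    ou c (ch.pull (a • φ)) t = a * ou c (ch.pull φ) t := by
  rw [ou, ou, ← integral_const_mul]
  simp_rw [pull_smul]

/-- The Ornstein-Uhlenbeck operator in the chart, with killing outside of the chart. -/
def ouOp (c : ℝ) : B →L[ℂ] B :=
  mkOp (fun φ => ch.pushFun (ou c (ch.pull φ))) 1 zero_le_one
    (fun φ => ch.measurable_pushFun (measurable_ou c (ch.measurable_pull φ)))
    (fun φ x => by
      rw [one_mul]
      exact ch.norm_pushFun_le (norm_nonneg _) (fun t _ => norm_ou_le c (ch.norm_pull_le φ) t) x)
    (fun φ ψ x => by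
      rw [pushFun, pushFun, pushFun]
      split_ifs
      · exact ch.ou_pull_add c φ ψ _
      · simp)
    (fun a φ x => by
      rw [pushFun, pushFun]
      split_ifs
      · exact ch.ou_pull_smul c a φ _
      · simp)

theorem ouOp_apply (c : ℝ) (φ : B) (x : S1) : ch.ouOp c φ x = ch.pushFun (ou c (ch.pull φ)) x := rfl

theorem pull_ouOp (c : ℝ) (φ : B) (t : ℝ) :
    ch.pull (ch.ouOp c φ) t = if |t| < ch.ρ then ou c (ch.pull φ) t else 0 :=
  ch.pull_eq_of_pushFun (ch.ouOp_apply c φ) t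

theorem isRealOp_ouOp (c : ℝ) : IsRealOp (ch.ouOp c) := fun φ hφ x => by
  rw [ouOp_apply, pushFun]
  split_ifs
  · rw [ou]
    have h := integral_im (integrable_ou (c := c) (ch.measurable_pull φ) (ch.norm_pull_le φ)
      (ch.coord x))
    have h2 : ∀ z, (ch.pull φ (c * ch.coord x + √(1 - c ^ 2) * z)).im = 0 := fun z =>
      ch.pull_im φ hφ _
    simp only [RCLike.im_to_complex, h2, integral_zero] at h
    exact h.symm
  · simp

/-- Multiplication by a continuous function of the coordinate, in the chart. -/
def mulOp (g : ℝ → ℝ) (hg : Continuous g) : B →L[ℂ] B :=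
  mkOp (fun φ => ch.pushFun fun t => (g t : ℂ) * ch.pull φ t) (ch.exists_bound_of_continuous hg).choose
    (ch.exists_bound_of_continuous hg).choose_spec.1
    (fun φ => ch.measurable_pushFun
      ((Complex.measurable_ofReal.comp hg.measurable).mul (ch.measurable_pull φ)))
    (fun φ x => by
      have h := (ch.exists_bound_of_continuous hg).choose_spec
      refine ch.norm_pushFun_le (mul_nonneg h.1 (norm_nonneg _)) (fun t ht => ?_) x
      rw [norm_mul]
      exact mul_le_mul (h.2 t ht) (ch.norm_pull_le φ t) (norm_nonneg _) h.1)
    (fun φ ψ x => by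
      rw [pushFun, pushFun, pushFun]
      split_ifs
      · rw [pull_add, mul_add]
      · simp)
    (fun a φ x => by
      rw [pushFun, pushFun]
      split_ifs
      · rw [pull_smul]; ring
      · simp)

theorem mulOp_apply (g : ℝ → ℝ) (hg : Continuous g) (φ : B) (x : S1) :
    ch.mulOp g hg φ x = ch.pushFun (fun t => (g t : ℂ) * ch.pull φ t) x := rfl

theorem pull_mulOp (g : ℝ → ℝ) (hg : Continuous g) (φ : B) (t : ℝ) :
    ch.pull (ch.mulOp g hg φ) t = (g t : ℂ) * ch.pull φ t := by
  rw [ch.pull_eq_of_pushFun (ch.mulOp_apply g hg φ) t]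
  split_ifs with ht
  · rfl
  · rw [ch.pull_of_le _ (not_lt.1 ht), mul_zero]

theorem isRealOp_mulOp (g : ℝ → ℝ) (hg : Continuous g) : IsRealOp (ch.mulOp g hg) := fun φ hφ x => by
  rw [mulOp_apply, pushFun]
  split_ifs
  · simp [ch.pull_im φ hφ]
  · simp

/-- The functional `φ ↦ ∫ φ d dγ` in the chart. -/
def fn (d : ℝ → ℝ) (hd : MemLp d 2 stdG) : B →L[ℂ] ℂ :=
  LinearMap.mkContinuous
    { toFun := fun φ => ∫ t, ch.pull φ t * (d t : ℂ) ∂stdG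
      map_add' := fun φ ψ => by
        rw [← integral_add]
        · simp_rw [pull_add, add_mul]
        · exact (ch.memLp_pull φ 2).integrable_mul hd.ofReal
        · exact (ch.memLp_pull ψ 2).integrable_mul hd.ofReal
      map_smul' := fun c φ => by
        simp_rw [pull_smul, RingHom.id_apply, smul_eq_mul, ← integral_const_mul, mul_assoc] }
    (∫ t, |d t| ∂stdG) fun φ => by
      rw [← integral_mul_const]
      refine norm_integral_le_of_norm_le ((hd.integrable one_le_two).norm.mul_const _)
        (Eventually.of_forall fun t => ?_)
      rw [norm_mul, Complex.norm_real, mul_comm, Real.norm_eq_abs]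
      gcongr
      exact ch.norm_pull_le φ t

theorem fn_apply (d : ℝ → ℝ) (hd : MemLp d 2 stdG) (φ : B) :
    ch.fn d hd φ = ∫ t, ch.pull φ t * (d t : ℂ) ∂stdG := rfl

theorem isRealFn_fn (d : ℝ → ℝ) (hd : MemLp d 2 stdG) : IsRealFn (ch.fn d hd) := fun φ hφ => by
  have h2 : ∀ t, ch.pull φ t * (d t : ℂ) = (((ch.pull φ t).re * d t : ℝ) : ℂ) := fun t => by
    apply Complex.ext <;> simp [ch.pull_im φ hφ]
  rw [fn_apply]
  simp_rw [h2]
  rw [integral_complex_ofReal, Complex.ofReal_im]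

end Chart

/-! ### The block at the stable fixed point -/

theorem functional_sum_smul {E ι : Type*} [NormedAddCommGroup E] [NormedSpace ℂ E] (l : E →L[ℂ] ℂ)
    (s : Finset ι) (a : ι → ℂ) (v : ι → E) :
    l (∑ i ∈ s, a i • v i) = ∑ i ∈ s, a i * l (v i) := by
  rw [map_sum]
  simp

theorem norm_toLp_le_norm_toLp {u v : ℝ → ℂ} (hu : MemLp u 2 stdG) (hv : MemLp v 2 stdG)
    (h : ∀ t, ‖u t‖ ≤ ‖v t‖) : ‖hu.toLp‖ ≤ ‖hv.toLp‖ := by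
  refine le_of_sq_le_sq ?_ (norm_nonneg _)
  rw [norm_toLp_sq hu, norm_toLp_sq hv]
  exact integral_mono hu.norm.integrable_sq hv.norm.integrable_sq
    fun t => pow_le_pow_left₀ (norm_nonneg _) (h t) 2

theorem norm_toLp_le_of_bound {u : ℝ → ℂ} (hu : MemLp u 2 stdG) {C : ℝ} (hC : 0 ≤ C)
    (h : ∀ t, ‖u t‖ ≤ C) : ‖hu.toLp‖ ≤ C := by
  refine le_of_sq_le_sq ?_ hC
  rw [norm_toLp_sq hu]
  calc ∫ t, ‖u t‖ ^ 2 ∂stdG ≤ ∫ _, C ^ 2 ∂stdG :=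
        integral_mono hu.norm.integrable_sq (integrable_const _)
          fun t => pow_le_pow_left₀ (norm_nonneg _) (h t) 2
    _ = C ^ 2 := by simp

theorem norm_integral_mul_le {u v : ℝ → ℂ} (hu : MemLp u 2 stdG) (hv : MemLp v 2 stdG) :
    ‖∫ t, u t * v t ∂stdG‖ ≤ ‖hu.toLp‖ * ‖hv.toLp‖ := by
  have hu' : MemLp (fun t => (starRingEnd ℂ) (u t)) 2 stdG := hu.star
  have e : ∫ t, u t * v t ∂stdG = inner ℂ hu'.toLp hv.toLp := by
    rw [L2.inner_def]
    refine integral_congr_ae ?_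
    filter_upwards [hu'.coeFn_toLp, hv.coeFn_toLp] with t h1 h2
    rw [h1, h2]
    simp [mul_comm]
  rw [e]
  refine (norm_inner_le_norm _ _).trans ?_
  gcongr
  exact norm_toLp_le_norm_toLp hu' hu fun t => by rw [RCLike.norm_conj]

/-- The part of a Hermite polynomial which lives far from the origin. -/
def tailHe (j : ℕ) (ρ : ℝ) : ℝ → ℂ := {t : ℝ | ρ ≤ |t|}.indicator fun t => (He j t : ℂ)

theorem measurableSet_tail (ρ : ℝ) : MeasurableSet {t : ℝ | ρ ≤ |t|} :=
  measurableSet_le measurable_const measurable_id.abs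

theorem memLp_tailHe (j : ℕ) (ρ : ℝ) : MemLp (tailHe j ρ) 2 stdG :=
  (memLp_He j).indicator (measurableSet_tail ρ)

/-- The `L²` norm of `tailHe j ρ`. -/
def tailNorm (j : ℕ) (ρ : ℝ) : ℝ := ‖(memLp_tailHe j ρ).toLp‖

theorem tailNorm_nonneg (j : ℕ) (ρ : ℝ) : 0 ≤ tailNorm j ρ := norm_nonneg _

theorem tendsto_tailNorm (j : ℕ) : Tendsto (tailNorm j) atTop (𝓝 0) := by
  have h := tendsto_tail_integral (memLp_He j).norm.integrable_sq
  have e : ∀ ρ, tailNorm j ρ = √(∫ t in {t : ℝ | ρ ≤ |t|}, ‖(He j t : ℂ)‖ ^ 2 ∂stdG) := fun ρ => by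
    rw [tailNorm, eq_comm, Real.sqrt_eq_iff_eq_sq _ (norm_nonneg _), norm_toLp_sq,
      ← integral_indicator (measurableSet_tail ρ)]
    · congr 1
      ext t
      rw [tailHe]
      by_cases ht : t ∈ {t : ℝ | ρ ≤ |t|}
      · rw [Set.indicator_of_mem ht, Set.indicator_of_mem ht]
      · rw [Set.indicator_of_notMem ht, Set.indicator_of_notMem ht]; simp
    · exact integral_nonneg fun _ => sq_nonneg _
  have h2 := (Real.continuous_sqrt.tendsto 0).comp h
  rw [Real.sqrt_zero] at h2
  exact h2.congr fun ρ => (e ρ).symm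

/-- Bounded functions supported in `(-1, 1)` which are dual to the first `N` Hermite polynomials. -/
structure DualHe (N : ℕ) where
  d : Fin N → ℝ → ℝ
  C : ℝ
  meas : ∀ j, Measurable (d j)
  supp : ∀ j t, 1 ≤ |t| → d j t = 0
  C_nonneg : 0 ≤ C
  bound : ∀ j t, |d j t| ≤ C
  biorth : ∀ i j : Fin N, ∫ t, (He i t : ℂ) * (d j t : ℂ) ∂stdG = if i = j then 1 else 0

theorem nonempty_dualHe (N : ℕ) : Nonempty (DualHe N) := by
  obtain ⟨d, h1, h2, ⟨C, h3, h4⟩, h5⟩ := exists_dual_He N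
  exact ⟨⟨d, C, h1, h2, h3, h4, h5⟩⟩

theorem DualHe.memLp {N : ℕ} (D : DualHe N) (j : Fin N) : MemLp (D.d j) 2 stdG :=
  MemLp.of_bound (D.meas j).aestronglyMeasurable D.C (Eventually.of_forall (D.bound j))

namespace Chart

variable (ch : Chart)

/-- The class in `L²` of the Gaussian measure of a function in the chart. -/
def L2 (φ : B) : Lp ℂ 2 stdG := (ch.memLp_pull φ 2).toLp

theorem L2_add (φ ψ : B) : ch.L2 (φ + ψ) = ch.L2 φ + ch.L2 ψ := by
  rw [L2, L2, L2, ← MemLp.toLp_add]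
  congr 1
  exact funext (ch.pull_add φ ψ)

theorem L2_smul (a : ℂ) (φ : B) : ch.L2 (a • φ) = a • ch.L2 φ := by
  rw [L2, L2, ← MemLp.toLp_const_smul]
  congr 1
  exact funext (ch.pull_smul a φ)

/-- `Chart.L2` as a linear map. -/
def L2Lin : B →ₗ[ℂ] Lp ℂ 2 stdG where
  toFun := ch.L2
  map_add' := ch.L2_add
  map_smul' := ch.L2_smul

theorem L2Lin_apply (φ : B) : ch.L2Lin φ = ch.L2 φ := rfl

theorem norm_L2_le (φ : B) : ‖ch.L2 φ‖ ≤ ‖φ‖ :=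
  norm_toLp_le_of_bound _ (norm_nonneg _) (ch.norm_pull_le φ)

theorem memLp_ou (c : ℝ) (φ : B) : MemLp (ou c (ch.pull φ)) 2 stdG :=
  memLp_of_bound (measurable_ou c (ch.measurable_pull φ)) (norm_ou_le c (ch.norm_pull_le φ)) 2

theorem memLp_He' (j : ℕ) : MemLp (He j) 2 stdG := memLp_polynomial _

/-- The functional `φ ↦ ∫ φ He_j dγ` in the chart. -/
def fnHe (j : ℕ) : B →L[ℂ] ℂ := ch.fn (He j) (memLp_He' j)

theorem fnHe_apply (j : ℕ) (φ : B) : ch.fnHe j φ = ∫ t, ch.pull φ t * (He j t : ℂ) ∂stdG := rfl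

theorem norm_ou_toLp_le {c : ℝ} (hc : c ^ 2 ≤ 1) {N : ℕ} {φ : B} (h : ∀ j < N, ch.fnHe j φ = 0) :
    ‖(ch.memLp_ou c φ).toLp‖ ≤ |c| ^ N * ‖ch.L2 φ‖ := by
  refine le_of_sq_le_sq ?_ (by positivity)
  rw [mul_pow, L2, norm_toLp_sq, norm_toLp_sq, ← pow_mul, mul_comm N, pow_mul, sq_abs]
  exact integral_norm_ou_sq_le hc (ch.memLp_pull φ 2) (ch.memLp_ou c φ) h

theorem norm_L2_ouOp_le {c : ℝ} (hc : c ^ 2 ≤ 1) {N : ℕ} {φ : B} (h : ∀ j < N, ch.fnHe j φ = 0) :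
    ‖ch.L2 (ch.ouOp c φ)‖ ≤ |c| ^ N * ‖ch.L2 φ‖ := by
  refine (norm_toLp_le_norm_toLp _ (ch.memLp_ou c φ) fun t => ?_).trans (ch.norm_ou_toLp_le hc h)
  rw [pull_ouOp]
  split_ifs <;> simp

/-- Without killing, c^j would be an exact left eigenvalue by symmetry. The defect is the pairing of
`ou` with the part of He_j beyond ρ, estimated by Cauchy-Schwarz. -/
theorem fnHe_ouOp {c : ℝ} (hc : c ^ 2 ≤ 1) (j : ℕ) (φ : B) :
    ‖(c : ℂ) ^ j * ch.fnHe j φ - ch.fnHe j (ch.ouOp c φ)‖ ≤ tailNorm j ch.ρ * ‖ch.L2 φ‖ := by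
  have h1 : (c : ℂ) ^ j * ch.fnHe j φ = ∫ t, ou c (ch.pull φ) t * (He j t : ℂ) ∂stdG := by
    rw [ou_symm hc (ch.memLp_pull φ 2) (memLp_He j), fnHe_apply, ← integral_const_mul]
    simp_rw [ou_He hc]
    congr 1
    ext t
    ring
  have h2 : (c : ℂ) ^ j * ch.fnHe j φ - ch.fnHe j (ch.ouOp c φ) =
      ∫ t, tailHe j ch.ρ t * ou c (ch.pull φ) t ∂stdG := by
    have i1 : Integrable (fun t => ou c (ch.pull φ) t * (He j t : ℂ)) stdG :=
      (ch.memLp_ou c φ).integrable_mul (memLp_He j)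
    have i2 : Integrable (fun t => ch.pull (ch.ouOp c φ) t * (He j t : ℂ)) stdG :=
      (ch.memLp_pull _ 2).integrable_mul (memLp_He j)
    rw [h1, fnHe_apply, ← integral_sub i1 i2]
    congr 1
    ext t
    rw [pull_ouOp, tailHe]
    by_cases ht : |t| < ch.ρ
    · rw [if_pos ht, Set.indicator_of_notMem (by simpa using ht)]
      ring
    · rw [if_neg ht, Set.indicator_of_mem (by simpa using ht)]
      ring
  rw [h2]
  refine (norm_integral_mul_le (memLp_tailHe j ch.ρ) (ch.memLp_ou c φ)).trans ?_
  have h3 := ch.norm_ou_toLp_le hc (N := 0) (φ := φ) (by simp)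
  rw [pow_zero, one_mul] at h3
  rw [tailNorm]
  gcongr

theorem exists_norm_ouOp_le {c : ℝ} (hc : c ^ 2 < 1) :
    ∃ K, 0 ≤ K ∧ ∀ φ, ‖ch.ouOp c φ‖ ≤ K * ‖ch.L2 φ‖ := by
  obtain ⟨K, hK, h⟩ := exists_norm_ou_le_L2 hc ch.ρ
  refine ⟨K, hK, fun φ => B.norm_le (by positivity) fun x => ?_⟩
  rw [ouOp_apply]
  refine ch.norm_pushFun_le (by positivity) (fun t _ => ?_) x
  have h1 := h (ch.pull φ) (ch.memLp_pull φ 2) (fun t ht => ch.pull_of_le φ ht) t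
  rwa [← norm_toLp_sq (ch.memLp_pull φ 2), Real.sqrt_sq (norm_nonneg _)] at h1

variable {N : ℕ} (D : DualHe N)

theorem bound_dual (j : Fin N) : ∃ C, 0 ≤ C ∧ ∀ t, |t| < ch.ρ → ‖(D.d j t : ℂ)‖ ≤ C :=
  ⟨D.C, D.C_nonneg, fun t _ => by rw [Complex.norm_real]; exact D.bound j t⟩

/-- The dual functions, transported to the circle. -/
def dualB (j : Fin N) : B := ch.pushB (D.d j) (D.meas j) (ch.bound_dual D j)

theorem pull_dualB (j : Fin N) (t : ℝ) : ch.pull (ch.dualB D j) t = (D.d j t : ℂ) := by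
  rw [ch.pull_eq_of_pushFun (φ := ch.dualB D j) (ψ := fun t => (D.d j t : ℂ)) (fun _ => rfl)]
  split_ifs with ht
  · rfl
  · rw [D.supp j t (ch.one_le_ρ.trans (not_lt.1 ht)), Complex.ofReal_zero]

theorem norm_dualB_le (j : Fin N) : ‖ch.dualB D j‖ ≤ D.C :=
  B.norm_le D.C_nonneg fun x => by
    rw [dualB, pushB_apply]
    exact ch.norm_pushFun_le D.C_nonneg
      (fun t _ => by rw [Complex.norm_real]; exact D.bound j t) x

theorem fnHe_dualB (i j : Fin N) : ch.fnHe i (ch.dualB D j) = if i = j then 1 else 0 := by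
  rw [fnHe_apply, ← D.biorth i j]
  simp_rw [pull_dualB, mul_comm]

/-- The Ornstein-Uhlenbeck operator in the chart, with the leading left eigenvectors removed. -/
def stableOp (c : ℝ) : B →L[ℂ] B :=
  ch.ouOp c - ∑ j : Fin N, ((ch.fnHe j).comp (ch.ouOp c)).smulRight (ch.dualB D j)

theorem stableOp_apply (c : ℝ) (φ : B) : ch.stableOp D c φ =
    ch.ouOp c φ - ∑ j : Fin N, ch.fnHe j (ch.ouOp c φ) • ch.dualB D j := by
  rw [stableOp, sub_apply, sum_apply]
  rfl

theorem isRealOp_stableOp (c : ℝ) : IsRealOp (ch.stableOp D c) :=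
  (ch.isRealOp_ouOp c).sub (IsRealOp.sum _ fun _ =>
    (((ch.isRealFn_fn _ _).comp (ch.isRealOp_ouOp c))).smulRight ch.isRealB_pushB)

theorem fnHe_stableOp (c : ℝ) (i : Fin N) (φ : B) : ch.fnHe i (ch.stableOp D c φ) = 0 := by
  rw [stableOp_apply, (ch.fnHe i).map_sub, functional_sum_smul]
  simp [fnHe_dualB]

theorem ouOp_congr {c : ℝ} {φ ψ : B} (h : ∀ t, ch.pull φ t = ch.pull ψ t) :
    ch.ouOp c φ = ch.ouOp c ψ :=
  B.ext_apply fun x => by rw [ouOp_apply, ouOp_apply, show ch.pull φ = ch.pull ψ from funext h]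

theorem stableOp_congr {c : ℝ} {φ ψ : B} (h : ∀ t, ch.pull φ t = ch.pull ψ t) :
    ch.stableOp D c φ = ch.stableOp D c ψ := by
  rw [stableOp_apply, stableOp_apply, ch.ouOp_congr h]

theorem ouOp_apply_of_notMem (c : ℝ) (φ : B) {x : S1} (hx : x ∉ ch.dom) : ch.ouOp c φ x = 0 := by
  rw [ouOp_apply, pushFun_of_notMem _ _ hx]

theorem dualB_apply_of_notMem (j : Fin N) {x : S1} (hx : x ∉ ch.dom) : ch.dualB D j x = 0 := by
  rw [dualB, pushB_apply, pushFun_of_notMem _ _ hx]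

theorem stableOp_apply_of_notMem (c : ℝ) (φ : B) {x : S1} (hx : x ∉ ch.dom) :
    ch.stableOp D c φ x = 0 := by
  rw [stableOp_apply, B.sub_apply, B.sum_apply, ch.ouOp_apply_of_notMem c φ hx]
  simp [ch.dualB_apply_of_notMem D _ hx]

theorem exists_norm_stableOp_le {c : ℝ} (hc : c ^ 2 < 1) :
    ∃ K, 0 ≤ K ∧ ∀ φ, ‖ch.stableOp D c φ‖ ≤ K * ‖ch.L2 φ‖ := by
  obtain ⟨K, hK, h⟩ := ch.exists_norm_ouOp_le hc
  refine ⟨K + ∑ j : Fin N, ‖ch.fnHe j‖ * K * ‖ch.dualB D j‖, by positivity, fun φ => ?_⟩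
  rw [stableOp_apply, add_mul, Finset.sum_mul]
  refine (norm_sub_le _ _).trans (add_le_add (h φ) ((norm_sum_le _ _).trans ?_))
  refine Finset.sum_le_sum fun j _ => ?_
  rw [norm_smul]
  calc _ ≤ (‖ch.fnHe j‖ * (K * ‖ch.L2 φ‖)) * ‖ch.dualB D j‖ := by
        gcongr
        exact ((ch.fnHe j).le_opNorm _).trans (by gcongr; exact h φ)
    _ = _ := by ring

/-- The first term is the Parseval contraction. On the common kernel of the functionals, the
coefficients subtracted in `stableOp` are pure killing defects, hence bounded by tail norms. -/
theorem norm_L2_stableOp_le {c : ℝ} (hc : c ^ 2 ≤ 1) {φ : B} (h : ∀ j : Fin N, ch.fnHe j φ = 0) :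
    ‖ch.L2 (ch.stableOp D c φ)‖ ≤ (|c| ^ N + D.C * ∑ j : Fin N, tailNorm j ch.ρ) * ‖ch.L2 φ‖ := by
  rw [stableOp_apply, ← L2Lin_apply, map_sub, map_sum, add_mul, Finset.mul_sum, Finset.sum_mul]
  refine (norm_sub_le _ _).trans (add_le_add ?_ ((norm_sum_le _ _).trans ?_))
  · exact ch.norm_L2_ouOp_le hc fun j hj => h ⟨j, hj⟩
  · refine Finset.sum_le_sum fun j _ => ?_
    rw [map_smul, norm_smul, L2Lin_apply]
    have h1 := ch.fnHe_ouOp hc j φ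
    rw [h j, mul_zero, zero_sub, norm_neg] at h1
    have h2 := (ch.norm_L2_le (ch.dualB D j)).trans (ch.norm_dualB_le D j)
    calc _ ≤ (tailNorm j ch.ρ * ‖ch.L2 φ‖) * D.C := mul_le_mul h1 h2 (norm_nonneg _)
          (mul_nonneg (tailNorm_nonneg _ _) (norm_nonneg _))
      _ = _ := by ring

theorem norm_L2_stableOp_pow_le {c θ : ℝ} (hc : c ^ 2 ≤ 1)
    (hθ : |c| ^ N + D.C * ∑ j : Fin N, tailNorm j ch.ρ ≤ θ) (φ : B) (n : ℕ) :
    ‖ch.L2 ((ch.stableOp D c ^ (n + 1)) φ)‖ ≤ θ ^ n * ‖ch.L2 (ch.stableOp D c φ)‖ := by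
  have hθ0 : 0 ≤ θ := le_trans (add_nonneg (by positivity) (mul_nonneg D.C_nonneg
    (Finset.sum_nonneg fun _ _ => tailNorm_nonneg _ _))) hθ
  induction n with
  | zero => simp
  | succ n ih =>
    have e : (ch.stableOp D c ^ (n + 1 + 1)) φ =
        ch.stableOp D c ((ch.stableOp D c ^ (n + 1)) φ) := by
      rw [pow_succ' _ (n + 1)]; rfl
    have e2 : (ch.stableOp D c ^ (n + 1)) φ =
        ch.stableOp D c ((ch.stableOp D c ^ n) φ) := by
      rw [pow_succ' _ n]; rfl
    rw [e]
    refine (ch.norm_L2_stableOp_le D hc fun j => by rw [e2, fnHe_stableOp]).trans ?_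
    rw [pow_succ' θ, mul_assoc]
    exact mul_le_mul hθ ih (norm_nonneg _) hθ0

/-- Powers contract by θ in L² once in the common kernel of the `fnHe j`. The shift by 2 accounts
for one application that enters this kernel and one that returns from L² to the sup norm by
smoothing. -/
theorem stableOp_notMem_spectrum {c θ : ℝ} (hc : c ^ 2 < 1)
    (hθ : |c| ^ N + D.C * ∑ j : Fin N, tailNorm j ch.ρ ≤ θ) {z : ℂ} (hz : θ < ‖z‖) :
    z ∉ spectrum ℂ (ch.stableOp D c) := by
  have hθ0 : 0 ≤ θ := le_trans (add_nonneg (by positivity) (mul_nonneg D.C_nonneg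
    (Finset.sum_nonneg fun _ _ => tailNorm_nonneg _ _))) hθ
  obtain ⟨K, hK, h⟩ := ch.exists_norm_stableOp_le D hc
  refine notMem_spectrum_of_norm_pow_le (C := K * ‖ch.stableOp D c‖) hθ0 (k := 2) (fun n => ?_) hz
  refine ContinuousLinearMap.opNorm_le_bound _ (by positivity) fun φ => ?_
  have e : (ch.stableOp D c ^ (n + 2)) φ =
      ch.stableOp D c ((ch.stableOp D c ^ (n + 1)) φ) := by
    rw [pow_succ' _ (n + 1)]; rfl
  rw [e]
  calc _ ≤ K * ‖ch.L2 ((ch.stableOp D c ^ (n + 1)) φ)‖ := h _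
    _ ≤ K * (θ ^ n * ‖ch.L2 (ch.stableOp D c φ)‖) := by
        gcongr
        exact ch.norm_L2_stableOp_pow_le D hc.le hθ φ n
    _ ≤ K * (θ ^ n * (‖ch.stableOp D c‖ * ‖φ‖)) := by
        gcongr
        exact (ch.norm_L2_le _).trans ((ch.stableOp D c).le_opNorm φ)
    _ = _ := by ring

/-- `stableOp` subtracts the coefficients of `ouOp c φ`; restoring them with the exact eigenvalues
c^j instead leaves only the killing defects. -/
theorem norm_stable_sub_ouOp_le {c : ℝ} (hc : c ^ 2 ≤ 1) (φ : B) :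
    ‖ch.stableOp D c φ + ∑ j : Fin N, ((c : ℂ) ^ (j : ℕ) * ch.fnHe j φ) • ch.dualB D j
      - ch.ouOp c φ‖ ≤ (D.C * ∑ j : Fin N, tailNorm j ch.ρ) * ‖φ‖ := by
  have e : ch.stableOp D c φ + ∑ j : Fin N, ((c : ℂ) ^ (j : ℕ) * ch.fnHe j φ) • ch.dualB D j
      - ch.ouOp c φ = ∑ j : Fin N, ((c : ℂ) ^ (j : ℕ) * ch.fnHe j φ - ch.fnHe j (ch.ouOp c φ)) •
        ch.dualB D j := by
    rw [stableOp_apply]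
    simp only [sub_smul, Finset.sum_sub_distrib]
    abel
  rw [e, Finset.mul_sum, Finset.sum_mul]
  refine (norm_sum_le _ _).trans (Finset.sum_le_sum fun j _ => ?_)
  rw [norm_smul]
  calc _ ≤ (tailNorm j ch.ρ * ‖φ‖) * D.C := mul_le_mul
        ((ch.fnHe_ouOp hc j φ).trans (mul_le_mul_of_nonneg_left (ch.norm_L2_le φ)
          (tailNorm_nonneg _ _))) (ch.norm_dualB_le D j) (norm_nonneg _)
          (mul_nonneg (tailNorm_nonneg _ _) (norm_nonneg _))
    _ = _ := by ring

end Chart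

/-! ### The block at the unstable fixed point, by duality -/

theorem operator_sum_smul {E ι : Type*} [NormedAddCommGroup E] [NormedSpace ℂ E] (T : E →L[ℂ] E)
    (s : Finset ι) (a : ι → ℂ) (v : ι → E) :
    T (∑ i ∈ s, a i • v i) = ∑ i ∈ s, a i • T (v i) := by
  rw [map_sum]
  simp

theorem norm_sum_fin_le {E : Type*} [SeminormedAddCommGroup E] {N : ℕ} {v : Fin N → E} {C : ℝ}
    (h : ∀ j, ‖v j‖ ≤ C) : ‖∑ j, v j‖ ≤ N * C := by
  have := norm_sum_le_of_le Finset.univ fun j _ => h j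
  simpa using this

theorem integrable_He_affine (j : ℕ) (a b : ℝ) : Integrable (fun z => (He j (a + b * z) : ℂ)) stdG := by
  have h := integrable_polynomial
    (((Polynomial.hermite j).map (Int.castRingHom ℝ)).comp
      (Polynomial.C a + Polynomial.C b * Polynomial.X))
  simp only [Polynomial.eval_comp, Polynomial.eval_add, Polynomial.eval_mul, Polynomial.eval_C,
    Polynomial.eval_X] at h
  exact h.ofReal

/-- The weighted Hermite functions `e^{-t²/2} He_j(t)`. -/
def wHe (j : ℕ) (t : ℝ) : ℝ := wt t * He j t

theorem continuous_wHe (j : ℕ) : Continuous (wHe j) := continuous_wt.mul (continuous_He j)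

theorem exists_abs_wHe_le (N : ℕ) : ∃ C, 0 ≤ C ∧ ∀ j < N, ∀ t, |wHe j t| ≤ C := by
  have h : ∀ j : ℕ, ∃ C, 0 ≤ C ∧ ∀ t, |wHe j t| ≤ C := fun j => by
    obtain ⟨C, hC, h⟩ := exists_bound_polynomial_mul_exp
      ((Polynomial.hermite j).map (Int.castRingHom ℝ)) (a := 1 / 2) (by norm_num)
    refine ⟨C, hC, fun t => ?_⟩
    rw [wHe, mul_comm, wt, show -t ^ 2 / 2 = -(1 / 2) * t ^ 2 by ring]
    exact h t
  choose C hC hb using h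
  refine ⟨∑ i ∈ Finset.range N, C i, Finset.sum_nonneg fun i _ => hC i, fun j hj t => ?_⟩
  exact (hb j t).trans (Finset.single_le_sum (fun i _ => hC i) (Finset.mem_range.2 hj))

theorem continuous_inv_wt : Continuous fun t => (wt t)⁻¹ :=
  continuous_wt.inv₀ fun t => (wt_pos t).ne'

namespace Chart

variable (ch : Chart)

/-- The bilinear pairing of two functions in the chart, with the Gaussian weight. -/
def pair (v : B) : B →ₗ[ℂ] ℂ where
  toFun u := ∫ t, ch.pull u t * ch.pull v t ∂stdG
  map_add' u u' := by
    have i1 : Integrable (fun t => ch.pull u t * ch.pull v t) stdG :=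
      (ch.memLp_pull u 2).integrable_mul (ch.memLp_pull v 2)
    have i2 : Integrable (fun t => ch.pull u' t * ch.pull v t) stdG :=
      (ch.memLp_pull u' 2).integrable_mul (ch.memLp_pull v 2)
    rw [← integral_add i1 i2]
    simp_rw [pull_add, add_mul]
  map_smul' a u := by
    simp_rw [pull_smul, RingHom.id_apply, smul_eq_mul, ← integral_const_mul, mul_assoc]

theorem pair_apply (v u : B) : ch.pair v u = ∫ t, ch.pull u t * ch.pull v t ∂stdG := rfl

theorem pair_comm (v u : B) : ch.pair v u = ch.pair u v := by
  rw [pair_apply, pair_apply]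
  simp_rw [mul_comm]

theorem norm_pair_le (v u : B) : ‖ch.pair v u‖ ≤ ‖ch.L2 u‖ * ‖ch.L2 v‖ :=
  norm_integral_mul_le _ _

theorem norm_L2_conjB_le (v : B) : ‖ch.L2 (conjB v)‖ ≤ ‖ch.L2 v‖ :=
  norm_toLp_le_norm_toLp _ _ fun t => by rw [pull_conjB, RCLike.norm_conj]

theorem pair_conjB (v : B) : ch.pair (conjB v) v = ((‖ch.L2 v‖ ^ 2 : ℝ) : ℂ) := by
  rw [L2, norm_toLp_sq, ← integral_complex_ofReal, pair_apply]
  congr 1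
  ext t
  rw [pull_conjB, Complex.mul_conj, Complex.normSq_eq_norm_sq]

theorem pair_sub_sum {N : ℕ} (v u : B) (a : Fin N → ℂ) (b : Fin N → B) :
    ch.pair v (u - ∑ j, a j • b j) = ch.pair v u - ∑ j, a j * ch.pair v (b j) := by
  rw [map_sub, map_sum]
  simp_rw [map_smul, smul_eq_mul]

/-- Testing against the complex conjugate of `u` suffices, because the pairing is bilinear rather
than sesquilinear. -/
theorem norm_L2_le_of_pair {u : B} {C : ℝ} (hC : 0 ≤ C)
    (h : ∀ v, ‖ch.pair v u‖ ≤ C * ‖ch.L2 v‖) : ‖ch.L2 u‖ ≤ C := by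
  have h1 := h (conjB u)
  rw [pair_conjB, Complex.norm_real, norm_pow, norm_norm] at h1
  have h2 := h1.trans (mul_le_mul_of_nonneg_left (ch.norm_L2_conjB_le u) hC)
  rcases (norm_nonneg (ch.L2 u)).eq_or_lt with h0 | h0
  · rwa [← h0]
  · rw [sq] at h2
    exact le_of_mul_le_mul_right h2 h0

theorem ouOp_sub_sum {N : ℕ} (c : ℝ) (u : B) (a : Fin N → ℂ) (b : Fin N → B) :
    ch.ouOp c (u - ∑ j, a j • b j) = ch.ouOp c u - ∑ j, a j • ch.ouOp c (b j) := by
  rw [(ch.ouOp c).map_sub, operator_sum_smul]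

theorem pull_eq_zero {u : B} (hu : ∀ x ∈ ch.dom, u x = 0) (t : ℝ) : ch.pull u t = 0 := by
  rw [pull]
  split_ifs with ht
  · refine hu _ ?_
    rwa [dom, Set.mem_ofPred_eq, ch.coord_pt ht]
  · rfl

variable {N : ℕ} (D : DualHe N)

/-- The Hermite polynomials, cut off outside of the chart. -/
def heB (j : ℕ) : B := ch.pushB (He j) (continuous_He j).measurable
  (ch.exists_bound_of_continuous (continuous_He j))

theorem pull_heB (j : ℕ) (t : ℝ) : ch.pull (ch.heB j) t = if |t| < ch.ρ then (He j t : ℂ) else 0 :=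
  ch.pull_eq_of_pushFun (φ := ch.heB j) (ψ := fun t => (He j t : ℂ)) (fun _ => rfl) t

/-- The functionals dual to the Hermite polynomials. -/
def fnD (j : Fin N) : B →L[ℂ] ℂ := ch.fn (D.d j) (D.memLp j)

theorem fnD_eq_pair (j : Fin N) (u : B) : ch.fnD D j u = ch.pair u (ch.dualB D j) := by
  rw [pair_comm, pair_apply, fnD, fn_apply]
  simp_rw [pull_dualB]

theorem fnHe_eq_pair (j : ℕ) (v : B) : ch.fnHe j v = ch.pair v (ch.heB j) := by
  rw [pair_apply, fnHe_apply]
  congr 1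
  ext t
  rw [pull_heB]
  split_ifs with ht
  · ring
  · rw [ch.pull_of_le v (not_lt.1 ht)]; ring

theorem fnD_heB (i j : Fin N) : ch.fnD D i (ch.heB j) = if i = j then 1 else 0 := by
  rw [fnD_eq_pair, pair_comm, ← fnHe_eq_pair, fnHe_dualB]
  simp_rw [eq_comm]

/-- The projection removing the leading Hermite polynomials. -/
def projOp : B →L[ℂ] B :=
  ContinuousLinearMap.id ℂ B - ∑ j : Fin N, (ch.fnD D j).smulRight (ch.heB j)

theorem projOp_apply (u : B) : ch.projOp D u = u - ∑ j : Fin N, ch.fnD D j u • ch.heB j := by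
  rw [projOp, sub_apply, sum_apply]
  rfl

/-- The adjoint of `Chart.stableOp`. -/
def adjOp (c : ℝ) : B →L[ℂ] B := (ch.ouOp c).comp (ch.projOp D)

theorem adjOp_apply (c : ℝ) (u : B) : ch.adjOp D c u = ch.ouOp c (ch.projOp D u) := rfl

theorem projOp_heB (j : Fin N) : ch.projOp D (ch.heB j) = 0 := by
  rw [projOp_apply]
  simp [fnD_heB]

theorem adjOp_heB (c : ℝ) (j : Fin N) : ch.adjOp D c (ch.heB j) = 0 := by
  rw [adjOp_apply, projOp_heB, (ch.ouOp c).map_zero]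

theorem pair_ouOp {c : ℝ} (hc : c ^ 2 ≤ 1) (v u : B) :
    ch.pair v (ch.ouOp c u) = ch.pair (ch.ouOp c v) u := by
  have h : ∀ v u : B, ch.pair v (ch.ouOp c u) = ∫ t, ou c (ch.pull u) t * ch.pull v t ∂stdG :=
    fun v u => by
      rw [pair_apply]
      congr 1
      ext t
      rw [pull_ouOp]
      split_ifs with ht
      · rfl
      · rw [ch.pull_of_le v (not_lt.1 ht)]; ring
  rw [h, ou_symm hc (ch.memLp_pull u 2) (ch.memLp_pull v 2), pair_comm _ _ u, h]
  simp_rw [mul_comm]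

/-- `ouOp` is symmetric for the pairing. Transposing the subtracted rank one terms exchanges the
roles of the cut-off Hermite polynomials and their dual functions. -/
theorem pair_adjOp {c : ℝ} (hc : c ^ 2 ≤ 1) (v u : B) :
    ch.pair v (ch.adjOp D c u) = ch.pair (ch.stableOp D c v) u := by
  rw [adjOp_apply, pair_ouOp _ hc, projOp_apply, pair_sub_sum, pair_comm _ _ u, stableOp_apply,
    pair_comm _ _ u, pair_sub_sum]
  congr 1
  refine Finset.sum_congr rfl fun j _ => ?_
  rw [← fnD_eq_pair, ← fnHe_eq_pair, mul_comm]

theorem pair_adjOp_pow {c : ℝ} (hc : c ^ 2 ≤ 1) (n : ℕ) (v u : B) :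
    ch.pair v ((ch.adjOp D c ^ n) u) = ch.pair ((ch.stableOp D c ^ n) v) u := by
  induction n generalizing v with
  | zero => simp
  | succ n ih =>
    have e : (ch.adjOp D c ^ (n + 1)) u = ch.adjOp D c ((ch.adjOp D c ^ n) u) := by
      rw [pow_succ' _ n]; rfl
    have e2 : (ch.stableOp D c ^ (n + 1)) v = (ch.stableOp D c ^ n) (ch.stableOp D c v) := by
      rw [pow_succ _ n]; rfl
    rw [e, e2, ch.pair_adjOp D hc, ih]

theorem projOp_congr {u v : B} (h : ∀ t, ch.pull u t = ch.pull v t) (t : ℝ) :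
    ch.pull (ch.projOp D u) t = ch.pull (ch.projOp D v) t := by
  have h1 : ∀ j, ch.fnD D j u = ch.fnD D j v := fun j => by
    rw [fnD, fn_apply, fn_apply]; simp_rw [h]
  rw [projOp_apply, projOp_apply, sub_eq_add_neg, sub_eq_add_neg, pull_add, pull_add, h]
  simp_rw [h1]

theorem adjOp_congr {c : ℝ} {u v : B} (h : ∀ t, ch.pull u t = ch.pull v t) :
    ch.adjOp D c u = ch.adjOp D c v := by
  rw [adjOp_apply, adjOp_apply]
  exact ch.ouOp_congr (ch.projOp_congr D h)

theorem exists_norm_adjOp_le {c : ℝ} (hc : c ^ 2 < 1) :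
    ∃ K, 0 ≤ K ∧ ∀ u, ‖ch.adjOp D c u‖ ≤ K * ‖ch.L2 u‖ := by
  obtain ⟨K, hK, h⟩ := ch.exists_norm_ouOp_le hc
  refine ⟨K * (1 + ∑ j : Fin N, ‖ch.L2 (ch.dualB D j)‖ * ‖ch.heB j‖), by positivity, fun u => ?_⟩
  rw [adjOp_apply]
  refine (h _).trans ?_
  rw [mul_assoc]
  gcongr
  rw [projOp_apply, ← L2Lin_apply, map_sub, map_sum, add_mul, one_mul, Finset.sum_mul]
  refine (norm_sub_le _ _).trans (add_le_add le_rfl ((norm_sum_le _ _).trans ?_))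
  refine Finset.sum_le_sum fun j _ => ?_
  rw [map_smul, norm_smul, L2Lin_apply, fnD_eq_pair]
  calc _ ≤ (‖ch.L2 (ch.dualB D j)‖ * ‖ch.L2 u‖) * ‖ch.heB j‖ :=
        mul_le_mul (ch.norm_pair_le _ _) (ch.norm_L2_le _) (norm_nonneg _) (by positivity)
    _ = _ := by ring

/-- An operator and its transpose have the same L² bounds, so the decay of powers of `stableOp`
carries over. -/
theorem exists_norm_L2_adjOp_pow_le {c θ : ℝ} (hc : c ^ 2 < 1)
    (hθ : |c| ^ N + D.C * ∑ j : Fin N, tailNorm j ch.ρ ≤ θ) : ∃ K, 0 ≤ K ∧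
    ∀ (n : ℕ) (u : B), ‖ch.L2 ((ch.adjOp D c ^ (n + 1)) u)‖ ≤ K * θ ^ n * ‖ch.L2 u‖ := by
  have hθ0 : 0 ≤ θ := le_trans (add_nonneg (by positivity) (mul_nonneg D.C_nonneg
    (Finset.sum_nonneg fun _ _ => tailNorm_nonneg _ _))) hθ
  obtain ⟨K, hK, h⟩ := ch.exists_norm_stableOp_le D hc
  refine ⟨K, hK, fun n u => ch.norm_L2_le_of_pair (by positivity) fun v => ?_⟩
  rw [ch.pair_adjOp_pow D hc.le]
  refine (ch.norm_pair_le _ _).trans ?_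
  calc _ ≤ ‖ch.L2 u‖ * (θ ^ n * (K * ‖ch.L2 v‖)) := by
        gcongr
        refine (ch.norm_L2_stableOp_pow_le D hc.le hθ v n).trans ?_
        gcongr
        exact (ch.norm_L2_le _).trans (h v)
    _ = _ := by ring

/-- The block at the unstable fixed point, with the leading eigenfunctions removed. -/
def unstableOp (c : ℝ) : B →L[ℂ] B :=
  (ch.mulOp (fun t => |c| * wt t) (continuous_wt.const_mul _)).comp
    ((ch.adjOp D c).comp (ch.mulOp _ continuous_inv_wt))

theorem unstableOp_apply (c : ℝ) (u : B) : ch.unstableOp D c u =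
    ch.mulOp (fun t => |c| * wt t) (continuous_wt.const_mul _)
      (ch.adjOp D c (ch.mulOp _ continuous_inv_wt u)) := rfl

/-- The leading eigenfunctions at the unstable fixed point. -/
def wHeB (j : ℕ) : B := ch.pushB (wHe j) (continuous_wHe j).measurable
  (ch.exists_bound_of_continuous (continuous_wHe j))

theorem wHeB_apply (j : ℕ) (x : S1) : ch.wHeB j x = ch.pushFun (fun t => (wHe j t : ℂ)) x := rfl

theorem pull_wHeB (j : ℕ) (t : ℝ) :
    ch.pull (ch.wHeB j) t = if |t| < ch.ρ then (wHe j t : ℂ) else 0 :=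
  ch.pull_eq_of_pushFun (φ := ch.wHeB j) (ψ := fun t => (wHe j t : ℂ)) (fun _ => rfl) t

theorem pull_mulOp_wHeB (j : ℕ) (t : ℝ) :
    ch.pull (ch.mulOp _ continuous_inv_wt (ch.wHeB j)) t = ch.pull (ch.heB j) t := by
  rw [pull_mulOp, pull_wHeB, pull_heB]
  split_ifs
  · rw [wHe, ← Complex.ofReal_mul, inv_mul_cancel_left₀ (wt_pos t).ne']
  · rw [mul_zero]

/-- The functionals dual to `Chart.wHeB`. -/
def fnW (j : Fin N) : B →L[ℂ] ℂ := (ch.fnD D j).comp (ch.mulOp _ continuous_inv_wt)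

theorem fnW_apply (j : Fin N) (u : B) :
    ch.fnW D j u = ch.fnD D j (ch.mulOp _ continuous_inv_wt u) := rfl

theorem fnW_wHeB (i j : Fin N) : ch.fnW D i (ch.wHeB j) = if i = j then 1 else 0 := by
  rw [← fnD_heB ch D i j, fnW_apply, fnD_eq_pair, fnD_eq_pair, pair_comm, pair_comm _ (ch.heB j),
    pair_apply, pair_apply]
  simp_rw [pull_mulOp_wHeB]

theorem unstableOp_wHeB (c : ℝ) (j : Fin N) : ch.unstableOp D c (ch.wHeB j) = 0 := by
  rw [unstableOp_apply, ch.adjOp_congr D (ch.pull_mulOp_wHeB j), adjOp_heB,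
    ContinuousLinearMap.map_zero]

theorem isRealFn_fnW (j : Fin N) : IsRealFn (ch.fnW D j) :=
  (ch.isRealFn_fn _ _).comp (ch.isRealOp_mulOp _ _)

theorem isRealOp_unstableOp (c : ℝ) : IsRealOp (ch.unstableOp D c) := by
  have h1 : IsRealOp (ch.projOp D) :=
    IsRealOp.sub (fun φ hφ x => hφ x) (IsRealOp.sum _ fun _ =>
      (ch.isRealFn_fn _ _).smulRight ch.isRealB_pushB)
  exact (ch.isRealOp_mulOp _ _).mul (((ch.isRealOp_ouOp c).mul h1).mul (ch.isRealOp_mulOp _ _))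

theorem wHeB_apply_of_notMem (j : ℕ) {x : S1} (hx : x ∉ ch.dom) : ch.wHeB j x = 0 := by
  rw [wHeB_apply, ch.pushFun_of_notMem _ hx]

theorem unstableOp_apply_of_notMem (c : ℝ) (u : B) {x : S1} (hx : x ∉ ch.dom) :
    ch.unstableOp D c u x = 0 := by
  rw [unstableOp_apply, mulOp_apply, ch.pushFun_of_notMem _ hx]

/-- The weight inverse grows with the chart, but the dual functions see it only on (-1, 1); the
bound is therefore independent of ρ. -/
theorem norm_fnW_le (j : Fin N) (u : B) : ‖ch.fnW D j u‖ ≤ D.C / wt 1 * ‖u‖ := by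
  rw [fnW_apply, fnD, fn_apply]
  refine (norm_integral_le_of_norm_le_const (C := D.C / wt 1 * ‖u‖)
    (Eventually.of_forall fun t => ?_)).trans (by simp)
  rw [pull_mulOp, norm_mul, norm_mul, Complex.norm_real, Complex.norm_real, norm_inv,
    Real.norm_of_nonneg (wt_pos t).le, Real.norm_eq_abs]
  rcases lt_or_ge |t| 1 with ht | ht
  · calc _ ≤ (wt 1)⁻¹ * ‖u‖ * D.C := by
          have := wt_pos 1
          have := wt_le_of_abs_lt ht
          gcongr
          · exact ch.norm_pull_le u t
          · exact D.bound j t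
      _ = _ := by ring
  · rw [D.supp j t ht, abs_zero, mul_zero]
    have := wt_pos 1
    have := D.C_nonneg
    positivity

/-- Between consecutive factors the weight and its inverse cancel inside the chart, each time
leaving |c|. -/
theorem unstableOp_pow (c : ℝ) (n : ℕ) (u : B) : (ch.unstableOp D c ^ (n + 1)) u =
    ((|c| ^ n : ℝ) : ℂ) • ch.mulOp (fun t => |c| * wt t) (continuous_wt.const_mul _)
      ((ch.adjOp D c ^ (n + 1)) (ch.mulOp _ continuous_inv_wt u)) := by
  induction n with
  | zero => simp [unstableOp_apply]
  | succ n ih =>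
    have e : (ch.unstableOp D c ^ (n + 1 + 1)) u =
        ch.unstableOp D c ((ch.unstableOp D c ^ (n + 1)) u) := by
      rw [pow_succ' _ (n + 1)]; rfl
    have e2 : ∀ v, (ch.adjOp D c ^ (n + 1 + 1)) v =
        ch.adjOp D c ((ch.adjOp D c ^ (n + 1)) v) := fun v => by
      rw [pow_succ' _ (n + 1)]; rfl
    rw [e, ih, e2, ContinuousLinearMap.map_smul, unstableOp_apply]
    set v := (ch.adjOp D c ^ (n + 1)) (ch.mulOp _ continuous_inv_wt u)
    have h : ch.adjOp D c (ch.mulOp _ continuous_inv_wt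
        (ch.mulOp (fun t => |c| * wt t) (continuous_wt.const_mul _) v)) =
        ch.adjOp D c (((|c| : ℝ) : ℂ) • v) := by
      refine ch.adjOp_congr D fun t => ?_
      rw [pull_mulOp, pull_mulOp, pull_smul]
      have := (Complex.ofReal_ne_zero.2 (wt_pos t).ne')
      push_cast
      field_simp
    rw [h, ContinuousLinearMap.map_smul, ContinuousLinearMap.map_smul, smul_smul, pow_succ]
    push_cast
    rfl

/-- Conjugation by the weight costs norms that depend on ρ, but they enter only once and do not
affect the growth rate. The powers of |c| are merely bounded by 1. -/
theorem unstableOp_notMem_spectrum {c θ : ℝ} (hc : c ^ 2 < 1)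
    (hθ : |c| ^ N + D.C * ∑ j : Fin N, tailNorm j ch.ρ ≤ θ) {z : ℂ} (hz : θ < ‖z‖) :
    z ∉ spectrum ℂ (ch.unstableOp D c) := by
  have hθ0 : 0 ≤ θ := le_trans (add_nonneg (by positivity) (mul_nonneg D.C_nonneg
    (Finset.sum_nonneg fun _ _ => tailNorm_nonneg _ _))) hθ
  obtain ⟨K, hK, h⟩ := ch.exists_norm_adjOp_le D hc
  obtain ⟨K', hK', h'⟩ := ch.exists_norm_L2_adjOp_pow_le D hc hθ
  have hc1 : |c| ≤ 1 := (sq_le_one_iff_abs_le_one c).1 hc.le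
  set X := ch.mulOp (fun t => |c| * wt t) (continuous_wt.const_mul _)
  set Y := ch.mulOp _ continuous_inv_wt
  refine notMem_spectrum_of_norm_pow_le (C := ‖X‖ * K * K' * ‖Y‖) hθ0 (k := 2) (fun n => ?_) hz
  refine ContinuousLinearMap.opNorm_le_bound _ (by positivity) fun u => ?_
  have e2 : ∀ v, (ch.adjOp D c ^ (n + 1 + 1)) v =
      ch.adjOp D c ((ch.adjOp D c ^ (n + 1)) v) := fun v => by
    rw [pow_succ' _ (n + 1)]; rfl
  rw [ch.unstableOp_pow D c (n + 1), norm_smul, e2]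
  have h1 : ‖((|c| ^ (n + 1) : ℝ) : ℂ)‖ ≤ 1 := by
    rw [Complex.norm_real, norm_pow, Real.norm_eq_abs, abs_abs]
    exact pow_le_one₀ (abs_nonneg _) hc1
  calc _ ≤ 1 * (‖X‖ * (K * (K' * θ ^ n * (‖Y‖ * ‖u‖)))) := by
        refine mul_le_mul h1 ((X.le_opNorm _).trans ?_) (norm_nonneg _) zero_le_one
        gcongr
        refine (h _).trans ?_
        gcongr
        refine (h' _ _).trans ?_
        gcongr
        exact (ch.norm_L2_le _).trans (Y.le_opNorm u)
    _ = _ := by ring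

/-- The error comes from cutting He_j off at ρ before applying `ou`. Transforming it back with
`integral_expanding` turns it into an average of exp(-y²/2) He_j(y) over |y| ≥ ρ, which is at most η
with no loss from the inverse weight. -/
theorem norm_unstable_sub_le {c η : ℝ} (hc0 : c ≠ 0) (hc : c ^ 2 < 1) (hη0 : 0 ≤ η)
    (hη : ∀ j < N, ∀ t, ch.ρ ≤ |t| → wt t * |He j t| ≤ η) (u : B) {x : S1} (hx : x ∈ ch.dom) :
    ‖ch.unstableOp D c u x + ∑ j : Fin N, ((|c| * c ^ (j : ℕ) : ℝ) * ch.fnW D j u) * ch.wHeB j x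
      - ∫ z, ch.pull u (c⁻¹ * ch.coord x + √(c⁻¹ ^ 2 - 1) * z) ∂stdG‖ ≤
      N * (D.C / wt 1 * η) * ‖u‖ := by
  set t := ch.coord x with ht
  have hm : ∀ φ : B, ∀ (g : ℝ → ℝ) (hg : Continuous g), ch.mulOp g hg φ x = g t * φ x := fun φ g hg => by
    rw [mulOp_apply, ch.pushFun_of_mem _ hx, ch.pull_of_lt _ hx, ch.pt_coord]
  set v := ch.mulOp _ continuous_inv_wt u with hv
  have h1 : ch.unstableOp D c u x = (|c| * wt t : ℝ) * (ou c (ch.pull v) t -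
      ∑ j : Fin N, ch.fnW D j u * ou c (ch.pull (ch.heB j)) t) := by
    rw [unstableOp_apply, hm, adjOp_apply, projOp_apply, ouOp_sub_sum, B.sub_apply, B.sum_apply,
      ouOp_apply, ch.pushFun_of_mem _ hx]
    simp_rw [B.smul_apply, ouOp_apply, ch.pushFun_of_mem _ hx]
    rfl
  have h2 : ∀ j : Fin N, (c : ℂ) ^ (j : ℕ) * He j t - ou c (ch.pull (ch.heB j)) t =
      ou c (tailHe j ch.ρ) t := fun j => by
    rw [← ou_He hc.le, ou, ou, ou, ← integral_sub (integrable_He_affine j _ _)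
      (integrable_ou (ch.measurable_pull _) (ch.norm_pull_le _) t)]
    congr 1
    ext z
    rw [pull_heB, tailHe]
    by_cases hz : |c * t + √(1 - c ^ 2) * z| < ch.ρ
    · rw [if_pos hz, Set.indicator_of_notMem (by simpa using hz), sub_self]
    · rw [if_neg hz, Set.indicator_of_mem (by simpa using hz), sub_zero]
  have h3 : ∀ ψ : ℝ → ℂ, (|c| * wt t : ℝ) * ou c ψ t =
      ∫ z, (wt (c⁻¹ * t + √(c⁻¹ ^ 2 - 1) * z) : ℂ) * ψ (c⁻¹ * t + √(c⁻¹ ^ 2 - 1) * z) ∂stdG := fun ψ => by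
    rw [integral_expanding hc0 hc (fun x => (wt x : ℂ) * ψ x)]
    congr 2
    ext x
    rw [mul_div_cancel_left₀ _ (Complex.ofReal_ne_zero.2 (wt_pos x).ne')]
  have h4 : (|c| * wt t : ℝ) * ou c (ch.pull v) t =
      ∫ z, ch.pull u (c⁻¹ * t + √(c⁻¹ ^ 2 - 1) * z) ∂stdG := by
    rw [h3]
    congr 1
    ext z
    rw [hv, pull_mulOp, ← mul_assoc, ← Complex.ofReal_mul, mul_inv_cancel₀ (wt_pos _).ne',
      Complex.ofReal_one, one_mul]
  have h5 : ∀ j : Fin N, ch.wHeB j x = (wt t : ℂ) * He j t := fun j => by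
    rw [wHeB_apply, ch.pushFun_of_mem _ hx, wHe, Complex.ofReal_mul]
  have h6 : ch.unstableOp D c u x + ∑ j : Fin N, ((|c| * c ^ (j : ℕ) : ℝ) * ch.fnW D j u) * ch.wHeB j x
      - ∫ z, ch.pull u (c⁻¹ * t + √(c⁻¹ ^ 2 - 1) * z) ∂stdG =
      ∑ j : Fin N, ch.fnW D j u * ((|c| * wt t : ℝ) * ou c (tailHe j ch.ρ) t) := by
    rw [h1, mul_sub, h4]
    simp_rw [← h2, h5, mul_sub, Finset.sum_sub_distrib, Finset.mul_sum]
    push_cast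
    have e1 : ∀ j : Fin N, (((|c| : ℝ) : ℂ) * (c : ℂ) ^ (j : ℕ) * ch.fnW D j u) * ((wt t : ℂ) * He j t) =
      ch.fnW D j u * (((|c| : ℝ) : ℂ) * wt t * ((c : ℂ) ^ (j : ℕ) * He j t)) := fun j => by ring
    have e2 : ∀ j : Fin N, ch.fnW D j u * (((|c| : ℝ) : ℂ) * wt t * ou c (ch.pull (ch.heB j)) t) =
      ((|c| : ℝ) : ℂ) * wt t * (ch.fnW D j u * ou c (ch.pull (ch.heB j)) t) := fun j => by ring
    simp_rw [e1, e2]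
    ring
  rw [h6, mul_assoc]
  refine norm_sum_fin_le fun j => ?_
  rw [norm_mul, h3]
  have h7 : ‖∫ z, (wt (c⁻¹ * t + √(c⁻¹ ^ 2 - 1) * z) : ℂ) *
      tailHe j ch.ρ (c⁻¹ * t + √(c⁻¹ ^ 2 - 1) * z) ∂stdG‖ ≤ η := by
    refine (norm_integral_le_of_norm_le_const (C := η) (Eventually.of_forall fun z => ?_)).trans
      (by simp)
    set y := c⁻¹ * t + √(c⁻¹ ^ 2 - 1) * z
    rw [tailHe]
    by_cases hy : y ∈ {t : ℝ | ch.ρ ≤ |t|}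
    · rw [Set.indicator_of_mem hy, norm_mul, Complex.norm_real, Complex.norm_real,
        Real.norm_of_nonneg (wt_pos y).le]
      exact hη j j.2 y hy
    · rw [Set.indicator_of_notMem hy, mul_zero, norm_zero]
      exact hη0
  calc _ ≤ (D.C / wt 1 * ‖u‖) * η := mul_le_mul (ch.norm_fnW_le D j u) h7 (norm_nonneg _)
        (by have := wt_pos 1; have := D.C_nonneg; positivity)
    _ = _ := by ring

theorem norm_sum_fnW_le {C a : ℝ} (hC : ∀ j < N, ∀ t, |wHe j t| ≤ C) (hC0 : 0 ≤ C)
    {b : Fin N → ℂ} (ha : ∀ j, ‖b j‖ ≤ a) (u : B) :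
    ‖∑ j : Fin N, (b j * ch.fnW D j u) • ch.wHeB j‖ ≤ N * (a * (D.C / wt 1) * C) * ‖u‖ := by
  rw [mul_assoc]
  refine norm_sum_fin_le fun j => ?_
  have ha0 : 0 ≤ a := (norm_nonneg _).trans (ha j)
  have hw := wt_pos 1
  have hD := D.C_nonneg
  have h1 : ‖ch.wHeB j‖ ≤ C := B.norm_le hC0 fun x => by
    rw [wHeB_apply]
    refine ch.norm_pushFun_le hC0 (fun t _ => ?_) x
    rw [Complex.norm_real]
    exact hC j j.2 t
  rw [norm_smul, norm_mul]
  calc _ ≤ a * (D.C / wt 1 * ‖u‖) * C := by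
        gcongr
        · exact ha j
        · exact ch.norm_fnW_le D j u
    _ = _ := by ring

end Chart

/-! ### Continuity of Gaussian averages in total variation -/

/-- The density of the normal law with mean `p.1` and standard deviation `p.2`. -/
def gaussDensity (p : ℝ × ℝ) (x : ℝ) : ℝ :=
  (√(2 * Real.pi * p.2 ^ 2))⁻¹ * Real.exp (-(x - p.1) ^ 2 / (2 * p.2 ^ 2))

theorem continuous_gaussDensity (p : ℝ × ℝ) : Continuous (gaussDensity p) := by
  unfold gaussDensity
  fun_prop

theorem continuousAt_gaussDensity {s₀ : ℝ} (hs : 0 < s₀) (x : ℝ) :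
    ContinuousAt (fun p => gaussDensity p x) (0, s₀) := by
  have h0 : √(2 * Real.pi * s₀ ^ 2) ≠ 0 := by positivity
  have h1 : 2 * s₀ ^ 2 ≠ 0 := by positivity
  unfold gaussDensity
  refine ContinuousAt.mul (ContinuousAt.inv₀ (by fun_prop) h0) ?_
  exact Real.continuous_exp.continuousAt.comp
    (ContinuousAt.div (by fun_prop) (by fun_prop) h1)

/-- A dominating function for parameters near (0, s₀): for |m| ≤ 1 one has (x - m)² ≥ x²/2 - 1, and
the variance is at most 4 s₀². -/
theorem gaussDensity_le {s₀ : ℝ} (hs : 0 < s₀) {p : ℝ × ℝ} (h1 : |p.1| ≤ 1) (h2 : s₀ / 2 ≤ p.2)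
    (h3 : p.2 ≤ 2 * s₀) (x : ℝ) : gaussDensity p x ≤
      (√(2 * Real.pi * (s₀ / 2) ^ 2))⁻¹ * Real.exp ((8 * s₀ ^ 2)⁻¹) *
        Real.exp (-(16 * s₀ ^ 2)⁻¹ * x ^ 2) := by
  rw [gaussDensity, mul_assoc (_ : ℝ)⁻¹ (Real.exp _), ← Real.exp_add]
  have hp : 0 < p.2 := by linarith
  gcongr
  have h4 : p.2 ^ 2 ≤ 4 * s₀ ^ 2 := by nlinarith
  have h5 : p.1 ^ 2 ≤ 1 := by rw [← sq_abs]; nlinarith [abs_nonneg p.1]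
  have h6 : x ^ 2 / 2 - 1 ≤ (x - p.1) ^ 2 := by nlinarith [sq_nonneg (x - 2 * p.1)]
  have h7 : (x - p.1) ^ 2 / (8 * s₀ ^ 2) ≤ (x - p.1) ^ 2 / (2 * p.2 ^ 2) := by
    refine div_le_div_of_nonneg_left (sq_nonneg _) (by positivity) ?_
    linarith
  have h8 : (x ^ 2 / 2 - 1) / (8 * s₀ ^ 2) ≤ (x - p.1) ^ 2 / (8 * s₀ ^ 2) := by gcongr
  have h9 : (x ^ 2 / 2 - 1) / (8 * s₀ ^ 2) = (16 * s₀ ^ 2)⁻¹ * x ^ 2 - (8 * s₀ ^ 2)⁻¹ := by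
    field_simp
    ring
  rw [neg_div, neg_mul]
  linarith

theorem gaussDensity_nonneg (p : ℝ × ℝ) (x : ℝ) : 0 ≤ gaussDensity p x := by
  unfold gaussDensity
  positivity

theorem tendsto_integral_abs_gaussDensity_sub {s₀ : ℝ} (hs : 0 < s₀) :
    Tendsto (fun p => ∫ x, |gaussDensity p x - gaussDensity (0, s₀) x|) (𝓝 (0, s₀)) (𝓝 0) := by
  set b : ℝ → ℝ := fun x => (√(2 * Real.pi * (s₀ / 2) ^ 2))⁻¹ * Real.exp ((8 * s₀ ^ 2)⁻¹) *
        Real.exp (-(16 * s₀ ^ 2)⁻¹ * x ^ 2) with hb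
  have hbi : Integrable b := (integrable_exp_neg_mul_sq (by positivity)).const_mul _
  suffices h0 : Tendsto (fun p => ∫ x, |gaussDensity p x - gaussDensity (0, s₀) x|) (𝓝 (0, s₀))
      (𝓝 (∫ _ : ℝ, (0 : ℝ))) by simpa using h0
  refine tendsto_integral_filter_of_dominated_convergence b
    (Eventually.of_forall fun p => ?_) ?_ hbi (Eventually.of_forall fun x => ?_)
  · exact (((continuous_gaussDensity p).sub (continuous_gaussDensity _)).abs).aestronglyMeasurable
  · have e1 : ∀ᶠ p : ℝ × ℝ in 𝓝 (0, s₀), |p.1| < 1 :=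
      (continuous_fst.abs.tendsto' (0, s₀) 0 (by simp)).eventually_lt_const one_pos
    have e2 : ∀ᶠ p : ℝ × ℝ in 𝓝 (0, s₀), s₀ / 2 < p.2 :=
      (continuous_snd.tendsto' (0, s₀) s₀ rfl).eventually_const_lt (by linarith)
    have e3 : ∀ᶠ p : ℝ × ℝ in 𝓝 (0, s₀), p.2 < 2 * s₀ :=
      (continuous_snd.tendsto' (0, s₀) s₀ rfl).eventually_lt_const (by linarith)
    filter_upwards [e1, e2, e3] with p h1 h2 h3
    refine Eventually.of_forall fun x => ?_
    rw [Real.norm_eq_abs, abs_abs]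
    have g1 := gaussDensity_le hs h1.le h2.le h3.le x
    have g2 := gaussDensity_le hs (p := (0, s₀)) (by simp) (by simp; linarith) (by simp; linarith) x
    have g3 := gaussDensity_nonneg p x
    have g4 := gaussDensity_nonneg (0, s₀) x
    exact abs_le.2 ⟨by linarith, by linarith⟩
  · have h := ((continuousAt_gaussDensity hs x).tendsto.sub_const (gaussDensity (0, s₀) x)).abs
    rwa [sub_self, abs_zero] at h

theorem integrable_gaussDensity {p : ℝ × ℝ} (hp : 0 < p.2) : Integrable (gaussDensity p) := by
  unfold gaussDensity
  refine Integrable.const_mul ?_ _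
  have h := (integrable_exp_neg_mul_sq (b := (2 * p.2 ^ 2)⁻¹) (by positivity)).comp_sub_right p.1
  refine h.congr (Eventually.of_forall fun x => ?_)
  simp only
  congr 1
  field_simp

/-- Translating by m₀ reduces to means near 0, so that δ is uniform in m₀. Allowing every bounded
measurable `G` makes this a total variation bound. -/
theorem exists_norm_integral_affine_sub_le {s₀ η : ℝ} (hs : 0 < s₀) (hη : 0 < η) :
    ∃ δ > 0, ∀ m m₀ s : ℝ, |m - m₀| < δ → |s - s₀| < δ → ∀ (G : ℝ → ℂ) (K : ℝ), Measurable G →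
      (∀ t, ‖G t‖ ≤ K) →
      ‖∫ z, G (m + s * z) ∂stdG - ∫ z, G (m₀ + s₀ * z) ∂stdG‖ ≤ η * K := by
  have h := (tendsto_integral_abs_gaussDensity_sub hs).eventually_lt_const hη
  obtain ⟨δ, hδ, hδ2⟩ := Metric.eventually_nhds_iff.1 h
  refine ⟨min δ s₀, lt_min hδ hs, fun m m₀ s hm hsd G K hG hK => ?_⟩
  have hs' : 0 < s := by
    have := (abs_lt.1 (hsd.trans_le (min_le_right _ _))).1
    linarith
  have hK0 : 0 ≤ K := (norm_nonneg _).trans (hK 0)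
  have hd : dist ((m - m₀, s) : ℝ × ℝ) (0, s₀) < δ := by
    rw [Prod.dist_eq]
    refine max_lt ?_ ?_
    · simpa [Real.dist_eq] using hm.trans_le (min_le_left _ _)
    · simpa [Real.dist_eq] using hsd.trans_le (min_le_left _ _)
  have h1 := hδ2 hd
  have e1 := integral_affine_stdG (m := m - m₀) hs'.ne' (fun x => G (m₀ + x))
  have e2 := integral_affine_stdG (m := 0) hs.ne' (fun x => G (m₀ + x))
  have e3 : ∀ z, m₀ + (m - m₀ + s * z) = m + s * z := fun z => by ring
  simp_rw [e3] at e1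
  simp_rw [zero_add] at e2
  have hi : ∀ {p : ℝ × ℝ}, 0 < p.2 → Integrable (fun x => gaussDensity p x • G (m₀ + x)) := fun hp => by
    have := (integrable_gaussDensity hp).ofReal (𝕜 := ℂ)
    refine (this.mul_bdd (c := K) (hG.comp (measurable_const_add m₀)).aestronglyMeasurable
      (Eventually.of_forall fun x => hK _)).congr (Eventually.of_forall fun x => ?_)
    simp
  rw [e1, e2]
  change ‖(∫ x, gaussDensity (m - m₀, s) x • G (m₀ + x)) -
    ∫ x, gaussDensity (0, s₀) x • G (m₀ + x)‖ ≤ η * K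
  rw [← integral_sub (hi (p := (m - m₀, s)) hs') (hi (p := (0, s₀)) hs)]
  have hint : Integrable (fun x => |gaussDensity (m - m₀, s) x - gaussDensity (0, s₀) x|) :=
    ((integrable_gaussDensity hs').sub (integrable_gaussDensity hs)).abs
  refine (norm_integral_le_of_norm_le (hint.mul_const K) (Eventually.of_forall fun x => ?_)).trans ?_
  · rw [← sub_smul, norm_smul, Real.norm_eq_abs]
    gcongr
    exact hK _
  · rw [integral_mul_const]
    gcongr

/-- The two-sided Gaussian tail. -/
def gaussTail (R : ℝ) : ℝ := ∫ z, {z : ℝ | R ≤ |z|}.indicator (fun _ => (1 : ℝ)) z ∂stdG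

theorem tendsto_gaussTail : Tendsto gaussTail atTop (𝓝 0) := by
  refine (tendsto_tail_integral (integrable_const 1)).congr fun R => ?_
  rw [gaussTail, integral_indicator (measurableSet_tail R)]

theorem integrable_tail (R : ℝ) :
    Integrable ({z : ℝ | R ≤ |z|}.indicator fun _ => (1 : ℝ)) stdG :=
  (integrable_const 1).indicator (measurableSet_tail R)

theorem norm_integral_le_gaussTail {G : ℝ → ℂ} {K R : ℝ}
    (h0 : ∀ z, |z| < R → G z = 0) (hK : ∀ z, ‖G z‖ ≤ K) :
    ‖∫ z, G z ∂stdG‖ ≤ K * gaussTail R := by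
  rw [gaussTail, ← integral_const_mul]
  refine norm_integral_le_of_norm_le ((integrable_tail R).const_mul K)
    (Eventually.of_forall fun z => ?_)
  rcases lt_or_ge |z| R with hz | hz
  · rw [h0 z hz, Set.indicator_of_notMem (by simpa using hz)]
    simp
  · rw [Set.indicator_of_mem (by simpa using hz), mul_one]
    exact hK z

theorem norm_integral_affine_sub_le_gaussTail {G ψ : ℝ → ℂ} {K R L m s : ℝ} (hG : Measurable G)
    (hψ : Measurable ψ) (hGK : ∀ t, ‖G t‖ ≤ K) (hψK : ∀ t, ‖ψ t‖ ≤ K)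
    (h : ∀ t, |t| < R → G t = ψ t) (hs : 0 < s) (hL : |m| + s * L ≤ R) :
    ‖∫ z, G (m + s * z) ∂stdG - ∫ z, ψ (m + s * z) ∂stdG‖ ≤ 2 * K * gaussTail L := by
  have hi : ∀ {F : ℝ → ℂ}, Measurable F → (∀ t, ‖F t‖ ≤ K) →
      Integrable (fun z => F (m + s * z)) stdG := fun hF hFK =>
    Integrable.of_bound (hF.comp (by fun_prop)).aestronglyMeasurable K
      (Eventually.of_forall fun _ => hFK _)
  rw [← integral_sub (hi hG hGK) (hi hψ hψK)]
  refine norm_integral_le_gaussTail (fun z hz => ?_) fun z => ?_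
  · rw [h, sub_self]
    refine (abs_add_le _ _).trans_lt (lt_of_lt_of_le ?_ hL)
    rw [abs_mul, abs_of_pos hs]
    gcongr
  · refine (norm_sub_le _ _).trans ?_
    linarith [hGK (m + s * z), hψK (m + s * z)]

/-! ### The map near a fixed point -/

/-- For a lift centred at the fixed point the derivative is Lipschitz near 0; the mean value
inequality for the lift minus its linear part gives the quadratic error. -/
theorem exists_local_expansion {f : S1 → S1} (hf : IsSmoothMap f) {x₀ : S1} (hx : f x₀ = x₀) :
    ∃ C > 0, ∃ δ > 0, ∀ x : S1, ‖x - x₀‖ < δ →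
      |rep (f x - x₀) - circleDeriv f x₀ * rep (x - x₀)| ≤ C * rep (x - x₀) ^ 2 := by
  obtain ⟨F, hF, hfF⟩ := hf
  obtain ⟨t₀, ht₀⟩ : ∃ t₀ : ℝ, (t₀ : S1) = x₀ := ⟨rep x₀, coe_rep x₀⟩
  set G : ℝ → ℝ := fun t => F (t₀ + t) - F t₀ with hG
  have hGs : ContDiff ℝ ∞ G := (hF.comp (contDiff_const.add contDiff_id)).sub contDiff_const
  have hG0 : G 0 = 0 := by simp [hG]
  have hFx : ((F t₀ : ℝ) : S1) = x₀ := by rw [← hfF, ht₀, hx]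
  have hfG : ∀ t : ℝ, f (x₀ + (t : S1)) - x₀ = ((G t : ℝ) : S1) := fun t => by
    rw [hG, AddCircle.coe_sub, hFx, ← hfF, ← ht₀, AddCircle.coe_add]
  have hsmall : ∀ᶠ t in 𝓝 (0 : ℝ), |G t| < Real.pi :=
    (hGs.continuous.abs.tendsto' 0 0 (by simp [hG0])).eventually_lt_const Real.pi_pos
  have hrep : ∀ᶠ t : ℝ in 𝓝 0, rep (f (x₀ + (t : S1)) - x₀) = G t := by
    filter_upwards [hsmall] with t ht
    rw [hfG, rep_coe_of_abs_lt ht]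
  have hc : circleDeriv f x₀ = deriv G 0 := by
    rw [circleDeriv, hx]
    exact EventuallyEq.deriv_eq hrep
  have hG1 : ContDiff ℝ 1 (deriv G) := (contDiff_infty_iff_deriv.1 hGs).2.of_le (by simp)
  obtain ⟨K, s, hs, hK⟩ := hG1.contDiffAt (x := 0) |>.exists_lipschitzOnWith
  obtain ⟨δ, hδ, hδ2⟩ := Metric.eventually_nhds_iff_ball.1 (hsmall.and (hrep.and hs))
  refine ⟨K + 1, by positivity, δ, hδ, fun x hxδ => ?_⟩
  set t := rep (x - x₀) with ht
  have htδ : |t| < δ := by rwa [ht, abs_rep]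
  have hxt : x = x₀ + (t : S1) := by rw [ht, coe_rep]; abel
  have htb : t ∈ Metric.ball (0 : ℝ) δ := by simpa using htδ
  have h1 := (hδ2 t htb).2.1
  rw [← hxt] at h1
  rw [h1, hc]
  have hder : ∀ y ∈ Set.uIcc 0 t, HasDerivWithinAt (fun y => G y - deriv G 0 * y)
      (deriv G y - deriv G 0) (Set.uIcc 0 t) y := fun y _ => by
    have h2 : HasDerivAt G (deriv G y) y := (hGs.differentiable (by simp)).differentiableAt.hasDerivAt
    have h3 := h2.sub ((hasDerivAt_id y).const_mul (deriv G 0))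
    rw [mul_one] at h3
    exact h3.hasDerivWithinAt
  have hbd : ∀ y ∈ Set.uIcc 0 t, ‖deriv G y - deriv G 0‖ ≤ K * |t| := fun y hy => by
    have hyt : |y| ≤ |t| := by
      have := Set.abs_sub_left_of_mem_uIcc hy
      simpa using this
    have hyb : y ∈ s := (hδ2 y (by simpa using hyt.trans_lt htδ)).2.2
    have h0s : (0 : ℝ) ∈ s := (hδ2 0 (by simpa using hδ)).2.2
    have := hK.dist_le_mul y hyb 0 h0s
    rw [dist_eq_norm, Real.dist_eq, sub_zero] at this
    exact this.trans (by gcongr)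
  have h4 := (convex_uIcc 0 t).norm_image_sub_le_of_norm_hasDerivWithin_le hder hbd
    Set.left_mem_uIcc Set.right_mem_uIcc
  rw [hG0, mul_zero, sub_zero, sub_zero, sub_zero, Real.norm_eq_abs, Real.norm_eq_abs] at h4
  refine h4.trans ?_
  rw [mul_assoc, abs_mul_abs_self, ← sq]
  gcongr
  linarith

theorem norm_le_of_expansion {f : S1 → S1} (hf : IsSmoothMap f) {x₀ : S1} (hx : f x₀ = x₀) {q : ℝ}
    (hq : |circleDeriv f x₀| < q) : ∃ δ > 0, ∀ x, dist x x₀ < δ → dist (f x) x₀ ≤ q * dist x x₀ := by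
  obtain ⟨C, hC, δ, hδ, h⟩ := exists_local_expansion hf hx
  refine ⟨min δ ((q - |circleDeriv f x₀|) / C), lt_min hδ (div_pos (by linarith) hC), fun x hxd => ?_⟩
  rw [dist_eq_norm, lt_min_iff, lt_div_iff₀ hC] at hxd
  rw [dist_eq_norm, dist_eq_norm, ← abs_rep, ← abs_rep]
  have h1 := h x hxd.1
  rw [← abs_rep] at hxd
  have h2 := abs_sub_abs_le_abs_sub (rep (f x - x₀)) (circleDeriv f x₀ * rep (x - x₀))
  rw [abs_mul] at h2
  rw [← sq_abs] at h1
  nlinarith [abs_nonneg (rep (x - x₀))]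

theorem le_norm_of_expansion {f : S1 → S1} (hf : IsSmoothMap f) {x₀ : S1} (hx : f x₀ = x₀) {q : ℝ}
    (hq : q < |circleDeriv f x₀|) : ∃ δ > 0, ∀ x, dist x x₀ < δ → q * dist x x₀ ≤ dist (f x) x₀ := by
  obtain ⟨C, hC, δ, hδ, h⟩ := exists_local_expansion hf hx
  refine ⟨min δ ((|circleDeriv f x₀| - q) / C), lt_min hδ (div_pos (by linarith) hC), fun x hxd => ?_⟩
  rw [dist_eq_norm, lt_min_iff, lt_div_iff₀ hC] at hxd
  rw [dist_eq_norm, dist_eq_norm, ← abs_rep, ← abs_rep]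
  have h1 := h x hxd.1
  rw [← abs_rep] at hxd
  have h2 := abs_sub_abs_le_abs_sub (circleDeriv f x₀ * rep (x - x₀)) (rep (f x - x₀))
  rw [abs_mul, abs_sub_comm (circleDeriv f x₀ * rep (x - x₀))] at h2
  rw [← sq_abs] at h1
  nlinarith [abs_nonneg (rep (x - x₀))]

/-- In the chart, the noisy map is close in total variation to its linearization. -/
theorem exists_norm_linearization_sub_le {f : S1 → S1} (hf : IsSmoothMap f) {σ : S1 → ℝ}
    (hσ : Continuous σ) {x₀ : S1} (hx : f x₀ = x₀) (hσ₀ : 0 < σ x₀) {a η : ℝ} (ha : 0 < a)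
    (hη : 0 < η) : ∃ δ > 0, ∀ (ch : Chart) (ε : ℝ), ch.x₀ = x₀ → 0 < ε → ch.κ = a * ε →
      ch.κ * ch.ρ ^ 2 < δ → ∀ x ∈ ch.dom, ∀ (G : ℝ → ℂ) (K : ℝ), Measurable G → (∀ t, ‖G t‖ ≤ K) →
      ‖∫ z, G (rep (f x - x₀) / ch.κ + ε * σ x / ch.κ * z) ∂stdG -
        ∫ z, G (circleDeriv f x₀ * ch.coord x + σ x₀ / a * z) ∂stdG‖ ≤ η * K := by
  obtain ⟨C, hC, δ₁, hδ₁, hexp⟩ := exists_local_expansion hf hx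
  obtain ⟨δ₂, hδ₂, htv⟩ := exists_norm_integral_affine_sub_le (s₀ := σ x₀ / a) (by positivity) hη
  obtain ⟨δ₃, hδ₃, hσc⟩ := Metric.continuousAt_iff.1 (hσ.continuousAt (x := x₀)) (a * δ₂)
    (by positivity)
  -- In the rescaled coordinate the quadratic error C(κt)² is divided by κ, which leaves at most
  -- Cκρ². As ρ ≥ 1, smallness of κρ² also controls the radius κρ of the chart.
  refine ⟨min (min δ₁ δ₃) (δ₂ / C), by positivity, fun ch ε hch hε hκ hδ x hxd G K hG hK => ?_⟩
  rw [lt_min_iff, lt_min_iff, lt_div_iff₀ hC] at hδ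
  have hκ0 := ch.κ_pos
  have hρ := ch.one_le_ρ
  have hκρ : ch.κ * ch.ρ ≤ ch.κ * ch.ρ ^ 2 := by
    gcongr
    nlinarith
  have hdist : dist x x₀ < ch.κ * ch.ρ := hch ▸ (ch.mem_dom_iff x).1 hxd
  refine htv _ _ _ ?_ ?_ G K hG hK
  · have h1 := hexp x (by rw [← dist_eq_norm]; linarith [hδ.1.1])
    have e : rep (x - x₀) = ch.κ * ch.coord x := by
      rw [Chart.coord, hch]; field_simp
    have hc : |ch.coord x| < ch.ρ := hxd
    rw [e] at h1
    have h2 : |rep (f x - x₀) / ch.κ - circleDeriv f x₀ * ch.coord x| =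
        |rep (f x - x₀) - circleDeriv f x₀ * (ch.κ * ch.coord x)| / ch.κ := by
      rw [← abs_of_pos hκ0, ← abs_div, abs_of_pos hκ0]
      congr 1
      field_simp
    rw [h2, div_lt_iff₀ hκ0]
    have h3 : ch.coord x ^ 2 ≤ ch.ρ ^ 2 := by
      rw [← sq_abs]
      exact pow_le_pow_left₀ (abs_nonneg _) hc.le 2
    calc _ ≤ C * (ch.κ * ch.coord x) ^ 2 := h1
      _ = ch.κ * (C * ch.κ * ch.coord x ^ 2) := by ring
      _ ≤ ch.κ * (C * ch.κ * ch.ρ ^ 2) := by gcongr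
      _ = (ch.κ * ch.ρ ^ 2 * C) * ch.κ := by ring
      _ < δ₂ * ch.κ := by gcongr; exact hδ.2
  · have h1 := hσc (x := x) (by linarith [hδ.1.2])
    rw [Real.dist_eq] at h1
    have h2 : ε * σ x / ch.κ - σ x₀ / a = (σ x - σ x₀) / a := by
      rw [hκ]; field_simp
    rw [h2, abs_div, abs_of_pos ha, div_lt_iff₀ ha]
    linarith

/-! ### Pseudo-orbits leave every region away from the fixed points -/

theorem exists_shadowing {f : S1 → S1} (hf : Continuous f) (n : ℕ) {e : ℝ} (he : 0 < e) :
    ∃ η > 0, ∀ x : ℕ → S1, (∀ i < n, dist (x (i + 1)) (f (x i)) ≤ η) →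
      dist (x n) (f^[n] (x 0)) < e := by
  induction n generalizing e with
  | zero => exact ⟨1, one_pos, fun x _ => by simpa using he⟩
  | succ n ih =>
    obtain ⟨d, hd, hfd⟩ := Metric.uniformContinuous_iff.1
      (CompactSpace.uniformContinuous_of_continuous hf) (e / 2) (half_pos he)
    obtain ⟨η, hη, h⟩ := ih hd
    refine ⟨min η (e / 3), by positivity, fun x hx => ?_⟩
    have h1 := hfd (h x fun i hi => (hx i (hi.trans n.lt_succ_self)).trans (min_le_left _ _))
    have h2 := (hx n n.lt_succ_self).trans (min_le_right _ _)
    rw [Function.iterate_succ_apply']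
    have := dist_triangle (x (n + 1)) (f (x n)) (f (f^[n] (x 0)))
    linarith

/-- Off a ball around `xu`, compactness bounds the entrance time of true orbits into a half-size
neighbourhood of `xs`; shadowing for that many steps transfers this to pseudo-orbits. -/
theorem exists_uniform_entrance {f : S1 → S1} (hf : Continuous f) {xs xu : S1}
    (hlim : ∀ x : S1, x ≠ xu → Tendsto (fun n : ℕ => f^[n] x) atTop (𝓝 xs)) {δ₁ δ₂ : ℝ}
    (hδ₁ : 0 < δ₁) (hδ₂ : 0 < δ₂) : ∃ η > 0, ∃ n : ℕ, ∀ x : ℕ → S1,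
      (∀ i < n, dist (x (i + 1)) (f (x i)) ≤ η) → δ₁ ≤ dist (x 0) xu →
      ∃ i ≤ n, dist (x i) xs < δ₂ := by
  have hK : IsCompact {y : S1 | δ₁ ≤ dist y xu} :=
    (isClosed_le continuous_const (continuous_id.dist continuous_const)).isCompact
  have hU : ∀ m : ℕ, IsOpen {y : S1 | dist (f^[m] y) xs < δ₂ / 2} := fun m =>
    isOpen_lt ((hf.iterate m).dist continuous_const) continuous_const
  obtain ⟨s, hs⟩ := hK.elim_finite_subcover _ hU fun y hy => by
    have hne : y ≠ xu := fun h => by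
      rw [Set.mem_ofPred_eq, h, dist_self] at hy
      linarith
    obtain ⟨m, hm⟩ := ((hlim y hne).eventually (Metric.ball_mem_nhds xs (half_pos hδ₂))).exists
    exact Set.mem_iUnion.2 ⟨m, hm⟩
  choose η hη h using fun m : ℕ => exists_shadowing hf m (half_pos hδ₂)
  have hmin : ∃ η' > 0, ∀ m ∈ s, η' ≤ η m := by
    rcases s.eq_empty_or_nonempty with rfl | hne
    · exact ⟨1, one_pos, by simp⟩
    · exact ⟨s.inf' hne η, (Finset.lt_inf'_iff hne).2 fun m _ => hη m,
        fun m hm => Finset.inf'_le η hm⟩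
  obtain ⟨η', hη', hle⟩ := hmin
  refine ⟨η', hη', s.sup id, fun x hx h0 => ?_⟩
  obtain ⟨m, hm⟩ := Set.mem_iUnion.1 (hs h0)
  obtain ⟨hms, hm⟩ := Set.mem_iUnion.1 hm
  have hle2 : m ≤ s.sup id := Finset.le_sup (f := id) hms
  refine ⟨m, hle2, ?_⟩
  have h1 := h m x fun i hi => (hx i (hi.trans_le hle2)).trans (hle m hms)
  have h2 : dist (f^[m] (x 0)) xs < δ₂ / 2 := hm
  have := dist_triangle (x m) (f^[m] (x 0)) xs
  linarith

/-- Pseudo-orbits with small jumps cannot avoid small neighbourhoods of the two fixed points for a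
long time. -/
theorem exists_no_long_pseudoOrbit {f : S1 → S1} (hf : Continuous f) {xs xu : S1}
    (hlim : ∀ x : S1, x ≠ xu → Tendsto (fun n : ℕ => f^[n] x) atTop (𝓝 xs)) {p q δs δu : ℝ}
    (hp : 1 < p) (hq0 : 0 < q) (hq : q < 1) (hδs : 0 < δs) (hδu : 0 < δu)
    (hu : ∀ x, dist x xu < δu → p * dist x xu ≤ dist (f x) xu)
    (hs : ∀ x, dist x xs < δs → dist (f x) xs ≤ q * dist x xs) :
    ∃ c > 0, ∀ ru rs η : ℝ, 0 < ru → 0 < rs → η ≤ c → η ≤ c * ru → η ≤ c * rs →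
      ∃ n : ℕ, ∀ x : ℕ → S1, (∀ i < n, dist (x (i + 1)) (f (x i)) ≤ η) →
        ∃ i < n, dist (x i) xu < ru ∨ dist (x i) xs < rs := by
  obtain ⟨η₀, hη₀, N₂, hN₂⟩ := exists_uniform_entrance hf hlim hδu hδs
  -- A jump of at most (p - 1)/2 times the distance to `xu` leaves the expansion rate p - (p - 1)/2
  -- = (1 + p)/2; likewise q + (1 - q)/2 = (1 + q)/2 at `xs`. The constant is fixed before the
  -- radii, which will shrink with ε.
  refine ⟨min η₀ (min ((p - 1) / 2) ((1 - q) / 2)), by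
    refine lt_min hη₀ (lt_min ?_ ?_) <;> linarith, fun ru rs η hru hrs h1 h2 h3 => ?_⟩
  have h2' : η ≤ (p - 1) / 2 * ru := h2.trans (by
    gcongr
    exact (min_le_right _ _).trans (min_le_left _ _))
  have h3' : η ≤ (1 - q) / 2 * rs := h3.trans (by
    gcongr
    exact (min_le_right _ _).trans (min_le_right _ _))
  have h1' := h1.trans (min_le_left _ _)
  obtain ⟨N₁, hN₁⟩ := pow_unbounded_of_one_lt (δu / ru) (show 1 < (1 + p) / 2 by linarith)
  rw [div_lt_iff₀ hru] at hN₁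
  obtain ⟨N₃, hN₃⟩ := exists_pow_lt_of_lt_one (div_pos hrs hδs) (show (1 + q) / 2 < 1 by linarith)
  rw [lt_div_iff₀ hδs] at hN₃
  -- Three phases: at most N₁ steps to get δu away from `xu`, N₂ more to come within δs of `xs`, and
  -- N₃ more to contract below `rs`.
  refine ⟨N₁ + N₂ + N₃ + 1, fun x hx => ?_⟩
  by_contra! hcon
  obtain ⟨a, haN, ha⟩ : ∃ a ≤ N₁, δu ≤ dist (x a) xu := by
    by_contra! hlt
    have key : ∀ i ≤ N₁, ((1 + p) / 2) ^ i * ru ≤ dist (x i) xu := by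
      intro i
      induction i with
      | zero => intro _; simpa using (hcon 0 (by omega)).1
      | succ i ih =>
        intro hi
        have g1 := hu (x i) (hlt i (by omega))
        have g2 := hx i (by omega)
        have g3 := (hcon i (by omega)).1
        have g4 := dist_triangle (f (x i)) (x (i + 1)) xu
        rw [dist_comm (f (x i)) (x (i + 1))] at g4
        have g5 := ih (by omega)
        have g6 := mul_nonneg (sub_nonneg.2 hp.le) (sub_nonneg.2 g3)
        have g7 := mul_nonneg (show 0 ≤ 1 + p by linarith) (sub_nonneg.2 g5)
        rw [pow_succ]
        linarith
    linarith [key N₁ le_rfl, hlt N₁ le_rfl]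
  obtain ⟨b, hbN, hb⟩ := hN₂ (fun i => x (a + i))
    (fun i hi => (hx (a + i) (by omega)).trans h1') ha
  have key : ∀ i ≤ N₃, dist (x (a + b + i)) xs ≤ ((1 + q) / 2) ^ i * δs := by
    intro i
    induction i with
    | zero => intro _; simpa using hb.le
    | succ i ih =>
      intro hi
      have g5 := ih (by omega)
      have g0 : ((1 + q) / 2) ^ i * δs ≤ δs := by
        have := pow_le_one₀ (n := i) (show 0 ≤ (1 + q) / 2 by linarith) (by linarith)
        nlinarith
      have g6 : dist (x (a + b + i)) xs < δs := by
        rcases Nat.eq_zero_or_pos i with rfl | hi0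
        · exact hb
        · have : ((1 + q) / 2) ^ i < 1 := pow_lt_one₀ (by linarith) (by linarith) hi0.ne'
          nlinarith
      have g1 := hs _ g6
      have g2 := hx (a + b + i) (by omega)
      have g3 := (hcon (a + b + i) (by omega)).2
      have g4 := dist_triangle (x (a + b + i + 1)) (f (x (a + b + i))) xs
      rw [pow_succ, ← add_assoc]
      nlinarith
  have := key N₃ le_rfl
  have := (hcon (a + b + N₃) (by omega)).2
  linarith

/-! ### The noise restricted to bounded values -/

/-- The transition function with the noise restricted to `(-M, M)`. -/
def truncFun (f : S1 → S1) (σ : S1 → ℝ) (ε M : ℝ) (φ : S1 → ℂ) (x : S1) : ℂ :=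
  ∫ z, (if |z| < M then φ (f x + ((ε * σ x * z : ℝ) : S1)) else 0) ∂stdG

section Trunc

variable {f : S1 → S1} {σ : S1 → ℝ} (ε M : ℝ)

theorem measurable_truncFun (hf : Measurable f) (hσ : Measurable σ) (φ : B) : Measurable (truncFun f σ ε M φ) := by
  have h : StronglyMeasurable
      (fun p : S1 × ℝ => if |p.2| < M then φ (f p.1 + ((ε * σ p.1 * p.2 : ℝ) : S1)) else 0) :=
    ((φ.measurable.comp (measurable_kernelMap hf hσ ε)).ite
      (measurableSet_lt measurable_snd.abs measurable_const) measurable_const).stronglyMeasurable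
  exact (h.integral_prod_right' (ν := stdG)).measurable

theorem norm_truncFun_integrand_le (φ : B) (x : S1) (z : ℝ) :
    ‖if |z| < M then φ (f x + ((ε * σ x * z : ℝ) : S1)) else 0‖ ≤ ‖φ‖ := by
  split_ifs
  · exact φ.norm_apply_le _
  · simp

theorem integrable_truncFun (hf : Measurable f) (hσ : Measurable σ) (φ : B) (x : S1) :
    Integrable (fun z => if |z| < M then φ (f x + ((ε * σ x * z : ℝ) : S1)) else 0) stdG :=
  Integrable.of_bound (Measurable.aestronglyMeasurable
    ((φ.measurable.comp ((measurable_kernelMap hf hσ ε).comp measurable_prodMk_left)).ite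
      (measurableSet_lt measurable_id.abs measurable_const) measurable_const)) ‖φ‖
    (Eventually.of_forall fun _ => norm_truncFun_integrand_le ε M φ x _)

variable (hf : Measurable f) (hσ : Measurable σ)

/-- The transition operator with the noise restricted to `(-M, M)`. -/
def truncOp : B →L[ℂ] B :=
  mkOp (fun φ => truncFun f σ ε M φ) 1 zero_le_one (measurable_truncFun ε M hf hσ)
    (fun φ x => by
      have h := norm_integral_le_of_norm_le_const (μ := stdG)
        (Eventually.of_forall (norm_truncFun_integrand_le (f := f) (σ := σ) ε M φ x))
      simpa [truncFun] using h)
    (fun φ ψ x => by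
      rw [truncFun, truncFun, truncFun, ← integral_add (integrable_truncFun ε M hf hσ φ x)
        (integrable_truncFun ε M hf hσ ψ x)]
      congr 1
      ext z
      split_ifs <;> simp)
    (fun c φ x => by
      rw [truncFun, truncFun, ← integral_const_mul]
      congr 1
      ext z
      split_ifs <;> simp)

theorem truncOp_apply (φ : B) (x : S1) : truncOp ε M hf hσ φ x =
    ∫ z, (if |z| < M then φ (f x + ((ε * σ x * z : ℝ) : S1)) else 0) ∂stdG := rfl

theorem transOp_apply (φ : B) (x : S1) : transOp f σ hf hσ ε φ x =
    ∫ z, φ (f x + ((ε * σ x * z : ℝ) : S1)) ∂stdG := rfl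

theorem im_integral_eq_zero {G : ℝ → ℂ} (hG : Integrable G stdG) (h : ∀ z, (G z).im = 0) :
    (∫ z, G z ∂stdG).im = 0 := by
  have h1 := integral_im hG
  simp only [RCLike.im_to_complex, h, integral_zero] at h1
  exact h1.symm

theorem isRealOp_truncOp : IsRealOp (truncOp ε M hf hσ) := fun φ hφ x => by
  rw [truncOp_apply]
  refine im_integral_eq_zero (integrable_truncFun ε M hf hσ φ x) fun z => ?_
  split_ifs
  · exact hφ _
  · simp

theorem isRealOp_transOp : IsRealOp (transOp f σ hf hσ ε) := fun φ hφ x =>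
  im_integral_eq_zero (integrable_transFun hf hσ ε φ x) fun _ => hφ _

theorem norm_transOp_sub_truncOp_le (φ : B) (x : S1) :
    ‖transOp f σ hf hσ ε φ x - truncOp ε M hf hσ φ x‖ ≤ ‖φ‖ * gaussTail M := by
  rw [transOp_apply, truncOp_apply, ← integral_sub (integrable_transFun hf hσ ε φ x)
    (integrable_truncFun ε M hf hσ φ x)]
  refine norm_integral_le_gaussTail (fun z hz => by rw [if_pos hz, sub_self]) fun z => ?_
  split_ifs
  · simp
  · rw [sub_zero]
    exact φ.norm_apply_le _

variable {ε M}

theorem dist_noise_le {C : ℝ} (hC : ∀ x, |σ x| ≤ C) (hε : 0 ≤ ε) {x : S1} {z : ℝ} (hz : |z| < M) :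
    dist (f x + ((ε * σ x * z : ℝ) : S1)) (f x) ≤ ε * C * M := by
  rw [dist_eq_norm, add_sub_cancel_left]
  refine (norm_coe_le_abs _).trans ?_
  rw [abs_mul, abs_mul, abs_of_nonneg hε]
  have := (abs_nonneg _).trans (hC x)
  gcongr
  exact hC x

theorem exists_of_truncOp_ne_zero {C : ℝ} (hC : ∀ x, |σ x| ≤ C) (hε : 0 ≤ ε) {φ : B} {x : S1}
    (h : truncOp ε M hf hσ φ x ≠ 0) : ∃ y, dist y (f x) ≤ ε * C * M ∧ φ y ≠ 0 := by
  by_contra! hcon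
  refine h ?_
  rw [truncOp_apply]
  have : ∀ z, (if |z| < M then φ (f x + ((ε * σ x * z : ℝ) : S1)) else 0) = 0 := fun z => by
    split_ifs with hz
    · exact hcon _ (dist_noise_le hC hε hz)
    · rfl
  simp_rw [this]
  exact integral_zero _ _

/-- The part of the truncated chain which starts in `O`, killed in `U`. -/
def transientOp (O U : Set S1) (hO : MeasurableSet O) (hU : MeasurableSet U) : B →L[ℂ] B :=
  (restr O hO).comp ((truncOp ε M hf hσ).comp (restr Uᶜ hU.compl))

theorem transientOp_apply (O U : Set S1) (hO : MeasurableSet O) (hU : MeasurableSet U) (φ : B) :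
    transientOp hf hσ (ε := ε) (M := M) O U hO hU φ =
      restr O hO (truncOp ε M hf hσ (restr Uᶜ hU.compl φ)) := rfl

theorem transientOp_apply_of_mem {O U : Set S1} {hO : MeasurableSet O} {hU : MeasurableSet U}
    (φ : B) {x : S1} (hx : x ∈ O)
    (h : ∀ z, |z| < M → f x + ((ε * σ x * z : ℝ) : S1) ∉ U) :
    transientOp hf hσ (ε := ε) (M := M) O U hO hU φ x = truncOp ε M hf hσ φ x := by
  rw [transientOp_apply, restr_apply_of_mem hx, truncOp_apply, truncOp_apply]
  congr 1
  ext z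
  split_ifs with hz
  · rw [restr_apply_of_mem]
    exact h z hz
  · rfl

/-- An average can be nonzero only if the function is nonzero at some reachable point. Following
such points through the factors yields a pseudo-orbit in `O`; if there is none of length n, the n-th
power vanishes. -/
theorem exists_pseudoOrbit {C : ℝ} (hC : ∀ x, |σ x| ≤ C) (hε : 0 ≤ ε) {O U : Set S1}
    {hO : MeasurableSet O} {hU : MeasurableSet U} (n : ℕ) {φ : B} {x : S1}
    (h : (transientOp hf hσ (ε := ε) (M := M) O U hO hU ^ n) φ x ≠ 0) :
    ∃ y : ℕ → S1, y 0 = x ∧ ∀ i < n, y i ∈ O ∧ dist (y (i + 1)) (f (y i)) ≤ ε * C * M := by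
  set T := transientOp hf hσ (ε := ε) (M := M) O U hO hU with hT
  induction n generalizing x with
  | zero => exact ⟨fun _ => x, rfl, by simp⟩
  | succ n ih =>
    have e : (T ^ (n + 1)) φ = T ((T ^ n) φ) := by
      rw [pow_succ' _ n]; rfl
    rw [e, hT, transientOp_apply] at h
    have hx : x ∈ O := by
      by_contra hx
      exact h (restr_apply_of_notMem hx _)
    rw [restr_apply_of_mem hx] at h
    obtain ⟨y, hy, hy2⟩ := exists_of_truncOp_ne_zero hf hσ hC hε h
    have hyU : y ∈ Uᶜ := by
      by_contra hyU
      exact hy2 (restr_apply_of_notMem hyU _)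
    rw [restr_apply_of_mem hyU] at hy2
    obtain ⟨w, hw0, hw⟩ := ih hy2
    refine ⟨fun i => Nat.casesOn i x w, rfl, fun i hi => ?_⟩
    cases i with
    | zero => exact ⟨hx, by simpa [hw0] using hy⟩
    | succ i => exact hw i (by omega)

theorem transientOp_pow_eq_zero {C : ℝ} (hC : ∀ x, |σ x| ≤ C) (hε : 0 ≤ ε) {O U : Set S1}
    {hO : MeasurableSet O} {hU : MeasurableSet U} {n : ℕ}
    (h : ∀ y : ℕ → S1, (∀ i < n, dist (y (i + 1)) (f (y i)) ≤ ε * C * M) → ∃ i < n, y i ∉ O) :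
    transientOp hf hσ (ε := ε) (M := M) O U hO hU ^ n = 0 := by
  refine ContinuousLinearMap.ext fun φ => B.ext_apply fun x => ?_
  by_contra hne
  obtain ⟨y, -, hy⟩ := exists_pseudoOrbit hf hσ hC hε n hne
  obtain ⟨i, hi, hiO⟩ := h y fun i hi => (hy i hi).2
  exact hiO (hy i hi).1

end Trunc

/-! ### Hermite profiles -/

theorem hermiteFn_div_sqrt_two (j : ℕ) (t : ℝ) : hermiteFn j (t / √2) = √2 ^ j * wHe j t := by
  have h2 : √2 ≠ 0 := by positivity
  rw [hermiteFn, wHe, wt, He_eq_aeval, mul_div_cancel₀ t h2, div_pow, Real.sq_sqrt (by norm_num)]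
  rw [neg_div]
  ring

/-- The correction which cuts off the Hermite function at the boundary of the chart. -/
def cutoff (j : ℕ) (a ε ρ : ℝ) (y : ℝ) : ℂ :=
  if |√2 * a * y| < ρ then 0 else ((-(hermiteFn j (a * y) / ε) : ℝ) : ℂ)

/-- The correction is nonzero only where |√2 a y| ≥ ρ, and there 1/ε = ρ⁴ ≤ (√2 a y)⁴. The division
by ε thus costs a polynomial factor, absorbed by exp(-(a² - k) y²). -/
theorem exists_gaussianDecay_cutoff (j : ℕ) {a k : ℝ} (hk : k < a ^ 2) :
    ∃ K, 0 ≤ K ∧ ∀ ε ρ : ℝ, 0 < ε → 0 ≤ ρ → ε⁻¹ = ρ ^ 4 → GaussianDecay k K (cutoff j a ε ρ) := by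
  set p : Polynomial ℝ := Polynomial.C (√2 ^ j) * (Polynomial.C (√2 * a) * Polynomial.X) ^ 4 *
    ((Polynomial.hermite j).map (Int.castRingHom ℝ)).comp (Polynomial.C (√2 * a) * Polynomial.X)
    with hp
  obtain ⟨K, hK, h⟩ := exists_bound_polynomial_mul_exp p (a := a ^ 2 - k) (by linarith)
  refine ⟨K, hK, fun ε ρ hε hρ hερ y => ?_⟩
  rw [cutoff]
  split_ifs with hy
  · simpa using hK
  · refine le_trans ?_ (h y)
    have e1 : p.eval y = √2 ^ j * (√2 * a * y) ^ 4 * He j (√2 * a * y) := by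
      simp [hp, He]
    have e2 : hermiteFn j (a * y) = √2 ^ j * (Real.exp (-(a * y) ^ 2) * He j (√2 * a * y)) := by
      rw [hermiteFn, He_eq_aeval, mul_assoc (√2) a y]
      ring
    have e3 : Real.exp (-(a ^ 2 - k) * y ^ 2) = Real.exp (-(a * y) ^ 2) * Real.exp (k * y ^ 2) := by
      rw [← Real.exp_add]
      ring_nf
    rw [Complex.norm_real, Real.norm_eq_abs, abs_neg, div_eq_inv_mul, hερ, e1, e2, e3]
    have e4 : |ρ ^ 4| ≤ |(√2 * a * y) ^ 4| := by
      rw [abs_pow, abs_pow, abs_of_nonneg hρ]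
      exact pow_le_pow_left₀ hρ (not_lt.1 hy) 4
    set A := √2 * a * y
    simp only [abs_mul, Real.abs_exp]
    calc _ ≤ |A ^ 4| * (|√2 ^ j| * (Real.exp (-(a * y) ^ 2) * |He j (√2 * a * y)|)) *
          Real.exp (k * y ^ 2) := by gcongr
      _ = _ := by ring

namespace Chart

variable (ch : Chart)

/-- Inside the chart ψ vanishes; between the chart and the unit sphere around the centre, ε ψ
cancels the Hermite function. The profile is thus exactly a multiple of the model eigenvector. -/
theorem profile_eq {j : ℕ} {a ε : ℝ} (ha : 0 < a) (hε : 0 < ε) (hκ : ch.κ = ε / (√2 * a))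
    (h1 : ch.κ * ch.ρ ≤ 1) (x : S1) :
    profile j a ε (cutoff j a ε ch.ρ) ch.x₀ 1 x = (√2 : ℂ) ^ j * ch.wHeB j x := by
  have h2 : 0 < √2 := by positivity
  have e1 : √2 * a * (rep (x - ch.x₀) / ε) = ch.coord x := by
    rw [coord, hκ]; field_simp
  have e2 : a * rep (x - ch.x₀) / ε = ch.coord x / √2 := by
    rw [coord, hκ]; field_simp
  have e3 : a * (rep (x - ch.x₀) / ε) = ch.coord x / √2 := by rw [← e2]; ring
  rw [profile]
  by_cases hx : x ∈ ch.dom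
  · have hx' : |ch.coord x| < ch.ρ := hx
    have hb : x ∈ Metric.ball ch.x₀ 1 :=
      Metric.mem_ball.2 (((ch.mem_dom_iff x).1 hx).trans_le h1)
    rw [Set.indicator_of_mem hb, cutoff, e1, if_pos hx', mul_zero, add_zero, e2,
      hermiteFn_div_sqrt_two, wHeB_apply, ch.pushFun_of_mem _ hx]
    push_cast
    rfl
  · have hx' : ¬|ch.coord x| < ch.ρ := hx
    rw [ch.wHeB_apply_of_notMem j hx, mul_zero]
    by_cases hb : x ∈ Metric.ball ch.x₀ 1
    · have hεC : (ε : ℂ) ≠ 0 := Complex.ofReal_ne_zero.2 hε.ne'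
      rw [Set.indicator_of_mem hb, cutoff, e1, if_neg hx', e2, e3]
      push_cast
      field_simp
      ring
    · rw [Set.indicator_of_notMem hb]

/-- The factor κ is the Jacobian of the chart, and √(2π) the ratio of the weight to the density of
γ. -/
theorem integral_mul_wHeB (j : ℕ) (φ : B) :
    ∫ x, φ x * ch.wHeB j x = (ch.κ * √(2 * Real.pi) : ℝ) * ch.fnHe j φ := by
  have hκ := ch.κ_pos
  set G : ℝ → ℂ := fun t => ch.pull φ t * (wHe j t : ℂ) with hG
  have e1 : ∫ x, φ x * ch.wHeB j x =
      ∫ s in Set.Ioc (-Real.pi) (-Real.pi + 2 * Real.pi), G (s / ch.κ) := by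
    rw [← integral_add_left_eq_self _ ch.x₀, ← AddCircle.integral_preimage (2 * Real.pi) (-Real.pi)]
    refine setIntegral_congr_fun measurableSet_Ioc fun s hs => ?_
    have hs' : s ∈ Set.Ioc (-Real.pi) Real.pi := ⟨hs.1, by linarith [hs.2]⟩
    have hc : ch.coord (ch.x₀ + (s : S1)) = s / ch.κ := by
      rw [coord, add_sub_cancel_left, rep_coe hs']
    have hpt : ch.pt (s / ch.κ) = ch.x₀ + (s : S1) := by rw [← hc, pt_coord]
    simp only [hG]
    rw [wHeB_apply, pushFun, hc, pull, hpt]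
    split_ifs <;> simp
  have e2 : ∫ s in Set.Ioc (-Real.pi) (-Real.pi + 2 * Real.pi), G (s / ch.κ) =
      ∫ s, G (s / ch.κ) := by
    refine setIntegral_eq_integral_of_forall_compl_eq_zero fun s hs => ?_
    have : ch.ρ ≤ |s / ch.κ| := by
      rw [abs_div, abs_of_pos hκ, le_div_iff₀ hκ]
      by_contra hlt
      have h1 := abs_lt.1 ((not_le.1 hlt).trans (by rw [mul_comm]; exact ch.lt_pi))
      exact hs ⟨h1.1, by linarith⟩
    simp only [hG]
    rw [ch.pull_of_le φ this, zero_mul]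
  have e3 : ∫ t, ch.pull φ t * (He j t : ℂ) ∂stdG =
      ∫ t, ((√(2 * Real.pi))⁻¹ : ℝ) • G t := by
    have h := integral_affine_stdG (m := 0) one_ne_zero (fun t => ch.pull φ t * (He j t : ℂ))
    simp only [zero_add, one_mul, sub_zero, one_pow, mul_one] at h
    rw [h]
    congr 1
    ext t
    simp only [hG, wHe, wt, Complex.real_smul]
    push_cast
    ring
  rw [e1, e2, Measure.integral_comp_div G, fnHe_apply, e3, integral_smul, abs_of_pos hκ,
    Complex.real_smul, Complex.real_smul, ← mul_assoc, ← Complex.ofReal_mul, mul_assoc,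
    mul_inv_cancel₀ (by positivity), mul_one]

end Chart

/-! ### From eigenfunctionals and eigenvectors to Hermite profiles -/

theorem smul_ne_zero_of_ne_zero {E : Type*} [NormedAddCommGroup E] [NormedSpace ℂ E] {c : ℂ} {v : E}
    (hc : c ≠ 0) (hv : v ≠ 0) : c • v ≠ 0 := smul_ne_zero hc hv

theorem integrable_B_mul {ρ : S1 → ℂ} (hρ : Integrable ρ volume) (φ : B) :
    Integrable (fun x => φ x * ρ x) volume :=
  hρ.bdd_mul φ.measurable.aestronglyMeasurable (Eventually.of_forall φ.norm_apply_le)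

theorem integrable_B (φ : B) : Integrable (φ : S1 → ℂ) volume :=
  Integrable.of_bound φ.measurable.aestronglyMeasurable ‖φ‖ (Eventually.of_forall φ.norm_apply_le)

theorem ae_eq_zero_of_forall_integral_B {ρ : S1 → ℂ} (hρ : Integrable ρ volume)
    (h : ∀ φ : B, ∫ x, φ x * ρ x = 0) : ρ =ᵐ[volume] 0 := by
  refine hρ.ae_eq_zero_of_forall_setIntegral_eq_zero fun s hs _ => ?_
  have h1 := h (mkB (s.indicator fun _ => 1) (measurable_const.indicator hs) 1 fun x => by
    refine (norm_indicator_le_norm_self _ _).trans (by simp))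
  rw [← integral_indicator hs, ← h1]
  congr 1
  ext x
  rw [mkB_apply]
  by_cases hx : x ∈ s
  · simp [hx]
  · simp [hx]

theorem ae_eq_of_forall_integral_B {ρ ρ' : S1 → ℂ} (hρ : Integrable ρ volume)
    (hρ' : Integrable ρ' volume) (h : ∀ φ : B, ∫ x, φ x * ρ x = ∫ x, φ x * ρ' x) :
    ρ =ᵐ[volume] ρ' := by
  have h0 := ae_eq_zero_of_forall_integral_B (hρ.sub hρ') fun φ => by
    simp only [Pi.sub_apply, mul_sub]
    rw [integral_sub (integrable_B_mul hρ φ) (integrable_B_mul hρ' φ), h, sub_self]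
  filter_upwards [h0] with x hx
  exact sub_eq_zero.1 hx

/-- Integration against a density, as a functional on `B`. -/
def densityFunctional {ρ : S1 → ℂ} (hρ : Integrable ρ volume) : B →ₗ[ℂ] ℂ where
  toFun φ := ∫ x, φ x * ρ x
  map_add' φ ψ := by
    rw [← integral_add (integrable_B_mul hρ φ) (integrable_B_mul hρ ψ)]
    congr 1
    ext x
    rw [B.add_apply, add_mul]
  map_smul' c φ := by
    rw [RingHom.id_apply, smul_eq_mul, ← integral_const_mul]
    congr 1
    ext x
    rw [B.smul_apply, mul_assoc]

/-- A density is determined almost everywhere by its functional on bounded functions, so uniqueness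
of the eigenfunctional is uniqueness of the eigendensity. -/
theorem Chart.hermiteEigendensities (ch : Chart) {T : B →L[ℂ] B} {μ : ℂ} {j : ℕ} {a ε k K : ℝ}
    (ha : 0 < a) (hε : 0 < ε) (hκ : ch.κ = ε / (√2 * a)) (h1 : ch.κ * ch.ρ ≤ 1)
    (hdecay : GaussianDecay k K (cutoff j a ε ch.ρ)) (hT : ∀ φ, ch.fnHe j (T φ) = μ * ch.fnHe j φ)
    (hne : ∃ φ, ch.fnHe j φ ≠ 0)
    (huniq : ∀ M : B →ₗ[ℂ] ℂ, (∀ φ, M (T φ) = μ * M φ) → ∃ b : ℂ, ∀ φ, M φ = b * ch.fnHe j φ) :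
    HermiteEigendensities T μ j a ε ch.x₀ 1 k K := by
  set p := profile j a ε (cutoff j a ε ch.ρ) ch.x₀ 1 with hp
  set q : ℂ := (√2 : ℂ) ^ j * (ch.κ * √(2 * Real.pi) : ℝ) with hq
  have hq0 : q ≠ 0 := by
    have h2 : (√2 : ℝ) ≠ 0 := by positivity
    have h3 : ch.κ * √(2 * Real.pi) ≠ 0 := mul_ne_zero ch.κ_pos.ne' (by positivity)
    exact mul_ne_zero (pow_ne_zero _ (Complex.ofReal_ne_zero.2 h2)) (Complex.ofReal_ne_zero.2 h3)
  have hpi : Integrable p volume :=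
    ((integrable_B (ch.wHeB j)).const_mul _).congr
      (Eventually.of_forall fun x => (ch.profile_eq ha hε hκ h1 x).symm)
  have hint : ∀ φ : B, ∫ x, φ x * p x = q * ch.fnHe j φ := fun φ => by
    rw [hq, mul_assoc, ← ch.integral_mul_wHeB, ← integral_const_mul]
    congr 1
    ext x
    rw [hp, ch.profile_eq ha hε hκ h1]
    ring
  refine ⟨cutoff j a ε ch.ρ, hdecay, ⟨hpi, fun h0 => ?_, fun φ => ?_⟩, fun ρ hρ => ?_⟩
  · obtain ⟨φ, hφ⟩ := hne
    have h3 := hint φ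
    rw [integral_congr_ae (g := fun _ => 0) (by filter_upwards [h0] with x hx; rw [show p x = 0 from hx, mul_zero]),
      integral_zero, eq_comm, mul_eq_zero] at h3
    exact h3.elim hq0 hφ
  · rw [hint, hint, hT]
    ring
  · obtain ⟨b, hb⟩ := huniq (densityFunctional hρ.1) hρ.2.2
    refine ⟨b / q, ae_eq_of_forall_integral_B hρ.1 (hpi.const_mul _) fun φ => ?_⟩
    refine (hb φ).trans ?_
    simp_rw [mul_left_comm _ (b / q)]
    rw [integral_const_mul, hint]
    field_simp

theorem Chart.hermiteEigenfunctions (ch : Chart) {T : B →L[ℂ] B} {μ : ℂ} {j : ℕ} {a ε k K : ℝ}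
    (ha : 0 < a) (hε : 0 < ε) (hκ : ch.κ = ε / (√2 * a)) (h1 : ch.κ * ch.ρ ≤ 1)
    (hdecay : GaussianDecay k K (cutoff j a ε ch.ρ)) (hT : T (ch.wHeB j) = μ • ch.wHeB j)
    (hne : ch.wHeB j ≠ 0) (huniq : ∀ φ, T φ = μ • φ → ∃ b : ℂ, φ = b • ch.wHeB j) :
    HermiteEigenfunctions T μ j a ε ch.x₀ 1 k K := by
  have h2 : (√2 : ℂ) ^ j ≠ 0 :=
    pow_ne_zero _ (Complex.ofReal_ne_zero.2 (by positivity))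
  refine ⟨cutoff j a ε ch.ρ, hdecay, ⟨(√2 : ℂ) ^ j • ch.wHeB j, ⟨smul_ne_zero_of_ne_zero h2 hne, ?_⟩,
    fun x => ?_⟩, fun φ hφ => ?_⟩
  · rw [T.map_smul, hT, smul_smul, smul_smul, mul_comm]
  · rw [ch.profile_eq ha hε hκ h1, B.smul_apply]
  · obtain ⟨b, hb⟩ := huniq φ hφ.2
    refine ⟨b / (√2 : ℂ) ^ j, fun x => ?_⟩
    rw [ch.profile_eq ha hε hκ h1, hb, B.smul_apply]
    field_simp

/-! ### The block triangular model operator -/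

theorem finiteRank_apply {E : Type*} [NormedAddCommGroup E] [NormedSpace ℂ E] {N : ℕ} (R : E →L[ℂ] E)
    (l m : Fin N → E →L[ℂ] ℂ) (φ g : Fin N → E) (a b : Fin N → ℂ) (u : E) :
    (R + ∑ j, (l j).smulRight (a j • φ j) + ∑ i, (m i).smulRight (b i • g i)) u =
      R u + ∑ j, (a j * l j u) • φ j + ∑ i, (b i * m i u) • g i := by
  simp only [add_apply, sum_apply, ContinuousLinearMap.smulRight_apply, smul_smul, mul_comm]

theorem Chart.stableOp_eq_zero (ch : Chart) {N : ℕ} (D : DualHe N) (c : ℝ) {u : B}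
    (hu : ∀ x ∈ ch.dom, u x = 0) : ch.stableOp D c u = 0 := by
  rw [ch.stableOp_congr D (ψ := 0) fun t => by
    rw [ch.pull_eq_zero hu, ch.pull_eq_zero fun _ _ => rfl], ContinuousLinearMap.map_zero]

theorem Chart.fnHe_eq_zero (ch : Chart) (j : ℕ) {u : B} (hu : ∀ x ∈ ch.dom, u x = 0) :
    ch.fnHe j u = 0 := by
  rw [fnHe_apply]
  simp_rw [ch.pull_eq_zero hu]
  simp

theorem IsRealB.smul {φ : B} (hφ : IsRealB φ) (a : ℝ) : IsRealB ((a : ℂ) • φ) := fun x => by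
  rw [B.smul_apply, Complex.mul_im, hφ x]
  simp

/-- Two disjoint charts, and operators describing the transitions outside of them (`P`) and out of the
second one (`Q`). -/
structure BlockData (chs chu : Chart) (P Q : B →L[ℂ] B) : Prop where
  disj : ∀ x ∈ chs.dom, x ∉ chu.dom
  P_apply : ∀ φ x, x ∈ chs.dom ∨ x ∈ chu.dom → P φ x = 0
  P_eq_zero : ∀ φ : B, (∀ x, x ∉ chu.dom → φ x = 0) → P φ = 0
  P_pow : ∃ n, P ^ n = 0
  Q_apply : ∀ φ x, x ∉ chu.dom → Q φ x = 0
  Q_eq_zero : ∀ φ : B, (∀ x, x ∉ chu.dom → φ x = 0) → Q φ = 0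

section Blocks

variable (chs chu : Chart) (P Q : B →L[ℂ] B) {N : ℕ} (D : DualHe N) (cs c : ℝ)

/-- The block triangular operator without the leading eigenvalues. -/
def restOp : B →L[ℂ] B :=
  chs.stableOp D cs + (P + (Q + chu.unstableOp D c))

theorem restOp_apply (φ : B) (x : S1) : restOp chs chu P Q D cs c φ x =
    chs.stableOp D cs φ x + (P φ x + (Q φ x + chu.unstableOp D c φ x)) := by
  rw [restOp, add_apply, add_apply, add_apply]
  rfl

/-- The block triangular operator, with the leading eigenvalues `lam` at the stable and `mu` at the
unstable fixed point. -/
def upOp (mu lam : Fin N → ℝ) : B →L[ℂ] B :=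
  restOp chs chu P Q D cs c + ∑ j, (chu.fnW D j).smulRight ((mu j : ℂ) • chu.wHeB j) +
    ∑ i : Fin N, (chs.fnHe i).smulRight ((lam i : ℂ) • chs.dualB D i)

theorem upOp_apply (mu lam : Fin N → ℝ) (φ : B) : upOp chs chu P Q D cs c mu lam φ =
    restOp chs chu P Q D cs c φ + ∑ j, ((mu j : ℂ) * chu.fnW D j φ) • chu.wHeB j +
      ∑ i : Fin N, ((lam i : ℂ) * chs.fnHe i φ) • chs.dualB D i :=
  finiteRank_apply _ _ _ _ _ _ _ _

theorem isRealOp_upOp (hP : IsRealOp P) (hQ : IsRealOp Q) (mu lam : Fin N → ℝ) :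
    IsRealOp (upOp chs chu P Q D cs c mu lam) :=
  (((chs.isRealOp_stableOp D cs).add (hP.add (hQ.add (chu.isRealOp_unstableOp D c)))).add
    (IsRealOp.sum _ fun j => (chu.isRealFn_fnW D j).smulRight
      (IsRealB.smul chu.isRealB_pushB (mu j)))).add
    (IsRealOp.sum _ fun i => (chs.isRealFn_fn _ _).smulRight
      (IsRealB.smul chs.isRealB_pushB (lam i)))

variable {chs chu P Q}

namespace BlockData

theorem notMem_dom_of_mem (h : BlockData chs chu P Q) {x : S1} (hx : x ∈ chu.dom) : x ∉ chs.dom :=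
  fun hs => h.disj x hs hx

/-- Each summand annihilates the range of the sum of those to its right: the stable block reads only
values in its own chart, where the others vanish, while `P` and `Q` read only values off the
unstable chart. What remains are two nilpotents and two diagonal blocks. -/
theorem restOp_notMem_spectrum (h : BlockData chs chu P Q) {θ : ℝ} (hcs : cs ^ 2 < 1) (hc : c ^ 2 < 1)
    (hθs : |cs| ^ N + D.C * ∑ j : Fin N, tailNorm j chs.ρ ≤ θ)
    (hθu : |c| ^ N + D.C * ∑ j : Fin N, tailNorm j chu.ρ ≤ θ) {z : ℂ} (hz : θ < ‖z‖) :
    z ∉ spectrum ℂ (restOp chs chu P Q D cs c) := by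
  have hθ0 : 0 ≤ θ := le_trans (add_nonneg (by positivity) (mul_nonneg D.C_nonneg
    (Finset.sum_nonneg fun _ _ => tailNorm_nonneg _ _))) hθs
  have hz0 : z ≠ 0 := norm_pos_iff.1 (hθ0.trans_lt hz)
  have hAu : ∀ φ x, x ∉ chu.dom → chu.unstableOp D c φ x = 0 := fun φ x hx =>
    chu.unstableOp_apply_of_notMem D c φ hx
  have hQA : ∀ φ x, x ∉ chu.dom → (Q + chu.unstableOp D c) φ x = 0 := fun φ x hx => by
    rw [add_apply, B.add_apply, h.Q_apply φ x hx, hAu φ x hx, add_zero]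
  have hPQA : ∀ φ x, x ∈ chs.dom → (P + (Q + chu.unstableOp D c)) φ x = 0 := fun φ x hx => by
    rw [add_apply, B.add_apply, h.P_apply φ x (Or.inl hx), hQA φ x (h.disj x hx), add_zero]
  obtain ⟨n, hn⟩ := h.P_pow
  have hQ2 : Q ^ 2 = 0 := by
    rw [sq]
    exact ContinuousLinearMap.ext fun φ => h.Q_eq_zero _ (h.Q_apply φ)
  refine notMem_spectrum_add_of_mul_eq_zero ?_ hz0 (chs.stableOp_notMem_spectrum D hcs hθs hz)
    (notMem_spectrum_add_of_mul_eq_zero ?_ hz0 (notMem_spectrum_of_pow_eq_zero hn hz0)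
      (notMem_spectrum_add_of_mul_eq_zero ?_ hz0 (notMem_spectrum_of_pow_eq_zero hQ2 hz0)
        (chu.unstableOp_notMem_spectrum D hc hθu hz)))
  · exact ContinuousLinearMap.ext fun φ => chs.stableOp_eq_zero D cs (hPQA φ)
  · exact ContinuousLinearMap.ext fun φ => h.P_eq_zero _ (hQA φ)
  · exact ContinuousLinearMap.ext fun φ => h.Q_eq_zero _ (hAu φ)

/-- Triangularity is what makes the leading modes exact: functions supported in the unstable chart
are invisible to the stable block, to `P` and to `Q`, and functionals supported in the stable chart
see only the stable block. -/
theorem deflated (h : BlockData chs chu P Q) (mu lam : Fin N → ℝ) :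
    Deflated N (restOp chs chu P Q D cs c) (upOp chs chu P Q D cs c mu lam)
      (fun j => chu.wHeB j) (fun i => chs.dualB D i) (fun j => chu.fnW D j)
      (fun i => chs.fnHe i) (fun j => (mu j : ℂ)) (fun i => (lam i : ℂ)) where
  eq := upOp_apply _ _ _ _ _ _ _ _ _
  R_φ j := by
    have hw : ∀ x, x ∉ chu.dom → chu.wHeB j x = 0 := fun x hx => chu.wHeB_apply_of_notMem j hx
    refine B.ext_apply fun x => ?_
    rw [restOp_apply, chs.stableOp_eq_zero D cs fun x hx => hw x (h.disj x hx),
      h.P_eq_zero _ hw, h.Q_eq_zero _ hw, chu.unstableOp_wHeB]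
    simp
  m_R i u := by
    have e : restOp chs chu P Q D cs c u =
        chs.stableOp D cs u + (P + (Q + chu.unstableOp D c)) u := by rw [restOp, add_apply]
    rw [e, (chs.fnHe i).map_add, chs.fnHe_stableOp, zero_add]
    refine chs.fnHe_eq_zero i fun x hx => ?_
    rw [add_apply, add_apply, B.add_apply, B.add_apply, h.P_apply u x (Or.inl hx),
      h.Q_apply u x (h.disj x hx), chu.unstableOp_apply_of_notMem D c u (h.disj x hx)]
    simp
  m_φ i j := chs.fnHe_eq_zero i fun x hx => chu.wHeB_apply_of_notMem j (h.disj x hx)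
  l_φ i j := chu.fnW_wHeB D i j
  m_g i j := chs.fnHe_dualB D i j

theorem upOp_apply_stable (h : BlockData chs chu P Q) (mu lam : Fin N → ℝ) (φ : B) {x : S1}
    (hx : x ∈ chs.dom) : upOp chs chu P Q D cs c mu lam φ x =
      (chs.stableOp D cs φ + ∑ i : Fin N, ((lam i : ℂ) * chs.fnHe i φ) • chs.dualB D i : B) x := by
  have hxu := h.disj x hx
  rw [upOp_apply, B.add_apply, B.add_apply, restOp_apply, h.P_apply φ x (Or.inl hx),
    h.Q_apply φ x hxu, chu.unstableOp_apply_of_notMem D c φ hxu, B.add_apply,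
    B.sum_apply _ fun j : Fin N => ((mu j : ℂ) * chu.fnW D j φ) • chu.wHeB j]
  simp_rw [B.smul_apply, chu.wHeB_apply_of_notMem _ hxu]
  simp

theorem upOp_apply_unstable (h : BlockData chs chu P Q) (mu lam : Fin N → ℝ) (φ : B) {x : S1}
    (hx : x ∈ chu.dom) : upOp chs chu P Q D cs c mu lam φ x =
      Q φ x + (chu.unstableOp D c φ x + ∑ j : Fin N, ((mu j : ℂ) * chu.fnW D j φ) * chu.wHeB j x) := by
  have hxs := h.notMem_dom_of_mem hx
  rw [upOp_apply, B.add_apply, B.add_apply, restOp_apply, h.P_apply φ x (Or.inr hx),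
    chs.stableOp_apply_of_notMem D cs φ hxs, B.sum_apply, B.sum_apply]
  simp_rw [B.smul_apply, chs.dualB_apply_of_notMem D _ hxs]
  simp [add_assoc]

theorem upOp_apply_outside (h : BlockData chs chu P Q) (mu lam : Fin N → ℝ) (φ : B) {x : S1}
    (hxs : x ∉ chs.dom) (hxu : x ∉ chu.dom) : upOp chs chu P Q D cs c mu lam φ x = P φ x := by
  rw [upOp_apply, B.add_apply, B.add_apply, restOp_apply, chs.stableOp_apply_of_notMem D cs φ hxs,
    h.Q_apply φ x hxu, chu.unstableOp_apply_of_notMem D c φ hxu, B.sum_apply, B.sum_apply]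
  simp_rw [B.smul_apply, chs.dualB_apply_of_notMem D _ hxs, chu.wHeB_apply_of_notMem _ hxu]
  simp

end BlockData

end Blocks

/-! ### The blocks of the transition operator -/

section Transition

variable {f : S1 → S1} {σ : S1 → ℝ} (hf : Measurable f) (hσ : Measurable σ) (ε M : ℝ)
  (chs chu : Chart)

/-- The complement of the charts. -/
def outside : Set S1 := (chs.dom ∪ chu.dom)ᶜ

theorem measurableSet_outside : MeasurableSet (outside chs chu) :=
  (chs.measurableSet_dom.union chu.measurableSet_dom).compl

/-- The transitions from outside of the charts. -/
def outsideOp : B →L[ℂ] B :=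
  transientOp hf hσ (ε := ε) (M := M) (outside chs chu) chu.dom (measurableSet_outside chs chu)
    chu.measurableSet_dom

/-- The transitions which leave the chart at the unstable fixed point. -/
def exitOp : B →L[ℂ] B :=
  (restr chu.dom chu.measurableSet_dom).comp
    ((transOp f σ hf hσ ε).comp (restr chu.domᶜ chu.measurableSet_dom.compl))

theorem exitOp_apply (φ : B) : exitOp hf hσ ε chu φ = restr chu.dom chu.measurableSet_dom
    (transOp f σ hf hσ ε (restr chu.domᶜ chu.measurableSet_dom.compl φ)) := rfl

theorem restr_compl_eq_zero {U : Set S1} {hU : MeasurableSet U} {φ : B}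
    (h : ∀ x, x ∉ U → φ x = 0) : restr Uᶜ hU.compl φ = 0 := by
  refine B.ext_apply fun x => ?_
  by_cases hx : x ∈ Uᶜ
  · rw [restr_apply_of_mem hx, h x hx, B.zero_apply]
  · rw [restr_apply_of_notMem hx, B.zero_apply]

theorem isRealOp_outsideOp : IsRealOp (outsideOp hf hσ ε M chs chu) :=
  (isRealOp_restr _ _).mul ((isRealOp_truncOp _ _ hf hσ).mul (isRealOp_restr _ _))

theorem isRealOp_exitOp : IsRealOp (exitOp hf hσ ε chu) :=
  (isRealOp_restr _ _).mul ((isRealOp_transOp ε hf hσ).mul (isRealOp_restr _ _))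

variable {ε M chs chu}

theorem blockData (hdisj : ∀ x ∈ chs.dom, x ∉ chu.dom)
    (hpow : ∃ n, outsideOp hf hσ ε M chs chu ^ n = 0) :
    BlockData chs chu (outsideOp hf hσ ε M chs chu) (exitOp hf hσ ε chu) where
  disj := hdisj
  P_apply φ x hx := by
    rw [outsideOp, transientOp_apply, restr_apply_of_notMem]
    exact fun h => h hx
  P_eq_zero φ hφ := by
    rw [outsideOp, transientOp_apply, restr_compl_eq_zero (hU := chu.measurableSet_dom) hφ, ContinuousLinearMap.map_zero,
      ContinuousLinearMap.map_zero]
  P_pow := hpow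
  Q_apply φ x hx := by rw [exitOp_apply, restr_apply_of_notMem hx]
  Q_eq_zero φ hφ := by
    rw [exitOp_apply, restr_compl_eq_zero (hU := chu.measurableSet_dom) hφ, ContinuousLinearMap.map_zero,
      ContinuousLinearMap.map_zero]

/-- Exits from the unstable chart are kept exactly, so the comparison there concerns only the part
of φ inside the chart. -/
theorem exitOp_apply_of_mem (φ : B) {x : S1} (hx : x ∈ chu.dom) : exitOp hf hσ ε chu φ x =
    transOp f σ hf hσ ε φ x - transOp f σ hf hσ ε (restr chu.dom chu.measurableSet_dom φ) x := by
  have e : restr chu.domᶜ chu.measurableSet_dom.compl φ =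
      φ - restr chu.dom chu.measurableSet_dom φ := B.ext_apply fun y => by
    rw [B.sub_apply]
    by_cases hy : y ∈ chu.dom
    · rw [restr_apply_of_mem hy, restr_apply_of_notMem (by simpa using hy), sub_self]
    · rw [restr_apply_of_notMem hy, restr_apply_of_mem hy, sub_zero]
  rw [exitOp_apply, restr_apply_of_mem hx, e, ContinuousLinearMap.map_sub, B.sub_apply]

theorem Chart.transOp_apply_eq (ch : Chart) (φ : B) (x : S1) : transOp f σ hf hσ ε φ x =
    ∫ z, φ (ch.pt (rep (f x - ch.x₀) / ch.κ + ε * σ x / ch.κ * z)) ∂stdG := by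
  rw [transOp_apply]
  congr 1
  ext z
  have hκ := ch.κ_pos.ne'
  have e : ch.κ * (rep (f x - ch.x₀) / ch.κ + ε * σ x / ch.κ * z) =
      rep (f x - ch.x₀) + ε * σ x * z := by field_simp
  have e2 : ch.pt (rep (f x - ch.x₀) / ch.κ + ε * σ x / ch.κ * z) =
      f x + ((ε * σ x * z : ℝ) : S1) := by
    rw [Chart.pt, e, AddCircle.coe_add, coe_rep, ← add_assoc, add_sub_cancel]
  rw [e2]

theorem norm_restr_le (U : Set S1) (hU : MeasurableSet U) (φ : B) : ‖restr U hU φ‖ ≤ ‖φ‖ :=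
  B.norm_le (norm_nonneg _) fun x => by
    by_cases hx : x ∈ U
    · rw [restr_apply_of_mem hx]; exact φ.norm_apply_le x
    · rw [restr_apply_of_notMem hx]; simp

end Transition

/-! ### Comparison of the transition operator with the model -/

theorem Chart.coord_pt_of_lt_pi (ch : Chart) {t : ℝ} (ht : |t| < Real.pi / ch.κ) :
    ch.coord (ch.pt t) = t := by
  have h : |ch.κ * t| < Real.pi := by
    rw [abs_mul, abs_of_pos ch.κ_pos, mul_comm]
    exact (lt_div_iff₀ ch.κ_pos).1 ht
  rw [coord, pt, add_sub_cancel_left, rep_coe_of_abs_lt h, mul_div_cancel_left₀ _ ch.κ_pos.ne']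

theorem Chart.κ_le (ch : Chart) : ch.κ ≤ ch.κ * ch.ρ ^ 2 :=
  le_mul_of_one_le_right ch.κ_pos.le (one_le_pow₀ ch.one_le_ρ)

theorem Chart.κ_mul_ρ_le (ch : Chart) : ch.κ * ch.ρ ≤ ch.κ * ch.ρ ^ 2 := by
  have := ch.one_le_ρ
  have := ch.κ_pos
  gcongr
  nlinarith

theorem Chart.restr_dom_pt (ch : Chart) (φ : B) {t : ℝ} (ht : |t| < Real.pi / ch.κ) :
    restr ch.dom ch.measurableSet_dom φ (ch.pt t) = ch.pull φ t := by
  have hc := ch.coord_pt_of_lt_pi ht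
  by_cases h : |t| < ch.ρ
  · rw [ch.pull_of_lt φ h, restr_apply_of_mem]
    rwa [Chart.dom, Set.mem_ofPred_eq, hc]
  · rw [ch.pull_of_le φ (not_lt.1 h), restr_apply_of_notMem]
    rwa [Chart.dom, Set.mem_ofPred_eq, hc]

/-- At the stable fixed point the transition operator is close to its model. -/
theorem exists_stable_row {f : S1 → S1} (hf : IsSmoothMap f) {σ : S1 → ℝ} (hσ : Continuous σ)
    {x₀ : S1} (hx : f x₀ = x₀) (hσ₀ : 0 < σ x₀) {c : ℝ} (hc : c = circleDeriv f x₀) (hc1 : |c| < 1)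
    {a : ℝ} (ha : 0 < a) (has : σ x₀ / a = √(1 - c ^ 2)) {N : ℕ} (D : DualHe N) {η : ℝ}
    (hη : 0 < η) : ∃ R : ℝ, ∃ δ > 0, ∀ (ch : Chart) (ε : ℝ), ch.x₀ = x₀ → 0 < ε → ch.κ = a * ε →
      R ≤ ch.ρ → ch.κ * ch.ρ ^ 2 < δ → ∀ (φ : B), ∀ x ∈ ch.dom,
      ‖transOp f σ hf.continuous.measurable hσ.measurable ε φ x - (ch.stableOp D c φ +
        ∑ j : Fin N, ((c : ℂ) ^ (j : ℕ) * ch.fnHe j φ) • ch.dualB D j : B) x‖ ≤ η * ‖φ‖ := by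
  have hc2 : c ^ 2 < 1 := (sq_lt_one_iff_abs_lt_one c).2 hc1
  have hs : 0 < σ x₀ / a := by positivity
  obtain ⟨δ, hδ, hlin⟩ := exists_norm_linearization_sub_le hf hσ hx hσ₀ ha
    (show 0 < η / 3 by positivity)
  obtain ⟨L, hL⟩ := (tendsto_gaussTail.eventually_lt_const (show 0 < η / 6 by positivity)).exists
  have htail : Tendsto (fun ρ => D.C * ∑ j : Fin N, tailNorm j ρ) atTop (𝓝 0) := by
    have h := (tendsto_finsetSum Finset.univ fun (j : Fin N) _ => tendsto_tailNorm j).const_mul D.C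
    simpa using h
  -- The lower bound on ρ gives |c|ρ + (σ/a)L ≤ ρ: noise below L does not lead out of the stable
  -- chart, so killing costs only a Gaussian tail.
  obtain ⟨R, hR⟩ := eventually_atTop.1 ((htail.eventually_lt_const
    (show 0 < η / 3 by positivity)).and (eventually_ge_atTop (σ x₀ / a * L / (1 - |c|))))
  refine ⟨R, δ, hδ, fun ch ε hch hε hκ hρ hκρ φ x hxd => ?_⟩
  obtain ⟨hR1, hR2⟩ := hR ch.ρ hρ
  rw [div_le_iff₀ (by linarith)] at hR2
  have hcd : |ch.coord x| < ch.ρ := hxd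
  have h1 := hlin ch ε hch hε hκ hκρ x hxd (fun t => φ (ch.pt t)) ‖φ‖
    (φ.measurable.comp ch.measurable_pt) fun t => φ.norm_apply_le _
  have e1 := ch.transOp_apply_eq hf.continuous.measurable hσ.measurable (ε := ε) φ x
  rw [hch] at e1
  rw [← e1, ← hc] at h1
  have h2 := norm_integral_affine_sub_le_gaussTail (G := fun t => φ (ch.pt t)) (ψ := ch.pull φ)
    (K := ‖φ‖) (R := ch.ρ) (L := L) (m := c * ch.coord x) (φ.measurable.comp ch.measurable_pt)
    (ch.measurable_pull φ) (fun t => φ.norm_apply_le _) (ch.norm_pull_le φ)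
    (fun t ht => (ch.pull_of_lt φ ht).symm) hs (by
      rw [abs_mul]
      have := mul_le_mul_of_nonneg_left hcd.le (abs_nonneg c)
      linarith)
  have e2 : ∫ z, ch.pull φ (c * ch.coord x + σ x₀ / a * z) ∂stdG = ch.ouOp c φ x := by
    rw [Chart.ouOp_apply, ch.pushFun_of_mem _ hxd, ou, has]
  rw [e2] at h2
  have h3 := (B.norm_apply_le _ x).trans (ch.norm_stable_sub_ouOp_le D hc2.le φ)
  rw [B.sub_apply, norm_sub_rev] at h3
  have h4 : D.C * ∑ j : Fin N, tailNorm j ch.ρ * 1 ≤ η / 3 := by simpa using hR1.le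
  have h5 : (D.C * ∑ j : Fin N, tailNorm j ch.ρ) * ‖φ‖ ≤ η / 3 * ‖φ‖ := by gcongr
  have h6 : 2 * ‖φ‖ * gaussTail L ≤ η / 3 * ‖φ‖ := by
    have := mul_le_mul_of_nonneg_left hL.le (norm_nonneg φ)
    linarith
  refine (norm_sub_le_norm_sub_add_norm_sub _ (ch.ouOp c φ x) _).trans ?_
  have h7 := norm_sub_le_norm_sub_add_norm_sub
    (transOp f σ hf.continuous.measurable hσ.measurable ε φ x)
    (∫ z, φ (ch.pt (c * ch.coord x + σ x₀ / a * z)) ∂stdG) (ch.ouOp c φ x)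
  linarith

set_option maxHeartbeats 1000000 in
/-- At the unstable fixed point the transition operator is close to its model. -/
theorem exists_unstable_row {f : S1 → S1} (hf : IsSmoothMap f) {σ : S1 → ℝ} (hσ : Continuous σ)
    {x₀ : S1} (hx : f x₀ = x₀) (hσ₀ : 0 < σ x₀) {c : ℝ} (hc : c⁻¹ = circleDeriv f x₀) (hc0 : c ≠ 0)
    (hc1 : |c| < 1) {a : ℝ} (ha : 0 < a) (has : σ x₀ / a = √(c⁻¹ ^ 2 - 1)) {N : ℕ} (D : DualHe N)
    {η : ℝ} (hη : 0 < η) : ∃ R : ℝ, ∃ δ > 0, ∀ (ch : Chart) (ε : ℝ), ch.x₀ = x₀ → 0 < ε →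
      ch.κ = a * ε → R ≤ ch.ρ → ch.κ * ch.ρ ^ 2 < δ → ∀ (φ : B), ∀ x ∈ ch.dom,
      ‖transOp f σ hf.continuous.measurable hσ.measurable ε (restr ch.dom ch.measurableSet_dom φ) x -
        (ch.unstableOp D c φ x + ∑ j : Fin N,
          (((|c| * c ^ (j : ℕ) * (1 + ε) : ℝ) : ℂ) * ch.fnW D j φ) * ch.wHeB j x)‖ ≤ η * ‖φ‖ := by
  have hc2 : c ^ 2 < 1 := (sq_lt_one_iff_abs_lt_one c).2 hc1
  have hs : 0 < σ x₀ / a := by positivity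
  have hw := wt_pos 1
  have hDC := D.C_nonneg
  obtain ⟨δ, hδ, hlin⟩ := exists_norm_linearization_sub_le hf hσ hx hσ₀ ha
    (show 0 < η / 4 by positivity)
  obtain ⟨L, hL, hL0⟩ := ((tendsto_gaussTail.eventually_lt_const
    (show 0 < η / 8 by positivity)).and (eventually_gt_atTop 0)).exists
  obtain ⟨C, hC0, hC⟩ := exists_abs_wHe_le N
  -- The error has four parts, each allowed η/4: linearization, noise beyond L, cutting off the
  -- Hermite polynomials, and the factor 1 + ε. This value makes the third one fit.
  set η' : ℝ := η / (4 * (N * (D.C / wt 1) + 1)) with hη'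
  have hη'0 : 0 < η' := by positivity
  have hη'1 : N * (D.C / wt 1 * η') ≤ η / 4 := by
    have h0 : 0 ≤ N * (D.C / wt 1) := by positivity
    rw [← mul_assoc, hη', mul_div_assoc', div_le_div_iff₀ (by positivity) (by norm_num)]
    nlinarith
  have hev : ∀ᶠ ρ : ℝ in atTop, ∀ j ∈ Finset.range N, ∀ t, ρ ≤ |t| → wt t * |He j t| ≤ η' :=
    (Finset.eventually_all _).2 fun j _ => eventually_wt_mul_He_le j hη'0
  obtain ⟨R, hR⟩ := eventually_atTop.1 hev
  set b : ℝ := N * (D.C / wt 1) * C with hb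
  have hb0 : 0 ≤ b := by positivity
  -- The chart may be left here, but φ has been restricted to it. The middle bound keeps the
  -- expanded chart plus noise below L within |t| < π/κ, where the restriction agrees with its
  -- extension by zero and no winding occurs; the last bound gives ε b ≤ η/4.
  refine ⟨R, min δ (min (Real.pi / (|c⁻¹| + σ x₀ / a * L)) (a * (η / (4 * (b + 1))))), by
    have := Real.pi_pos
    positivity, fun ch ε hch hε hκ hρ hκρ φ x hxd => ?_⟩
  rw [lt_min_iff, lt_min_iff, lt_div_iff₀ (by positivity)] at hκρ
  have hκ0 := ch.κ_pos
  have hcd : |ch.coord x| < ch.ρ := hxd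
  set ψ := restr ch.dom ch.measurableSet_dom φ with hψ
  have hψφ : ‖ψ‖ ≤ ‖φ‖ := norm_restr_le _ _ φ
  have hψb : ∀ t, ‖ψ (ch.pt t)‖ ≤ ‖φ‖ := fun t => (ψ.norm_apply_le _).trans hψφ
  have h1 := hlin ch ε hch hε hκ hκρ.1 x hxd (fun t => ψ (ch.pt t)) ‖φ‖
    (ψ.measurable.comp ch.measurable_pt) hψb
  have e1 := ch.transOp_apply_eq hf.continuous.measurable hσ.measurable (ε := ε) ψ x
  rw [hch] at e1
  rw [← e1, ← hc] at h1
  have h2 := norm_integral_affine_sub_le_gaussTail (G := fun t => ψ (ch.pt t)) (ψ := ch.pull φ)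
    (K := ‖φ‖) (R := Real.pi / ch.κ) (L := L) (m := c⁻¹ * ch.coord x)
    (ψ.measurable.comp ch.measurable_pt)
    (ch.measurable_pull φ) hψb (ch.norm_pull_le φ)
    (fun t ht => ch.restr_dom_pt φ ht) hs (by
      rw [le_div_iff₀ hκ0, abs_mul]
      have g1 : |c⁻¹| * |ch.coord x| + σ x₀ / a * L ≤ (|c⁻¹| + σ x₀ / a * L) * ch.ρ := by
        rw [add_mul]
        have g2 : σ x₀ / a * L * 1 ≤ σ x₀ / a * L * ch.ρ := by
          gcongr
          exact ch.one_le_ρ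
        have g3 := mul_le_mul_of_nonneg_left hcd.le (abs_nonneg c⁻¹)
        linarith
      calc _ ≤ (|c⁻¹| + σ x₀ / a * L) * ch.ρ * ch.κ := by gcongr
        _ = (ch.κ * ch.ρ) * (|c⁻¹| + σ x₀ / a * L) := by ring
        _ ≤ (ch.κ * ch.ρ ^ 2) * (|c⁻¹| + σ x₀ / a * L) := by
          gcongr ?_ * _
          exact ch.κ_mul_ρ_le
        _ ≤ _ := hκρ.2.1.le)
  rw [has] at h2 h1
  have h3 := ch.norm_unstable_sub_le D hc0 hc2 hη'0.le
    (fun j hj t ht => hR ch.ρ hρ j (Finset.mem_range.2 hj) t ht) φ hxd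
  have h4 : ε * b ≤ η / 4 := by
    have g1 : a * ε < a * (η / (4 * (b + 1))) := by
      rw [← hκ]
      exact ch.κ_le.trans_lt hκρ.2.2
    have g2 := lt_of_mul_lt_mul_left g1 ha.le
    rw [lt_div_iff₀ (by positivity)] at g2
    nlinarith
  have h5 := (B.norm_apply_le _ x).trans (ch.norm_sum_fnW_le D (a := ε)
    (b := fun j => ((|c| * c ^ (j : ℕ) * ε : ℝ) : ℂ)) hC hC0 (fun j => by
      rw [Complex.norm_real, norm_mul, norm_mul, norm_pow, Real.norm_eq_abs, Real.norm_eq_abs,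
        abs_abs, Real.norm_of_nonneg hε.le]
      have g1 : |c| * |c| ^ (j : ℕ) ≤ 1 := by
        rw [← pow_succ']
        exact pow_le_one₀ (abs_nonneg _) hc1.le
      nlinarith) φ)
  rw [B.sum_apply] at h5
  simp_rw [B.smul_apply] at h5
  set I := ∫ z, ch.pull φ (c⁻¹ * ch.coord x + √(c⁻¹ ^ 2 - 1) * z) ∂stdG
  set J := ∫ z, ψ (ch.pt (c⁻¹ * ch.coord x + √(c⁻¹ ^ 2 - 1) * z)) ∂stdG
  set T := transOp f σ hf.continuous.measurable hσ.measurable ε ψ x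
  set A := ch.unstableOp D c φ x
  have e3 : ∑ j : Fin N, (((|c| * c ^ (j : ℕ) * (1 + ε) : ℝ) : ℂ) * ch.fnW D j φ) * ch.wHeB j x =
      ∑ j : Fin N, (((|c| * c ^ (j : ℕ) : ℝ) : ℂ) * ch.fnW D j φ) * ch.wHeB j x +
      ∑ j : Fin N, (((|c| * c ^ (j : ℕ) * ε : ℝ) : ℂ) * ch.fnW D j φ) * ch.wHeB j x := by
    rw [← Finset.sum_add_distrib]
    refine Finset.sum_congr rfl fun j _ => ?_
    push_cast
    ring
  rw [e3]
  set S₁ := ∑ j : Fin N, (((|c| * c ^ (j : ℕ) : ℝ) : ℂ) * ch.fnW D j φ) * ch.wHeB j x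
  set S₂ := ∑ j : Fin N, (((|c| * c ^ (j : ℕ) * ε : ℝ) : ℂ) * ch.fnW D j φ) * ch.wHeB j x
  have e4 : T - (A + (S₁ + S₂)) = (T - J) + (J - I) - (A + S₁ - I) - S₂ := by ring
  rw [e4]
  have h6 : ‖(T - J) + (J - I) - (A + S₁ - I) - S₂‖ ≤ ‖T - J‖ + ‖J - I‖ + ‖A + S₁ - I‖ + ‖S₂‖ :=
    (norm_sub_le _ _).trans (add_le_add ((norm_sub_le _ _).trans
      (add_le_add (norm_add_le _ _) le_rfl)) le_rfl)
  have h7 : 2 * ‖φ‖ * gaussTail L ≤ η / 4 * ‖φ‖ := by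
    have := mul_le_mul_of_nonneg_left hL.le (norm_nonneg φ)
    linarith
  have h8 : N * (D.C / wt 1 * η') * ‖φ‖ ≤ η / 4 * ‖φ‖ := by gcongr
  have h9 : N * (ε * (D.C / wt 1) * C) * ‖φ‖ ≤ η / 4 * ‖φ‖ := by
    rw [show N * (ε * (D.C / wt 1) * C) = ε * b by rw [hb]; ring]
    gcongr
  linarith

set_option maxHeartbeats 1000000 in
/-- Outside of the charts, the transition operator is close to a nilpotent one. -/
theorem exists_blockData {f : S1 → S1} (hf : IsSmoothMap f) {σ : S1 → ℝ} (hσ : Continuous σ)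
    {xs xu : S1} (hxs : f xs = xs) (hxu : f xu = xu) (hcs : |circleDeriv f xs| < 1)
    (hcu : 1 < |circleDeriv f xu|)
    (hlim : ∀ x : S1, x ≠ xu → Tendsto (fun n : ℕ => f^[n] x) atTop (𝓝 xs)) {as au M : ℝ}
    (has : 0 < as) (hau : 0 < au) (hM : 0 < M) : ∃ R : ℝ, ∃ δ > 0, ∀ (chs chu : Chart) (ε : ℝ),
      chs.x₀ = xs → chu.x₀ = xu → 0 < ε → chs.κ = as * ε → chu.κ = au * ε → R ≤ chs.ρ → R ≤ chu.ρ →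
      chs.κ * chs.ρ ^ 2 < δ → chu.κ * chu.ρ ^ 2 < δ →
      BlockData chs chu (outsideOp hf.continuous.measurable hσ.measurable ε M chs chu)
        (exitOp hf.continuous.measurable hσ.measurable ε chu) ∧
      ∀ (φ : B) (x : S1), x ∉ chs.dom → x ∉ chu.dom →
        ‖transOp f σ hf.continuous.measurable hσ.measurable ε φ x -
          outsideOp hf.continuous.measurable hσ.measurable ε M chs chu φ x‖ ≤
        ‖φ‖ * gaussTail M := by
  have hfm := hf.continuous.measurable
  obtain ⟨C₀, hC₀⟩ := isCompact_univ.exists_bound_of_continuousOn hσ.continuousOn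
  set C : ℝ := max C₀ 1 with hCdef
  have hC1 : 0 < C := lt_max_of_lt_right one_pos
  have hC : ∀ x, |σ x| ≤ C := fun x => (hC₀ x trivial).trans (le_max_left _ _)
  have hne : xs ≠ xu := fun h => by rw [h] at hcs; linarith
  -- A point mapped to `xu` would stay there, contradicting convergence to `xs`.
  have hfne : ∀ x, x ≠ xu → f x ≠ xu := fun x hx hfx => by
    have h1 := (tendsto_add_atTop_iff_nat 1).2 (hlim x hx)
    have h2 : ∀ n : ℕ, f^[n + 1] x = xu := fun n => by
      rw [Function.iterate_succ_apply, hfx]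
      exact Function.iterate_fixed hxu n
    simp_rw [h2] at h1
    exact hne (tendsto_nhds_unique h1 tendsto_const_nhds)
  obtain ⟨p, hp1, hp⟩ := exists_between hcu
  obtain ⟨q, hq0, hq1⟩ := exists_between hcs
  obtain ⟨δu, hδu, hu⟩ := le_norm_of_expansion hf hxu hp
  obtain ⟨δs, hδs, hs⟩ := norm_le_of_expansion hf hxs hq0
  obtain ⟨c, hc, hnil⟩ := exists_no_long_pseudoOrbit hf.continuous hlim hp1
    ((abs_nonneg _).trans_lt hq0) hq1 hδs hδu hu hs
  obtain ⟨d, hd, hfar⟩ : ∃ d > 0, ∀ x, δu ≤ dist x xu → d ≤ dist (f x) xu := by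
    have hK : IsCompact {y : S1 | δu ≤ dist y xu} :=
      (isClosed_le continuous_const (continuous_id.dist continuous_const)).isCompact
    rcases Set.eq_empty_or_nonempty {y : S1 | δu ≤ dist y xu} with he | hn
    · refine ⟨1, one_pos, fun x hx => ?_⟩
      have : x ∈ {y : S1 | δu ≤ dist y xu} := hx
      rw [he] at this
      exact this.elim
    · obtain ⟨y, hy, hmin⟩ := hK.exists_isMinOn hn
        (f := fun y => dist (f y) xu) (hf.continuous.dist continuous_const).continuousOn
      refine ⟨dist (f y) xu, dist_pos.2 (hfne y fun h => ?_), fun x hx => hmin hx⟩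
      have h3 : δu ≤ dist y xu := hy
      rw [h, dist_self] at h3
      linarith
  have hdist : 0 < dist xs xu := dist_pos.2 hne
  -- The truncated noise moves points by at most εCM. Large ρ makes this at most c κρ in both charts
  -- and (p - 1)κρ at `xu`; the upper bounds separate the charts, keep the unstable one within d/2,
  -- and keep the noise below c and d/2.
  refine ⟨max (C * M / (c * as)) (max (C * M / (c * au)) (C * M / ((p - 1) * au))),
    min (dist xs xu / 2) (min (c * au / (C * M)) (min (d / 2) (d * au / (2 * (C * M))))), by positivity,
    fun chs chu ε hxs' hxu' hε hκs hκu hRs hRu hδs' hδu' => ?_⟩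
  rw [max_le_iff, max_le_iff] at hRs hRu
  rw [lt_min_iff, lt_min_iff, lt_min_iff] at hδs' hδu'
  have hCM : 0 < C * M := by positivity
  have hp0 : 0 < p - 1 := by linarith
  have gs := hRs.1
  have gu := hRu.2.1
  have gp := hRu.2.2
  rw [div_le_iff₀ (by positivity)] at gs gu gp
  have hκρs := chs.κ_mul_ρ_le
  have hκρu := chu.κ_mul_ρ_le
  have hκu1 := chu.κ_le
  have k1 : ε * C * M ≤ c * (chs.κ * chs.ρ) := by
    have := mul_le_mul_of_nonneg_left gs hε.le
    rw [hκs]; linarith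
  have k2 : ε * C * M ≤ c * (chu.κ * chu.ρ) := by
    have := mul_le_mul_of_nonneg_left gu hε.le
    rw [hκu]; linarith
  have k3 : ε * C * M ≤ (p - 1) * (chu.κ * chu.ρ) := by
    have := mul_le_mul_of_nonneg_left gp hε.le
    rw [hκu]; linarith
  have k4 : ε * C * M ≤ c := by
    have h1 := (hκu1.trans_lt hδu'.2.1)
    rw [hκu, lt_div_iff₀ hCM] at h1
    have h2 : au * (ε * C * M) ≤ au * c := by linarith
    exact le_of_mul_le_mul_left h2 hau
  have k5 : ε * C * M ≤ d / 2 := by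
    have h1 := (hκu1.trans_lt hδu'.2.2.2)
    rw [hκu, lt_div_iff₀ (by positivity)] at h1
    have h2 : au * (ε * C * M) ≤ au * (d / 2) := by linarith
    exact le_of_mul_le_mul_left h2 hau
  -- No return to the unstable chart: a nearby point outside it is sent to distance at least pκρ and
  -- the noise takes back at most (p - 1)κρ, while a far point lands at distance at least d. Killing
  -- in that chart therefore alters nothing off it.
  have hmove : ∀ x, x ∉ chu.dom → ∀ z, |z| < M → f x + ((ε * σ x * z : ℝ) : S1) ∉ chu.dom := by
    intro x hx z hz
    rw [chu.mem_dom_iff, hxu', not_lt] at hx ⊢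
    have h1 := dist_noise_le (f := f) hC hε.le (x := x) hz
    have h2 := dist_triangle (f x) (f x + ((ε * σ x * z : ℝ) : S1)) xu
    rw [dist_comm (f x) (f x + _)] at h2
    rcases lt_or_ge (dist x xu) δu with h3 | h3
    · have h4 := hu x h3
      have h5 := mul_le_mul_of_nonneg_left hx (show 0 ≤ p by linarith)
      linarith
    · have h4 := hfar x h3
      linarith [hδu'.2.2.1]
  refine ⟨blockData hfm hσ.measurable (fun x hx hx' => ?_) ?_, fun φ x hx hx' => ?_⟩
  · rw [Chart.mem_dom_iff, hxs'] at hx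
    rw [Chart.mem_dom_iff, hxu'] at hx'
    have h1 := dist_triangle xs x xu
    rw [dist_comm xs x] at h1
    linarith [hδs'.1, hδu'.1]
  · obtain ⟨n, hn⟩ := hnil (chu.κ * chu.ρ) (chs.κ * chs.ρ) (ε * C * M)
      (mul_pos chu.κ_pos chu.ρ_pos) (mul_pos chs.κ_pos chs.ρ_pos) k4 k2 k1
    refine ⟨n, transientOp_pow_eq_zero hfm hσ.measurable hC hε.le fun y hy => ?_⟩
    obtain ⟨i, hi, h1⟩ := hn y hy
    refine ⟨i, hi, fun hO => hO ?_⟩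
    rcases h1 with h1 | h1
    · exact Or.inr ((chu.mem_dom_iff _).2 (by rwa [hxu']))
    · exact Or.inl ((chs.mem_dom_iff _).2 (by rwa [hxs']))
  · have hxO : x ∈ outside chs chu := fun h => h.elim hx hx'
    rw [outsideOp, transientOp_apply_of_mem hfm hσ.measurable φ hxO (hmove x hx')]
    exact norm_transOp_sub_truncOp_le ε M hfm hσ.measurable φ x

/-! ### Choice of scales and spectral conclusions for the model -/

theorem eq_of_pow_eq_pow {x : ℝ} (hx : |x| < 1) {i k : ℕ} (h : x ^ i = x ^ k) (h0 : x ^ i ≠ 0) :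
    i = k := by
  rcases eq_or_ne x 0 with rfl | hx0
  · have h1 : i = 0 := by
      by_contra hi
      exact h0 (zero_pow hi)
    have h2 : k = 0 := by
      by_contra hk
      exact h0 (h ▸ zero_pow hk)
    rw [h1, h2]
  · refine pow_right_injective₀ (abs_pos.2 hx0) hx.ne ?_
    simp only [← abs_pow, h]

/-- If a = b, any ε > 0 separates the two values; otherwise continuity at ε = 0 does. -/
theorem eventually_ne_mul_one_add (a : ℝ) {b : ℝ} (hb : b ≠ 0) :
    ∀ᶠ ε : ℝ in 𝓝[>] 0, a ≠ b * (1 + ε) := by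
  rcases eq_or_ne a b with rfl | hab
  · filter_upwards [self_mem_nhdsWithin] with ε hε h
    have hε' : 0 < ε := hε
    have : a * ε = 0 := by linarith
    exact (mul_ne_zero hb hε'.ne') this
  · have h : Tendsto (fun ε : ℝ => b * (1 + ε)) (𝓝 0) (𝓝 b) := by
      have : Continuous fun ε : ℝ => b * (1 + ε) := by fun_prop
      simpa using this.tendsto 0
    exact ((h.eventually_ne hab.symm).filter_mono nhdsWithin_le_nhds).mono fun ε hε => hε.symm

/-- The prescribed scales α and β are those for which the rescaled noise has variance 1 - c² or c_u²
- 1, as the Gaussian model requires. -/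
theorem div_inv_sqrt_two_mul_sqrt {s y : ℝ} (hs : 0 < s) (hy : 0 < y) :
    s / (√2 * √(y / (2 * s ^ 2)))⁻¹ = √y := by
  have h2 : √2 ≠ 0 := by positivity
  rw [Real.sqrt_div hy.le, Real.sqrt_mul (by norm_num), Real.sqrt_sq hs.le]
  field_simp

/-- The cutoff radius, in the rescaled coordinates. -/
def cutoffRadius (ε : ℝ) : ℝ := (√(√ε))⁻¹

theorem tendsto_cutoffRadius : Tendsto cutoffRadius (𝓝[>] 0) atTop := by
  refine tendsto_inv_nhdsGT_zero.comp (tendsto_nhdsWithin_iff.2 ⟨?_, ?_⟩)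
  · have h : Continuous fun ε : ℝ => √(√ε) := by fun_prop
    have := (h.tendsto 0).mono_left (nhdsWithin_le_nhds (s := Set.Ioi (0 : ℝ)))
    simpa using this
  · filter_upwards [self_mem_nhdsWithin] with ε hε
    have : 0 < ε := hε
    exact Real.sqrt_pos.2 (Real.sqrt_pos.2 this)

theorem cutoffRadius_pow {ε : ℝ} (hε : 0 < ε) : ε⁻¹ = cutoffRadius ε ^ 4 := by
  rw [cutoffRadius, inv_pow, show 4 = 2 * 2 by norm_num, pow_mul, Real.sq_sqrt (Real.sqrt_nonneg _),
    Real.sq_sqrt hε.le]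

/-- The exponent -1/4 reconciles three demands: ρ → ∞ for the tails, ερ² → 0 for the linearization,
and 1/ε equal to a fixed power of ρ for the decay of ψ. -/
theorem tendsto_mul_cutoffRadius_sq (a : ℝ) :
    Tendsto (fun ε => a * ε * cutoffRadius ε ^ 2) (𝓝[>] 0) (𝓝 0) := by
  have h : Continuous fun ε : ℝ => a * √ε := by fun_prop
  have h1 := (h.tendsto 0).mono_left (nhdsWithin_le_nhds (s := Set.Ioi (0 : ℝ)))
  rw [Real.sqrt_zero, mul_zero] at h1
  refine h1.congr' ?_
  filter_upwards [self_mem_nhdsWithin] with ε hε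
  have hε' : 0 < ε := hε
  have hs : √ε ≠ 0 := (Real.sqrt_pos.2 hε').ne'
  rw [cutoffRadius, inv_pow, Real.sq_sqrt (Real.sqrt_nonneg _)]
  nth_rewrite 2 [← Real.mul_self_sqrt hε'.le]
  field_simp

section Conclusion

variable {chs chu : Chart} {P Q : B →L[ℂ] B} {N : ℕ} {D : DualHe N} {cs c r ε k K α β : ℝ}

/-- The eigenvalues imposed at the unstable fixed point; the factor `1 + ε` removes resonances. -/
def muFn (N : ℕ) (c ε : ℝ) (j : Fin N) : ℝ := |c| * c ^ (j : ℕ) * (1 + ε)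

/-- The eigenvalues imposed at the stable fixed point. -/
def lamFn (N : ℕ) (cs : ℝ) (i : Fin N) : ℝ := cs ^ (i : ℕ)

theorem muFn_injective (hc0 : c ≠ 0) (hc : |c| < 1) (hε : 0 < ε) {j l : Fin N}
    (h : muFn N c ε j = muFn N c ε l) : j = l := by
  have h1 : 1 + ε ≠ 0 := by positivity
  rw [muFn, muFn, mul_left_inj' h1, mul_right_inj' (abs_ne_zero.2 hc0)] at h
  exact Fin.ext (eq_of_pow_eq_pow hc h (pow_ne_zero _ hc0))

theorem stable_conclusion (h : BlockData chs chu P Q) (hr : 0 < r)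
    (hrest : ∀ z : ℂ, r < ‖z‖ → z ∉ spectrum ℂ (restOp chs chu P Q D cs c)) (hcs : |cs| < 1)
    (hne : ∀ i j : Fin N, lamFn N cs i ≠ muFn N c ε j) (hε : 0 < ε) (hα : 0 < α)
    (hκ : chs.κ = ε / (√2 * α)) (h1 : chs.κ * chs.ρ ≤ 1) (i : Fin N)
    (hdecay : GaussianDecay k K (cutoff i α ε chs.ρ)) (hi : r < |cs ^ (i : ℕ)|) :
    IsSimpleEigenvalue (upOp chs chu P Q D cs c (muFn N c ε) (lamFn N cs)) (lamFn N cs i : ℂ) ∧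
      (lamFn N cs i : ℂ) ∈ spectrum ℂ (upOp chs chu P Q D cs c (muFn N c ε) (lamFn N cs)) ∧
      HermiteEigendensities (upOp chs chu P Q D cs c (muFn N c ε) (lamFn N cs)) (lamFn N cs i : ℂ) i
        α ε chs.x₀ 1 k K := by
  have hd := h.deflated D cs c (muFn N c ε) (lamFn N cs)
  have hz : r < ‖(lamFn N cs i : ℂ)‖ := by rwa [Complex.norm_real]
  have hz0 : (lamFn N cs i : ℂ) ≠ 0 := norm_pos_iff.1 (hr.trans hz)
  have hmu : ∀ j, (muFn N c ε j : ℂ) ≠ lamFn N cs i := fun j hj =>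
    hne i j (Complex.ofReal_injective hj).symm
  have hlam : ∀ l, l ≠ i → (lamFn N cs l : ℂ) ≠ lamFn N cs i := fun l hl hl2 => by
    have h2 : cs ^ (i : ℕ) = cs ^ (l : ℕ) := (Complex.ofReal_injective hl2).symm
    exact hl (Fin.ext (eq_of_pow_eq_pow hcs h2 (Complex.ofReal_ne_zero.1 hz0)).symm)
  obtain ⟨hs, hmem⟩ := hd.finrank_maxGenEigenspace_lam (hrest _ hz) hz0 hmu rfl hlam
  refine ⟨hs, hmem, chs.hermiteEigendensities hα hε hκ h1 hdecay (hd.m_T i)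
    ⟨chs.dualB D i, ?_⟩ fun F hF => hd.eigenfunctional_lam (hrest _ hz) hz0 hmu hlam F hF⟩
  rw [chs.fnHe_dualB, if_pos rfl]
  exact one_ne_zero

theorem unstable_conclusion (h : BlockData chs chu P Q) (hr : 0 < r)
    (hrest : ∀ z : ℂ, r < ‖z‖ → z ∉ spectrum ℂ (restOp chs chu P Q D cs c)) (hc0 : c ≠ 0)
    (hc : |c| < 1) (hne : ∀ i j : Fin N, lamFn N cs i ≠ muFn N c ε j) (hε : 0 < ε) (hβ : 0 < β)
    (hκ : chu.κ = ε / (√2 * β)) (h1 : chu.κ * chu.ρ ≤ 1) (j : Fin N)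
    (hdecay : GaussianDecay k K (cutoff j β ε chu.ρ)) (hj : r < |muFn N c ε j|) :
    IsSimpleEigenvalue (upOp chs chu P Q D cs c (muFn N c ε) (lamFn N cs)) (muFn N c ε j : ℂ) ∧
      (muFn N c ε j : ℂ) ∈ spectrum ℂ (upOp chs chu P Q D cs c (muFn N c ε) (lamFn N cs)) ∧
      HermiteEigenfunctions (upOp chs chu P Q D cs c (muFn N c ε) (lamFn N cs)) (muFn N c ε j : ℂ) j
        β ε chu.x₀ 1 k K := by
  have hd := h.deflated D cs c (muFn N c ε) (lamFn N cs)
  have hz : r < ‖(muFn N c ε j : ℂ)‖ := by rwa [Complex.norm_real]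
  have hz0 : (muFn N c ε j : ℂ) ≠ 0 := norm_pos_iff.1 (hr.trans hz)
  have hlam : ∀ i, (lamFn N cs i : ℂ) ≠ muFn N c ε j := fun i hi =>
    hne i j (Complex.ofReal_injective hi)
  have hmu : ∀ l, l ≠ j → (muFn N c ε l : ℂ) ≠ muFn N c ε j := fun l hl hl2 =>
    hl (muFn_injective hc0 hc hε (Complex.ofReal_injective hl2))
  obtain ⟨hs, huniq⟩ := hd.finrank_maxGenEigenspace_φ (hrest _ hz) hz0 hlam rfl hmu
  exact ⟨hs, Deflated.mem_spectrum_of_eigenvector (hd.φ_ne_zero j) (hd.T_φ j),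
    chu.hermiteEigenfunctions hβ hε hκ h1 hdecay (hd.T_φ j) (hd.φ_ne_zero j) huniq⟩

theorem eigenvalue_cases (h : BlockData chs chu P Q) (hr : 0 < r)
    (hrest : ∀ z : ℂ, r < ‖z‖ → z ∉ spectrum ℂ (restOp chs chu P Q D cs c)) {μ : ℂ}
    (hμ : μ ∈ spectrum ℂ (upOp chs chu P Q D cs c (muFn N c ε) (lamFn N cs))) (hμr : r < ‖μ‖) :
    (∃ i, μ = (lamFn N cs i : ℂ)) ∨ ∃ j, μ = (muFn N c ε j : ℂ) := by
  by_contra! hcon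
  exact (h.deflated D cs c (muFn N c ε) (lamFn N cs)).notMem_spectrum (hrest _ hμr)
    (norm_pos_iff.1 (hr.trans hμr)) (fun j hj => hcon.2 j hj.symm) (fun i hi => hcon.1 i hi.symm) hμ

end Conclusion

end CirclePert

end

/-! ### Assembly of the theorem -/

open CirclePert
set_option maxHeartbeats 1000000 in
theorem theorem3
    (f : S1 → S1) (hf : IsSmoothMap f)
    (σ : S1 → ℝ) (hσ : IsSmoothFun σ) (hσ_pos : ∀ x, 0 < σ x)
    (xs xu : S1) (hxs : f xs = xs) (hxu : f xu = xu)
    (cs cu : ℝ) (hcs : cs = circleDeriv f xs) (hcu : cu = circleDeriv f xu)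
    (hstable : |cs| < 1) (hunstable : 1 < |cu|)
    (hlim : ∀ x : S1, x ≠ xu → Tendsto (fun n : ℕ => f^[n] x) atTop (𝓝 xs)) :
    ∃ δs ∈ Set.Ioo 0 Real.pi, ∃ δu ∈ Set.Ioo 0 Real.pi, ∃ k > 0, ∀ r : ℝ, 0 < r →
      ∃ εr > 0, ∃ L > 0, ∃ K > 0, ∀ ε : ℝ, 0 < ε → ε < εr →
        ∃ Tup Tlp : B →L[ℂ] B, IsRealOp Tup ∧ IsRealOp Tlp ∧
          transOp f σ hf.continuous.measurable hσ.continuous.measurable ε = Tup + Tlp ∧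
          ‖Tlp‖ < r ∧
          -- every spectral value outside the disc of radius `r` is simple and of type (i) or (ii)
          (∀ μ ∈ spectrum ℂ Tup, r < ‖μ‖ →
            IsSimpleEigenvalue Tup μ ∧
            ((∃ j : ℕ, ‖μ - (cs : ℂ) ^ j‖ ≤ L * ε ∧
                HermiteEigendensities Tup μ j (stableScale cs (σ xs)) ε xs δs k K) ∨
              (∃ j : ℕ, ‖μ - ((|cu|⁻¹ * (cu⁻¹) ^ j : ℝ) : ℂ)‖ ≤ L * ε ∧
                HermiteEigenfunctions Tup μ j (unstableScale cu (σ xu)) ε xu δu k K))) ∧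
          -- every limiting value outside the disc of radius `r` does occur
          (∀ j : ℕ, r < |cs ^ j| → ∃ μ ∈ spectrum ℂ Tup, ‖μ - (cs : ℂ) ^ j‖ ≤ L * ε ∧
            HermiteEigendensities Tup μ j (stableScale cs (σ xs)) ε xs δs k K) ∧
          (∀ j : ℕ, r < |cu|⁻¹ * |cu⁻¹ ^ j| →
            ∃ μ ∈ spectrum ℂ Tup, ‖μ - ((|cu|⁻¹ * (cu⁻¹) ^ j : ℝ) : ℂ)‖ ≤ L * ε ∧
            HermiteEigenfunctions Tup μ j (unstableScale cu (σ xu)) ε xu δu k K) := by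
  have hσc := hσ.continuous
  have hσs := hσ_pos xs
  have hσu := hσ_pos xu
  have hcs2 : 0 < 1 - cs ^ 2 := by
    have := (sq_lt_one_iff_abs_lt_one cs).2 hstable
    linarith
  have hcu2 : 0 < cu ^ 2 - 1 := by
    have := (one_lt_sq_iff_one_lt_abs cu).2 hunstable
    linarith
  have hcu0 : cu ≠ 0 := abs_pos.1 (one_pos.trans hunstable)
  set α := stableScale cs (σ xs) with hα_def
  set β := unstableScale cu (σ xu) with hβ_def
  have hα : 0 < α := Real.sqrt_pos.2 (by positivity)
  have hβ : 0 < β := Real.sqrt_pos.2 (by positivity)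
  set as : ℝ := (√2 * α)⁻¹ with has_def
  set au : ℝ := (√2 * β)⁻¹ with hau_def
  have has0 : 0 < as := by positivity
  have hau0 : 0 < au := by positivity
  have has : σ xs / as = √(1 - cs ^ 2) := div_inv_sqrt_two_mul_sqrt hσs hcs2
  set c : ℝ := cu⁻¹ with hc_def
  have hcinv : c⁻¹ = cu := inv_inv cu
  have hau : σ xu / au = √(c⁻¹ ^ 2 - 1) := by
    rw [hcinv]
    exact div_inv_sqrt_two_mul_sqrt hσu hcu2
  have hc0 : c ≠ 0 := inv_ne_zero hcu0
  have hc1 : |c| < 1 := by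
    rw [hc_def, abs_inv]
    exact inv_lt_one_of_one_lt₀ hunstable
  have hcabs : |cu|⁻¹ = |c| := (abs_inv cu).symm
  -- Any k strictly below α² and β² leaves room for the polynomial factors; it must not depend on r.
  set k : ℝ := min (α ^ 2) (β ^ 2) / 2 with hk_def
  have hmin : 0 < min (α ^ 2) (β ^ 2) := by positivity
  have hkα : k < α ^ 2 := (half_lt_self hmin).trans_le (min_le_left _ _)
  have hkβ : k < β ^ 2 := (half_lt_self hmin).trans_le (min_le_right _ _)
  have hπ : (1 : ℝ) < Real.pi := by linarith [Real.pi_gt_three]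
  refine ⟨1, ⟨one_pos, hπ⟩, 1, ⟨one_pos, hπ⟩, k, half_pos hmin, fun r hr => ?_⟩
  have hr4 : 0 < r / 4 := by positivity
  have hr2 : 0 < r / 2 := by positivity
  -- With |c_s|^N and |c|^N below r/4, and tail terms below r/4 later, the diagonal blocks get θ =
  -- r/2.
  obtain ⟨N, hNs, hNu⟩ := (((tendsto_pow_atTop_nhds_zero_of_lt_one (abs_nonneg cs)
    hstable).eventually_lt_const hr4).and ((tendsto_pow_atTop_nhds_zero_of_lt_one (abs_nonneg c)
    hc1).eventually_lt_const hr4)).exists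
  obtain ⟨D⟩ := nonempty_dualHe N
  obtain ⟨M, hM, hM0⟩ := ((tendsto_gaussTail.eventually_lt_const hr2).and
    (eventually_gt_atTop 0)).exists
  have htail : Tendsto (fun ρ => D.C * ∑ j : Fin N, tailNorm j ρ) atTop (𝓝 0) := by
    have h := (tendsto_finsetSum Finset.univ fun (j : Fin N) _ => tendsto_tailNorm j).const_mul D.C
    simpa using h
  obtain ⟨R₁, δ₁, hδ₁, hrow_s⟩ := exists_stable_row hf hσc hxs hσs hcs hstable has0 has D hr2
  obtain ⟨R₂, δ₂, hδ₂, hrow_u⟩ := exists_unstable_row hf hσc hxu hσu (hcinv.trans hcu) hc0 hc1 hau0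
    hau D hr2
  obtain ⟨R₃, δ₃, hδ₃, hblock⟩ := exists_blockData hf hσc hxs hxu (hcs ▸ hstable) (hcu ▸ hunstable)
    hlim has0 hau0 hM0
  choose Ks hKs0 hKs using fun j : ℕ => exists_gaussianDecay_cutoff j hkα
  choose Ku hKu0 hKu using fun j : ℕ => exists_gaussianDecay_cutoff j hkβ
  -- Only modes with j < N carry eigenvalues beyond r, so one constant depending on r serves all of
  -- them.
  set K : ℝ := ∑ j ∈ Finset.range N, (Ks j + Ku j) + 1 with hK_def
  have hKsum : 0 ≤ ∑ j ∈ Finset.range N, (Ks j + Ku j) :=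
    Finset.sum_nonneg fun j _ => add_nonneg (hKs0 j) (hKu0 j)
  have hKle : ∀ j < N, Ks j + Ku j ≤ K := fun j hj => by
    have := Finset.single_le_sum (f := fun j => Ks j + Ku j)
      (fun j _ => add_nonneg (hKs0 j) (hKu0 j)) (Finset.mem_range.2 hj)
    linarith
  have hev : ∀ᶠ ε : ℝ in 𝓝[>] 0, (1 ≤ cutoffRadius ε ∧ R₁ ≤ cutoffRadius ε ∧ R₂ ≤ cutoffRadius ε ∧
      R₃ ≤ cutoffRadius ε ∧ D.C * ∑ j : Fin N, tailNorm j (cutoffRadius ε) < r / 4) ∧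
      (as * ε * cutoffRadius ε ^ 2 < min 1 (min δ₁ δ₃) ∧
        au * ε * cutoffRadius ε ^ 2 < min 1 (min δ₂ δ₃)) ∧
      ∀ i j : Fin N, lamFn N cs i ≠ muFn N c ε j := by
    refine (tendsto_cutoffRadius.eventually ((eventually_ge_atTop 1).and
      ((eventually_ge_atTop R₁).and ((eventually_ge_atTop R₂).and ((eventually_ge_atTop R₃).and
      (htail.eventually_lt_const hr4)))))).and ((((tendsto_mul_cutoffRadius_sq as).eventually_lt_const
      (by positivity)).and ((tendsto_mul_cutoffRadius_sq au).eventually_lt_const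
      (by positivity))).and ?_)
    refine eventually_all.2 fun i => eventually_all.2 fun j => ?_
    exact eventually_ne_mul_one_add _ (mul_ne_zero (abs_ne_zero.2 hc0) (pow_ne_zero _ hc0))
  obtain ⟨εr, hεr, hsub⟩ := mem_nhdsGT_iff_exists_Ioo_subset.1 hev
  refine ⟨εr, hεr, 1, one_pos, K, by positivity, fun ε hε hεlt => ?_⟩
  obtain ⟨⟨hρ1, hρR₁, hρR₂, hρR₃, hρtail⟩, ⟨hδs, hδu⟩, hres⟩ := hsub ⟨hε, hεlt⟩
  rw [lt_min_iff, lt_min_iff] at hδs hδu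
  set ρ := cutoffRadius ε with hρ_def
  have hρρ : ρ ≤ ρ ^ 2 := by nlinarith
  have hsmall : ∀ a : ℝ, 0 < a → a * ε * ρ ^ 2 < 1 → a * ε * ρ < 1 := fun a ha h =>
    (mul_le_mul_of_nonneg_left hρρ (by positivity)).trans_lt h
  have hs1 := hsmall as has0 hδs.1
  have hu1 := hsmall au hau0 hδu.1
  set chs : Chart := ⟨xs, as * ε, ρ, by positivity, hρ1, hs1.trans hπ⟩ with hchs
  set chu : Chart := ⟨xu, au * ε, ρ, by positivity, hρ1, hu1.trans hπ⟩ with hchu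
  have hfm := hf.continuous.measurable
  have hσm := hσc.measurable
  obtain ⟨hb, hout⟩ := hblock chs chu ε rfl rfl hε rfl rfl hρR₃ hρR₃ hδs.2.2 hδu.2.2
  set P := outsideOp hfm hσm ε M chs chu with hP
  set Q := exitOp hfm hσm ε chu with hQ
  set U := upOp chs chu P Q D cs c (muFn N c ε) (lamFn N cs) with hU
  have hUreal : IsRealOp U := isRealOp_upOp _ _ _ _ _ _ _ (isRealOp_outsideOp hfm hσm ε M chs chu)
    (isRealOp_exitOp hfm hσm ε chu) _ _
  have hrest : ∀ z : ℂ, r < ‖z‖ → z ∉ spectrum ℂ (restOp chs chu P Q D cs c) := fun z hz =>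
    hb.restOp_notMem_spectrum D cs c (θ := r / 2) (by linarith)
      ((sq_lt_one_iff_abs_lt_one c).2 hc1) (by change _ + D.C * ∑ j : Fin N, tailNorm j ρ ≤ _; linarith)
      (by change _ + D.C * ∑ j : Fin N, tailNorm j ρ ≤ _; linarith) (by linarith)
  have hκs : chs.κ = ε / (√2 * α) := by
    change as * ε = _
    rw [has_def, div_eq_inv_mul]
  have hκu : chu.κ = ε / (√2 * β) := by
    change au * ε = _
    rw [hau_def, div_eq_inv_mul]
  have hdec_s : ∀ i : Fin N, GaussianDecay k K (cutoff i α ε chs.ρ) := fun i y =>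
    (hKs i ε ρ hε (by linarith) (cutoffRadius_pow hε) y).trans (by linarith [hKle i i.2, hKu0 i])
  have hdec_u : ∀ i : Fin N, GaussianDecay k K (cutoff i β ε chu.ρ) := fun i y =>
    (hKu i ε ρ hε (by linarith) (cutoffRadius_pow hε) y).trans (by linarith [hKle i i.2, hKs0 i])
  have hS := fun i => stable_conclusion hb hr hrest hstable hres hε hα hκs hs1.le i (hdec_s i)
  have hV := fun i => unstable_conclusion hb hr hrest hc0 hc1 hres hε hβ hκu hu1.le i (hdec_u i)
  have hlam : ∀ i : Fin N, ((lamFn N cs i : ℝ) : ℂ) = (cs : ℂ) ^ (i : ℕ) := fun i => by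
    rw [lamFn, Complex.ofReal_pow]
  have hlam_dist : ∀ i : Fin N, ‖((lamFn N cs i : ℝ) : ℂ) - (cs : ℂ) ^ (i : ℕ)‖ ≤ 1 * ε := fun i => by
    rw [hlam, sub_self, norm_zero, one_mul]
    exact hε.le
  have hmu_dist : ∀ j : Fin N,
      ‖((muFn N c ε j : ℝ) : ℂ) - ((|cu|⁻¹ * c ^ (j : ℕ) : ℝ) : ℂ)‖ ≤ 1 * ε := fun j => by
    rw [hcabs, ← Complex.ofReal_sub, Complex.norm_real, muFn,
      show |c| * c ^ (j : ℕ) * (1 + ε) - |c| * c ^ (j : ℕ) = |c| * c ^ (j : ℕ) * ε by ring, norm_mul,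
      norm_mul, norm_pow, Real.norm_eq_abs, Real.norm_eq_abs, abs_abs, Real.norm_of_nonneg hε.le,
      ← pow_succ']
    gcongr
    exact pow_le_one₀ (abs_nonneg _) hc1.le
  refine ⟨U, transOp f σ hfm hσm ε - U, hUreal, (isRealOp_transOp ε hfm hσm).sub hUreal,
    (add_sub_cancel _ _).symm, ?_, fun μ hμ hμr => ?_, fun j hj => ?_, fun j hj => ?_⟩
  · have hhalf : ‖transOp f σ hfm hσm ε - U‖ ≤ r / 2 := by
      refine ContinuousLinearMap.opNorm_le_bound _ hr2.le fun φ => B.norm_le (by positivity) fun x => ?_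
      rw [sub_apply, B.sub_apply, hU]
      by_cases hxs' : x ∈ chs.dom
      · rw [hb.upOp_apply_stable D cs c _ _ φ hxs']
        simp_rw [hlam]
        exact hrow_s chs ε rfl hε rfl hρR₁ hδs.2.1 φ x hxs'
      by_cases hxu' : x ∈ chu.dom
      · rw [hb.upOp_apply_unstable D cs c _ _ φ hxu', hQ, exitOp_apply_of_mem hfm hσm φ hxu']
        have h := hrow_u chu ε rfl hε rfl hρR₂ hδu.2.1 φ x hxu'
        rw [sub_add_eq_sub_sub, sub_sub_cancel]
        exact h
      · rw [hb.upOp_apply_outside D cs c _ _ φ hxs' hxu']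
        refine (hout φ x hxs' hxu').trans ?_
        rw [mul_comm]
        gcongr
    linarith
  · rcases eigenvalue_cases hb hr hrest hμ hμr with ⟨i, rfl⟩ | ⟨j, rfl⟩
    · have h := hS i (by rwa [Complex.norm_real] at hμr)
      exact ⟨h.1, Or.inl ⟨i, hlam_dist i, h.2.2⟩⟩
    · have h := hV j (by rwa [Complex.norm_real] at hμr)
      exact ⟨h.1, Or.inr ⟨j, hmu_dist j, h.2.2⟩⟩
  -- Indices from N on are excluded, because |c_s|^N < r/4.
  · have hjN : j < N := by
      by_contra hle
      have h1 := pow_le_pow_of_le_one (abs_nonneg cs) hstable.le (not_lt.1 hle)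
      rw [abs_pow] at hj
      linarith
    have h := hS ⟨j, hjN⟩ hj
    exact ⟨_, h.2.1, hlam_dist ⟨j, hjN⟩, h.2.2⟩
  · rw [hcabs, abs_pow] at hj
    have hjN : j < N := by
      by_contra hle
      have h1 := pow_le_pow_of_le_one (abs_nonneg c) hc1.le (not_lt.1 hle)
      have h2 := mul_le_of_le_one_left (pow_nonneg (abs_nonneg c) j) hc1.le
      linarith
    -- The factor 1 + ε only increases the modulus, so the perturbed eigenvalue still exceeds r.
    have h := hV ⟨j, hjN⟩ (by
      rw [muFn, abs_mul, abs_mul, abs_abs, abs_pow, abs_of_pos (show 0 < 1 + ε by positivity)]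
      have h3 : 0 ≤ |c| * |c| ^ j := by positivity
      change r < |c| * |c| ^ j * (1 + ε)
      nlinarith)
    exact ⟨_, h.2.1, hmu_dist ⟨j, hjN⟩, h.2.2⟩
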